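/- Let $\mathcal X_\lambda=P(x,y;\lambda)\partial_x+Q(x,y;\lambda)\partial_y$, $\lambda\in\Lambda\subset\mathbb R^d$, be a family of planar vector fields that is real analytic in $(x,y,\lambda)$ near $\{(0,0)\}\times\Lambda$, and suppose that for every $\lambda\in\Lambda$ the origin is a monodromic singularity (i.e. $P=Q=0$ there and the local orbits turn around it). Let $(p,q)$ be coprime positive weights associated with an edge of the Newton diagram of $\mathcal X_\lambda$ (for every $\lambda\in\Lambda$), and let $r=r(\lambda)\ge 0$ be the degree of the leading part of the expansion of $\mathcal X_\lambda$ into $(p,q)$-quasihomogeneous vector fields. In the weighted polar coordinates $(x,y)=(\rho^p\cos\varphi,\rho^q\sin\varphi)$ write $\dot\rho=\rho^{r}R(\varphi,\rho)$, $\dot\varphi=\rho^{r}\Theta(\varphi,\rho)$, where $R$ and $\Theta$ extend analytically to $\rho=0$ and $R(\varphi,0)=0$; let $\mathcal F=R/\Theta$ and consider the equation $$\frac{d\rho}{d\varphi}=\mathcal F(\varphi,\rho).\qquad(3)$$ Let $\Omega_{pq}=\{\varphi\in\mathbb R/2\pi\mathbb Z:\Theta(\varphi,0)=0\}$ be the set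 of characteristic directions, and let $\Lambda_{pq}\subset\Lambda$ be the set of those $\lambda$ for which $\Theta$ has zeros with $0<\rho<\varepsilon$ for every $\varepsilon>0$. For $\lambda\in\Lambda\setminus\Lambda_{pq}$ let $\Phi(\varphi;\rho_0)$ be the solution of (3) with $\Phi(0;\rho_0)=\rho_0$, for small $\rho_0>0$, and let $\Pi(\rho_0)=\Phi(2\pi;\rho_0)$ be the Poincaré map. Assume that $0\notin\Omega_{pq}$ for all $\lambda\in\Lambda$, and that there is $m\in\mathbb Z$ such that for every $\lambda\in\Lambda\setminus\Lambda_{pq}$ equation (3) has a Laurent inverse integrating factor $V$ of multiplicity $m$. This means: $V(\varphi,\rho)$ is $2\pi$-periodic in $\varphi$, of class $C^1$ and not locally null for $0<\rho\ll1$, and satisfies $$\frac{\partial V}{\partial\varphi}+\frac{\partial V}{\partial\rho}\,\mathcal F=\frac{\partial\mathcal F}{\partial\rho}\,V ;$$ for each $\varphi\notin\Omega_{pq}$ one has a convergent expansion $V(\varphi,\rho)=\sum_{i\ge m}v_i(\varphi)\rho^i$ for small $\rho>0$, with $C^1$ functions $v_i:\mathbb S^1\setminus\Omega_{pq}\to\mathbb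 R$; and the leading coefficient $v_m$ is not identically zero on the connected component of $\mathbb S^1\setminus\Omega_{pq}$ that contains the direction $\varphi=0$. Then for every $\lambda\in\Lambda\setminus\Lambda_{pq}$ the Poincaré map $\Pi$ is defined for all small $\rho>0$ and has a formal power series (asymptotic) expansion $\Pi(\rho)=\sum_{i\ge1}\eta_i\rho^i$ as $\rho\to0^+$. Moreover: (i) if $m\le 0$, then the origin is a center; (ii) if $m>1$, then $\Pi(\rho)=\rho+\eta_m\rho^m(1+O(\rho))$; in particular, if $\eta_m=0$, then the origin is a center; (iii) if $m=1$ and $\eta_1=1$, then the origin is a center. -/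

import Mathlib

open Set Filter Topology

noncomputable section

namespace Monodromic

/-! ### Newton diagram, weights and quasihomogeneous expansion -/

/-- The coefficient of `x ^ i * y ^ j` in the Taylor series of `f` at the origin. -/
def taylorCoeff (f : ℝ → ℝ → ℝ) (i j : ℕ) : ℝ :=
  iteratedDeriv i (fun x => iteratedDeriv j (fun y => f x y) 0) 0 / (i.factorial * j.factorial)

/-- The support of `P ∂x + Q ∂y`, where `P = ∑ a i j * x ^ i * y ^ (j - 1)` and
`Q = ∑ b i j * x ^ (i - 1) * y ^ j`: the pairs `(i, j)` with `(a i j, b i j) ≠ (0, 0)`. -/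
def support (P Q : ℝ → ℝ → ℝ) : Set (ℕ × ℕ) :=
  {s | (1 ≤ s.2 ∧ taylorCoeff P s.1 (s.2 - 1) ≠ 0) ∨
    (1 ≤ s.1 ∧ taylorCoeff Q (s.1 - 1) s.2 ≠ 0)}

/-- `s` is a point of the support at which `p * i + q * j` is minimal, i.e. a point of the support
on the face of the Newton polygon with inner normal `(p, q)`. -/
def OnFace (P Q : ℝ → ℝ → ℝ) (p q : ℕ) (s : ℕ × ℕ) : Prop :=
  s ∈ support P Q ∧ ∀ t ∈ support P Q, p * s.1 + q * s.2 ≤ p * t.1 + q * t.2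

/-- The set of weights of the Newton diagram: coprime positive `(p, q)` for which the face with
inner normal `(p, q)` is an edge, that is, contains two different points of the support. -/
def newtonWeights (P Q : ℝ → ℝ → ℝ) : Set (ℕ × ℕ) :=
  {w | 0 < w.1 ∧ 0 < w.2 ∧ Nat.Coprime w.1 w.2 ∧
    ∃ s t, s ≠ t ∧ OnFace P Q w.1 w.2 s ∧ OnFace P Q w.1 w.2 t}

/-- The `(p, q)`-quasihomogeneous part of degree `n` of the function `f` analytic at the origin:
the coefficient of `t ^ n` in `f (t ^ p * x) (t ^ q * y)`. -/
def quasiPart (p q : ℕ) (f : ℝ → ℝ → ℝ) (n : ℕ) (x y : ℝ) : ℝ :=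
  iteratedDeriv n (fun t : ℝ => f (t ^ p * x) (t ^ q * y)) 0 / n.factorial

/-- The expansion of `P ∂x + Q ∂y` into quasihomogeneous vector fields
`P_{p+j} ∂x + Q_{q+j} ∂y` of degree `j` starts exactly at `j = r`. -/
def IsLeadingDegree (p q r : ℕ) (P Q : ℝ → ℝ → ℝ) : Prop :=
  (∀ n < p + r, ∀ x y, quasiPart p q P n x y = 0) ∧
  (∀ n < q + r, ∀ x y, quasiPart p q Q n x y = 0) ∧
  ∃ x y, quasiPart p q P (p + r) x y ≠ 0 ∨ quasiPart p q Q (q + r) x y ≠ 0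

/-! ### The weighted polar blow-up `(x, y) = (ρ ^ p * cos φ, ρ ^ q * sin φ)` -/

/-- The value of `f` at the point with weighted polar coordinates `(φ, ρ)`. -/
def polar (p q : ℕ) (f : ℝ → ℝ → ℝ) (φ ρ : ℝ) : ℝ :=
  f (ρ ^ p * Real.cos φ) (ρ ^ q * Real.sin φ)

/-- The Jacobian of the weighted polar blow-up. -/
def jac (p q : ℕ) (φ ρ : ℝ) : ℝ :=
  ρ ^ (p + q - 1) * (p * Real.cos φ ^ 2 + q * Real.sin φ ^ 2)

/-- The angular component `Θ` of the polar vector field divided by `ρ ^ r`, together with its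
extension to `ρ = 0`, which comes from the leading part of the vector field. -/
def Theta (p q r : ℕ) (P Q : ℝ → ℝ → ℝ) (φ ρ : ℝ) : ℝ :=
  if ρ = 0 then
    (p * Real.cos φ * quasiPart p q Q (q + r) (Real.cos φ) (Real.sin φ)
      - q * Real.sin φ * quasiPart p q P (p + r) (Real.cos φ) (Real.sin φ))
      / (p * Real.cos φ ^ 2 + q * Real.sin φ ^ 2)
  else
    (p * ρ ^ (p - 1) * Real.cos φ * polar p q Q φ ρ
      - q * ρ ^ (q - 1) * Real.sin φ * polar p q P φ ρ) / (jac p q φ ρ * ρ ^ r)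

/-- The radial component `R` of the polar vector field divided by `ρ ^ r`; it is `0` at `ρ = 0`. -/
def Rad (p q r : ℕ) (P Q : ℝ → ℝ → ℝ) (φ ρ : ℝ) : ℝ :=
  (ρ ^ q * Real.cos φ * polar p q P φ ρ + ρ ^ p * Real.sin φ * polar p q Q φ ρ)
    / (jac p q φ ρ * ρ ^ r)

/-- The right-hand side of the equation `dρ/dφ = F (φ, ρ) = R (φ, ρ) / Θ (φ, ρ)`. -/
def F (p q r : ℕ) (P Q : ℝ → ℝ → ℝ) (φ ρ : ℝ) : ℝ :=
  Rad p q r P Q φ ρ / Theta p q r P Q φ ρ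

/-- The characteristic directions, as a `2π`-periodic set of angles. -/
def Omega (p q r : ℕ) (P Q : ℝ → ℝ → ℝ) : Set ℝ :=
  {φ | Theta p q r P Q φ 0 = 0}

/-- `Θ` has zeros with `ρ > 0` in every cylinder `0 ≤ ρ < ε`. -/
def HasZeroAngularSpeed (p q r : ℕ) (P Q : ℝ → ℝ → ℝ) : Prop :=
  ∀ ε > 0, ∃ φ ρ : ℝ, 0 < ρ ∧ ρ < ε ∧ Theta p q r P Q φ ρ = 0

/-- The `(p, q)`-critical parameters of a family with parameters in `Λ`
(the leading degree `r l` may depend on the parameter `l`). -/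
def criticalParams {d : ℕ} (p q : ℕ) (r : (Fin d → ℝ) → ℕ)
    (P Q : (Fin d → ℝ) → ℝ → ℝ → ℝ) (Λ : Set (Fin d → ℝ)) : Set (Fin d → ℝ) :=
  {l ∈ Λ | HasZeroAngularSpeed p q (r l) (P l) (Q l)}

/-! ### Monodromic singularities and centers -/

/-- `γ` restricted to `[0, T]` is a piece of an orbit of `x' = P, y' = Q` that makes exactly one
turn around the origin (in either sense) inside the punctured ball of radius `ε`; `θ` is a
continuous determination of the angle along it. -/
structure IsTurn (P Q : ℝ → ℝ → ℝ) (ε T : ℝ) (γ : ℝ → ℝ × ℝ) (θ : ℝ → ℝ) : Prop where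
  pos : 0 < T
  ode : ∀ t ∈ Icc 0 T,
    HasDerivWithinAt γ (P (γ t).1 (γ t).2, Q (γ t).1 (γ t).2) (Icc 0 T) t
  small : ∀ t ∈ Icc 0 T, ‖γ t‖ < ε
  cont : ContinuousOn θ (Icc 0 T)
  angle : ∀ t ∈ Icc 0 T, ∃ s > 0, γ t = (s * Real.cos (θ t), s * Real.sin (θ t))
  turn : |θ T - θ 0| = 2 * Real.pi

/-- The origin is a singularity and the local orbits turn around it. -/
def IsMonodromic (P Q : ℝ → ℝ → ℝ) : Prop :=
  P 0 0 = 0 ∧ Q 0 0 = 0 ∧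
  ∀ ε > 0, ∃ δ > 0, ∀ z : ℝ × ℝ, z ≠ 0 → ‖z‖ < δ →
    ∃ T γ θ, IsTurn P Q ε T γ θ ∧ γ 0 = z

/-- The origin is a center: it is a singularity and the orbits through all the other points near
it are closed orbits around it. -/
def IsCenter (P Q : ℝ → ℝ → ℝ) : Prop :=
  P 0 0 = 0 ∧ Q 0 0 = 0 ∧
  ∀ ε > 0, ∃ δ > 0, ∀ z : ℝ × ℝ, z ≠ 0 → ‖z‖ < δ →
    ∃ T γ θ, IsTurn P Q ε T γ θ ∧ γ 0 = z ∧ γ T = z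

/-! ### The Poincaré map -/

/-- `Π` is (a representative of the germ at `0` of) the Poincaré map: `Π ρ₀ = Φ (2π; ρ₀)`, where
`Φ (·; ρ₀)` solves `dρ/dφ = F (φ, ρ)`, `Φ (0; ρ₀) = ρ₀`, inside an arbitrarily small cylinder when
`ρ₀ > 0` is small enough. -/
def IsPoincareMap (p q r : ℕ) (P Q : ℝ → ℝ → ℝ) (Pi : ℝ → ℝ) : Prop :=
  ∀ ε > 0, ∃ δ > 0, ∀ ρ₀ : ℝ, 0 < ρ₀ → ρ₀ < δ →
    ∃ Φ : ℝ → ℝ, Φ 0 = ρ₀ ∧ Φ (2 * Real.pi) = Pi ρ₀ ∧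
      ∀ φ ∈ Icc 0 (2 * Real.pi), 0 < Φ φ ∧ Φ φ < ε ∧
        HasDerivWithinAt Φ (F p q r P Q φ (Φ φ)) (Icc 0 (2 * Real.pi)) φ

/-! ### Inverse integrating factors -/

/-- The open part `0 < ρ < ε`, `Θ ≠ 0` of the cylinder (angles are taken in `ℝ`). -/
def region (p q r : ℕ) (P Q : ℝ → ℝ → ℝ) (ε : ℝ) : Set (ℝ × ℝ) :=
  {z | 0 < z.2 ∧ z.2 < ε ∧ Theta p q r P Q z.1 z.2 ≠ 0}

/-- `V (φ, ρ)` is an inverse integrating factor of `dρ/dφ = F (φ, ρ)`: a function on the cylinder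
(`2π`-periodic in `φ`), not locally null and of class `C¹` where `0 < ρ < ε` and `Θ ≠ 0`,
that satisfies `∂V/∂φ + ∂V/∂ρ * F = ∂F/∂ρ * V`. -/
def IsInvIntFactor (p q r : ℕ) (P Q : ℝ → ℝ → ℝ) (V : ℝ → ℝ → ℝ) : Prop :=
  (∀ φ ρ, V (φ + 2 * Real.pi) ρ = V φ ρ) ∧
  ∃ ε > 0,
    ContDiffOn ℝ 1 (fun z : ℝ × ℝ => V z.1 z.2) (region p q r P Q ε) ∧
    (∀ W ⊆ region p q r P Q ε, IsOpen W → W.Nonempty → ∃ z ∈ W, V z.1 z.2 ≠ 0) ∧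
    ∀ z ∈ region p q r P Q ε,
      deriv (fun φ => V φ z.2) z.1 + deriv (fun ρ => V z.1 ρ) z.2 * F p q r P Q z.1 z.2
        = deriv (fun ρ => F p q r P Q z.1 ρ) z.2 * V z.1 z.2

/-- `V` is a Laurent inverse integrating factor of multiplicity `m`: for every non-characteristic
angle `φ` it is the sum of a convergent series `∑_{i ≥ m} v i φ * ρ ^ i` for small `ρ > 0`, the
coefficients are `C¹` functions on the complement of the characteristic directions, and the
leading coefficient `v m` does not vanish identically on the arc of non-characteristic directions
that contains the direction `φ = 0` of the transversal section. -/
def IsLaurentInvIntFactor (p q r : ℕ) (P Q : ℝ → ℝ → ℝ) (V : ℝ → ℝ → ℝ) (m : ℤ) : Prop :=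
  IsInvIntFactor p q r P Q V ∧
  ∃ v : ℤ → ℝ → ℝ,
    (∀ i φ, v i (φ + 2 * Real.pi) = v i φ) ∧
    (∀ i, m ≤ i → ContDiffOn ℝ 1 (v i) (Omega p q r P Q)ᶜ) ∧
    (∀ φ ∉ Omega p q r P Q, ∃ δ > 0, ∀ ρ : ℝ, 0 < ρ → ρ < δ →
      HasSum (fun k : ℕ => v (m + k) φ * ρ ^ (m + k : ℤ)) (V φ ρ)) ∧
    ∃ φ, (∀ ψ ∈ uIcc 0 φ, ψ ∉ Omega p q r P Q) ∧ v m φ ≠ 0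

/-- `f` has the asymptotic (formal power series) expansion `∑_{i ≥ 1} η i * ρ ^ i` as `ρ → 0⁺`. -/
def HasFormalExpansion (f : ℝ → ℝ) (η : ℕ → ℝ) : Prop :=
  ∀ N : ℕ, (fun ρ => f ρ - ∑ i ∈ Finset.Icc 1 N, η i * ρ ^ i)
    =O[𝓝[>] 0] (fun ρ : ℝ => ρ ^ (N + 1))

end Monodromic

end

/-!
Along a solution of `dρ/dφ = F`, an inverse integrating factor `V` solves the variational equation,
so the Poincaré map satisfies `Π' = V (0, Π) / V (0, ·)`. Every solution is comparable to `ρ₀` over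
an arc of non-characteristic directions, which propagates the non-vanishing of the leading
coefficient to `φ = 0`, whence `V (0, ρ) = ρ ^ m * g ρ` with `g` analytic and `g 0 ≠ 0`.
A primitive `W` of `1 / V (0, ·)` then makes `W ∘ Π - W` a constant `c`. If `c = 0`, then `Π = id`
and all orbits close up. If `m ≤ 0`, then `W` is continuous at `0`, which forces `c = 0`; otherwise
`W` is a Laurent polynomial plus a logarithm plus a smooth function, and the implicit function
theorem solves `W (ρ * ψ) = W ρ + c` for a smooth quotient `ψ = Π / ρ`.
-/

noncomputable section

namespace Monodromic

open Function

section ScalarODE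

variable {f : ℝ → ℝ → ℝ} {s : Set ℝ} {a b : ℝ}

/-- The partial derivative `∂f/∂ρ` at `(φ, ρ)`. -/
def dRho (f : ℝ → ℝ → ℝ) (φ ρ : ℝ) : ℝ := deriv (f φ) ρ

/-- `Φ` solves the scalar equation `dρ/dφ = f (φ, ρ)` on `[a, b]` with values in `s`. The derivative
is taken within `[a, b]`, hence one-sided at the endpoints. -/
structure IsSolOn (f : ℝ → ℝ → ℝ) (s : Set ℝ) (a b : ℝ) (Φ : ℝ → ℝ) : Prop where
  mem : MapsTo Φ (Icc a b) s
  ode : ∀ φ ∈ Icc a b, HasDerivWithinAt Φ (f φ (Φ φ)) (Icc a b) φ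

lemma hasFDerivAt_uncurry (hf : ContDiffOn ℝ 1 (uncurry f) (univ ×ˢ s)) (hs : IsOpen s)
    {φ ρ : ℝ} (hρ : ρ ∈ s) :
    HasFDerivAt (uncurry f) (fderiv ℝ (uncurry f) (φ, ρ)) (φ, ρ) :=
  ((hf.contDiffAt ((isOpen_univ.prod hs).mem_nhds ⟨mem_univ φ, hρ⟩)).differentiableAt
    one_ne_zero).hasFDerivAt

lemma hasDerivAt_snd (hf : ContDiffOn ℝ 1 (uncurry f) (univ ×ˢ s)) (hs : IsOpen s)
    {φ ρ : ℝ} (hρ : ρ ∈ s) : HasDerivAt (f φ) (fderiv ℝ (uncurry f) (φ, ρ) (0, 1)) ρ :=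
  (hasFDerivAt_uncurry hf hs hρ).comp_hasDerivAt (f := fun x ↦ (φ, x)) ρ
    ((hasDerivAt_const ρ φ).prodMk (hasDerivAt_id ρ))

lemma hasDerivAt_fst (hf : ContDiffOn ℝ 1 (uncurry f) (univ ×ˢ s)) (hs : IsOpen s)
    {φ ρ : ℝ} (hρ : ρ ∈ s) :
    HasDerivAt (fun x ↦ f x ρ) (fderiv ℝ (uncurry f) (φ, ρ) (1, 0)) φ :=
  (hasFDerivAt_uncurry hf hs hρ).comp_hasDerivAt (f := fun x ↦ (x, ρ)) φ
    ((hasDerivAt_id φ).prodMk (hasDerivAt_const φ ρ))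

lemma dRho_eq_fderiv (hf : ContDiffOn ℝ 1 (uncurry f) (univ ×ˢ s)) (hs : IsOpen s)
    {φ ρ : ℝ} (hρ : ρ ∈ s) : dRho f φ ρ = fderiv ℝ (uncurry f) (φ, ρ) (0, 1) :=
  (hasDerivAt_snd hf hs hρ).deriv

lemma hasDerivAt_dRho (hf : ContDiffOn ℝ 1 (uncurry f) (univ ×ˢ s)) (hs : IsOpen s)
    {φ ρ : ℝ} (hρ : ρ ∈ s) : HasDerivAt (f φ) (dRho f φ ρ) ρ :=
  (hasDerivAt_snd hf hs hρ).differentiableAt.hasDerivAt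

lemma contDiffOn_dRho {m n : WithTop ℕ∞} (hmn : m + 1 ≤ n)
    (hf : ContDiffOn ℝ n (uncurry f) (univ ×ˢ s)) (hs : IsOpen s) :
    ContDiffOn ℝ m (uncurry (dRho f)) (univ ×ˢ s) :=
  ((hf.fderiv_of_isOpen (isOpen_univ.prod hs) hmn).clm_apply contDiffOn_const).congr
    fun _ hz ↦ dRho_eq_fderiv (hf.of_le (le_add_self.trans hmn)) hs hz.2

lemma continuousOn_dRho (hf : ContDiffOn ℝ 1 (uncurry f) (univ ×ˢ s)) (hs : IsOpen s) :
    ContinuousOn (uncurry (dRho f)) (univ ×ˢ s) :=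
  (contDiffOn_dRho (m := 0) (zero_add _).le hf hs).continuousOn

lemma exists_abs_dRho_le (hf : ContDiffOn ℝ 1 (uncurry f) (univ ×ˢ s)) (hs : IsOpen s)
    {k K : ℝ} (hkK : Icc k K ⊆ s) :
    ∃ L, 0 ≤ L ∧ ∀ φ ∈ Icc a b, ∀ ρ ∈ Icc k K, |dRho f φ ρ| ≤ L := by
  obtain ⟨L, hL⟩ := (isCompact_Icc.prod isCompact_Icc).exists_bound_of_continuousOn
    ((continuousOn_dRho hf hs).mono (prod_mono (subset_univ (Icc a b)) hkK))
  exact ⟨max L 0, le_max_right _ _, fun φ hφ ρ hρ ↦ (hL (φ, ρ) ⟨hφ, hρ⟩).trans (le_max_left _ _)⟩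

lemma abs_sub_le_of_abs_dRho_le (hf : ContDiffOn ℝ 1 (uncurry f) (univ ×ˢ s)) (hs : IsOpen s)
    {k K L φ : ℝ} (hkK : Icc k K ⊆ s) (hL : ∀ ρ ∈ Icc k K, |dRho f φ ρ| ≤ L)
    {x y : ℝ} (hx : x ∈ Icc k K) (hy : y ∈ Icc k K) : |f φ y - f φ x| ≤ L * |y - x| :=
  (convex_Icc k K).norm_image_sub_le_of_norm_hasDerivWithin_le
    (fun _ hρ ↦ (hasDerivAt_dRho hf hs (hkK hρ)).hasDerivWithinAt) hL hx hy

lemma norm_le_mul_exp_of_norm_deriv_le {E : Type*} [NormedAddCommGroup E] [NormedSpace ℝ E]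
    {u u' : ℝ → E} {L : ℝ} (hu : ∀ x ∈ Icc a b, HasDerivWithinAt u (u' x) (Icc a b) x)
    (hL : ∀ x ∈ Icc a b, ‖u' x‖ ≤ L * ‖u x‖) {x : ℝ} (hx : x ∈ Icc a b) :
    ‖u x‖ ≤ ‖u a‖ * Real.exp (L * (x - a)) := by
  rw [← gronwallBound_ε0]
  refine norm_le_gronwallBound_of_norm_deriv_right_le
    (fun y hy ↦ (hu y hy).continuousWithinAt)
    (fun y hy ↦ ?_) le_rfl
    (fun y hy ↦ (hL y (Ico_subset_Icc_self hy)).trans_eq (add_zero _).symm) x hx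
  exact (hu y (Ico_subset_Icc_self hy)).mono_of_mem_nhdsWithin
    (mem_of_superset (Icc_mem_nhdsGE hy.2) (Icc_subset_Icc_left hy.1))

lemma norm_left_le_mul_exp_of_norm_deriv_le {E : Type*} [NormedAddCommGroup E] [NormedSpace ℝ E]
    {u u' : ℝ → E} {L : ℝ} (hu : ∀ x ∈ Icc a b, HasDerivWithinAt u (u' x) (Icc a b) x)
    (hL : ∀ x ∈ Icc a b, ‖u' x‖ ≤ L * ‖u x‖) {x : ℝ} (hx : x ∈ Icc a b) :
    ‖u x‖ ≤ ‖u b‖ * Real.exp (L * (b - x)) := by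
  have hmaps : MapsTo Neg.neg (Icc (-b) (-a)) (Icc a b) := fun y hy ↦
    ⟨le_neg_of_le_neg hy.2, neg_le_of_neg_le hy.1⟩
  have hrev : ∀ y ∈ Icc (-b) (-a),
      HasDerivWithinAt (fun y ↦ u (-y)) (-u' (-y)) (Icc (-b) (-a)) y := fun y hy ↦ by
    simpa [comp_def] using (hu (-y) (hmaps hy)).scomp y (hasDerivAt_neg y).hasDerivWithinAt hmaps
  have h := norm_le_mul_exp_of_norm_deriv_le hrev
    (fun y hy ↦ by simpa using hL (-y) (hmaps hy)) (x := -x) ⟨neg_le_neg hx.2, neg_le_neg hx.1⟩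
  simpa [sub_eq_add_neg, add_comm] using h

lemma norm_le_mul_exp_of_mem {E : Type*} [NormedAddCommGroup E] [NormedSpace ℝ E]
    {u u' : ℝ → E} {L : ℝ} (hL0 : 0 ≤ L)
    (hu : ∀ x ∈ Icc a b, HasDerivWithinAt u (u' x) (Icc a b) x)
    (hL : ∀ x ∈ Icc a b, ‖u' x‖ ≤ L * ‖u x‖) {x y : ℝ} (hx : x ∈ Icc a b) (hy : y ∈ Icc a b) :
    ‖u y‖ ≤ ‖u x‖ * Real.exp (L * (b - a)) := by
  rcases le_total x y with hxy | hxy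
  · have hsub : Icc x y ⊆ Icc a b := Icc_subset_Icc hx.1 hy.2
    refine (norm_le_mul_exp_of_norm_deriv_le (fun z hz ↦ (hu z (hsub hz)).mono hsub)
      (fun z hz ↦ hL z (hsub hz)) (right_mem_Icc.2 hxy)).trans ?_
    gcongr
    exacts [hy.2, hx.1]
  · have hsub : Icc y x ⊆ Icc a b := Icc_subset_Icc hy.1 hx.2
    refine (norm_left_le_mul_exp_of_norm_deriv_le (fun z hz ↦ (hu z (hsub hz)).mono hsub)
      (fun z hz ↦ hL z (hsub hz)) (left_mem_Icc.2 hxy)).trans ?_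
    gcongr
    exacts [hx.2, hy.1]

namespace IsSolOn

variable {Φ Ψ : ℝ → ℝ}

lemma continuousOn (h : IsSolOn f s a b Φ) : ContinuousOn Φ (Icc a b) :=
  fun φ hφ ↦ (h.ode φ hφ).continuousWithinAt

lemma mono (h : IsSolOn f s a b Φ) {a' b' : ℝ} (ha : a ≤ a') (hb : b' ≤ b) :
    IsSolOn f s a' b' Φ where
  mem := h.mem.mono_left (Icc_subset_Icc ha hb)
  ode φ hφ := (h.ode φ (Icc_subset_Icc ha hb hφ)).mono (Icc_subset_Icc ha hb)

lemma mono_set (h : IsSolOn f s a b Φ) {t : Set ℝ} (hst : s ⊆ t) : IsSolOn f t a b Φ :=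
  ⟨h.mem.mono_right hst, h.ode⟩

lemma congr (h : IsSolOn f s a b Φ) (hΨ : EqOn Ψ Φ (Icc a b)) : IsSolOn f s a b Ψ where
  mem := h.mem.congr hΨ.symm
  ode φ hφ := by
    rw [hΨ hφ]
    exact (h.ode φ hφ).congr hΨ (hΨ hφ)

lemma shift (h : IsSolOn f s a b Φ) {c : ℝ} (hper : ∀ φ ρ, f (φ + c) ρ = f φ ρ) :
    IsSolOn f s (a - c) (b - c) (fun φ ↦ Φ (φ + c)) := by
  have hmaps : MapsTo (· + c) (Icc (a - c) (b - c)) (Icc a b) := fun φ hφ ↦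
    ⟨sub_le_iff_le_add.1 hφ.1, le_sub_iff_add_le.1 hφ.2⟩
  refine ⟨h.mem.comp hmaps, fun φ hφ ↦ ?_⟩
  simpa [hper, Function.comp_def] using (h.ode _ (hmaps hφ)).scomp φ
    ((hasDerivAt_id φ).add_const c).hasDerivWithinAt hmaps

lemma exists_bounds (h : IsSolOn f s a b Φ) (hs : s.OrdConnected) (hab : a ≤ b) :
    ∃ k ∈ s, ∃ K ∈ s, Icc k K ⊆ s ∧ MapsTo Φ (Icc a b) (Icc k K) := by
  obtain ⟨x, hx, hmin⟩ := isCompact_Icc.exists_isMinOn (nonempty_Icc.2 hab) h.continuousOn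
  obtain ⟨y, hy, hmax⟩ := isCompact_Icc.exists_isMaxOn (nonempty_Icc.2 hab) h.continuousOn
  exact ⟨Φ x, h.mem hx, Φ y, h.mem hy, hs.out (h.mem hx) (h.mem hy),
    fun φ hφ ↦ ⟨hmin hφ, hmax hφ⟩⟩

lemma abs_sub_le (hf : ContDiffOn ℝ 1 (uncurry f) (univ ×ˢ s)) (hs : IsOpen s)
    (hΦ : IsSolOn f s a b Φ) (hΨ : IsSolOn f s a b Ψ) {k K L : ℝ} (hkK : Icc k K ⊆ s)
    (hL0 : 0 ≤ L) (hL : ∀ φ ∈ Icc a b, ∀ ρ ∈ Icc k K, |dRho f φ ρ| ≤ L)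
    (hΦk : MapsTo Φ (Icc a b) (Icc k K)) (hΨk : MapsTo Ψ (Icc a b) (Icc k K))
    {x y : ℝ} (hx : x ∈ Icc a b) (hy : y ∈ Icc a b) :
    |Φ y - Ψ y| ≤ |Φ x - Ψ x| * Real.exp (L * (b - a)) :=
  norm_le_mul_exp_of_mem (u := fun φ ↦ Φ φ - Ψ φ) hL0
    (fun φ hφ ↦ (hΦ.ode φ hφ).sub (hΨ.ode φ hφ))
    (fun φ hφ ↦ abs_sub_le_of_abs_dRho_le hf hs hkK (hL φ hφ) (hΨk hφ) (hΦk hφ)) hx hy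

section Uniqueness

variable (hf : ContDiffOn ℝ 1 (uncurry f) (univ ×ˢ s)) (hs : IsOpen s) (hs' : s.OrdConnected)
include hf hs hs'

lemma eqOn (hΦ : IsSolOn f s a b Φ) (hΨ : IsSolOn f s a b Ψ) {x : ℝ} (hx : x ∈ Icc a b)
    (h : Φ x = Ψ x) : EqOn Φ Ψ (Icc a b) := by
  obtain ⟨k, hk, K, hK, -, h1⟩ := hΦ.exists_bounds hs' (hx.1.trans hx.2)
  obtain ⟨k', hk', K', hK', -, h2⟩ := hΨ.exists_bounds hs' (hx.1.trans hx.2)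
  have hsub : Icc (min k k') (max K K') ⊆ s :=
    hs'.out (min_rec' (· ∈ s) hk hk') (max_rec' (· ∈ s) hK hK')
  obtain ⟨L, hL0, hL⟩ := exists_abs_dRho_le (a := a) (b := b) hf hs hsub
  intro y hy
  have hy0 : |Φ y - Ψ y| ≤ |Φ x - Ψ x| * Real.exp (L * (b - a)) :=
    abs_sub_le hf hs hΦ hΨ hsub hL0 hL
      (h1.mono_right (Icc_subset_Icc (min_le_left _ _) (le_max_left _ _)))
      (h2.mono_right (Icc_subset_Icc (min_le_right _ _) (le_max_right _ _))) hx hy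
  rw [h, sub_self, abs_zero, zero_mul] at hy0
  exact sub_eq_zero.1 (abs_nonpos_iff.1 hy0)

lemma lt_of_lt (hΦ : IsSolOn f s a b Φ) (hΨ : IsSolOn f s a b Ψ) {x y : ℝ} (hx : x ∈ Icc a b)
    (hy : y ∈ Icc a b) (h : Φ x < Ψ x) : Φ y < Ψ y := by
  by_contra! hcon
  obtain ⟨z, hz, hz0⟩ : (0 : ℝ) ∈ (fun φ ↦ Ψ φ - Φ φ) '' Icc a b :=
    isPreconnected_Icc.intermediate_value hy hx (hΨ.continuousOn.sub hΦ.continuousOn)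
      ⟨sub_nonpos.2 hcon, sub_nonneg.2 h.le⟩
  exact h.ne (eqOn hf hs hs' hΦ hΨ hz (sub_eq_zero.1 hz0).symm hx)

lemma le_of_le (hΦ : IsSolOn f s a b Φ) (hΨ : IsSolOn f s a b Ψ) {x y : ℝ} (hx : x ∈ Icc a b)
    (hy : y ∈ Icc a b) (h : Φ x ≤ Ψ x) : Φ y ≤ Ψ y := by
  by_contra! hcon
  exact absurd (lt_of_lt hf hs hs' hΨ hΦ hy hx hcon) h.not_gt

lemma exists_lipschitz_of_between {Φ₁ Φ₂ : ℝ → ℝ} (h₁ : IsSolOn f s a b Φ₁)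
    (h₂ : IsSolOn f s a b Φ₂) {x : ℝ} (hx : x ∈ Icc a b) :
    ∃ C k K, Icc k K ⊆ s ∧
      (∀ Φ, IsSolOn f s a b Φ → Φ x ∈ Icc (Φ₁ x) (Φ₂ x) → MapsTo Φ (Icc a b) (Icc k K)) ∧
      ∀ Φ Ψ, IsSolOn f s a b Φ → IsSolOn f s a b Ψ → Φ x ∈ Icc (Φ₁ x) (Φ₂ x) →
        Ψ x ∈ Icc (Φ₁ x) (Φ₂ x) → ∀ y ∈ Icc a b, |Φ y - Ψ y| ≤ C * |Φ x - Ψ x| := by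
  obtain ⟨k, hk, _, _, -, hb1⟩ := h₁.exists_bounds hs' (hx.1.trans hx.2)
  obtain ⟨_, _, K, hK, -, hb2⟩ := h₂.exists_bounds hs' (hx.1.trans hx.2)
  have hsub : Icc k K ⊆ s := hs'.out hk hK
  obtain ⟨L, hL0, hL⟩ := exists_abs_dRho_le (a := a) (b := b) hf hs hsub
  have hmem : ∀ Φ, IsSolOn f s a b Φ → Φ x ∈ Icc (Φ₁ x) (Φ₂ x) →
      MapsTo Φ (Icc a b) (Icc k K) := fun Φ hΦ hΦx y hy ↦
    ⟨(hb1 hy).1.trans (le_of_le hf hs hs' h₁ hΦ hx hy hΦx.1),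
      (le_of_le hf hs hs' hΦ h₂ hx hy hΦx.2).trans (hb2 hy).2⟩
  refine ⟨Real.exp (L * (b - a)), k, K, hsub, hmem, fun Φ Ψ hΦ hΨ hΦx hΨx y hy ↦ ?_⟩
  rw [mul_comm]
  exact abs_sub_le hf hs hΦ hΨ hsub hL0 hL (hmem Φ hΦ hΦx) (hmem Ψ hΨ hΨx) hx hy

end Uniqueness

end IsSolOn

end ScalarODE

section InverseIntegratingFactor

variable {f V : ℝ → ℝ → ℝ} {s : Set ℝ} {a b : ℝ} {Φ Ψ : ℝ → ℝ}

/-- `V` is a `C¹` inverse integrating factor of `dρ/dφ = f (φ, ρ)` on `ℝ × s`. Unlike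
`IsInvIntFactor`, this asks neither for periodicity nor for `V` not to vanish locally. -/
structure IsInvIntFactorOn (f : ℝ → ℝ → ℝ) (s : Set ℝ) (V : ℝ → ℝ → ℝ) : Prop where
  contDiffOn : ContDiffOn ℝ 1 (uncurry V) (univ ×ˢ s)
  pde : ∀ φ, ∀ ρ ∈ s,
    deriv (fun x ↦ V x ρ) φ + dRho V φ ρ * f φ ρ = dRho f φ ρ * V φ ρ

lemma IsInvIntFactorOn.hasDerivWithinAt (hV : IsInvIntFactorOn f s V) (hs : IsOpen s)
    (hΦ : IsSolOn f s a b Φ) {φ : ℝ} (hφ : φ ∈ Icc a b) :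
    HasDerivWithinAt (fun φ ↦ V φ (Φ φ)) (dRho f φ (Φ φ) * V φ (Φ φ)) (Icc a b) φ := by
  have hchain := (hasFDerivAt_uncurry hV.contDiffOn hs (hΦ.mem hφ)).comp_hasDerivWithinAt φ
    (f := fun x ↦ (x, Φ x)) ((hasDerivWithinAt_id φ _).prodMk (hΦ.ode φ hφ))
  have hsplit : ((1 : ℝ), f φ (Φ φ)) = (1, 0) + f φ (Φ φ) • ((0 : ℝ), (1 : ℝ)) := by simp
  rw [hsplit, map_add, map_smul, smul_eq_mul, ← dRho_eq_fderiv hV.contDiffOn hs (hΦ.mem hφ),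
    ← (hasDerivAt_fst hV.contDiffOn hs (hΦ.mem hφ)).deriv, mul_comm] at hchain
  rw [← hV.pde φ _ (hΦ.mem hφ)]
  exact hchain

lemma IsInvIntFactorOn.ne_zero (hV : IsInvIntFactorOn f s V)
    (hf : ContDiffOn ℝ 1 (uncurry f) (univ ×ˢ s)) (hs : IsOpen s) (hs' : s.OrdConnected)
    (hΦ : IsSolOn f s a b Φ) {x y : ℝ} (hx : x ∈ Icc a b) (hy : y ∈ Icc a b)
    (h : V x (Φ x) ≠ 0) : V y (Φ y) ≠ 0 := by
  obtain ⟨k, -, K, -, hkK, hΦk⟩ := hΦ.exists_bounds hs' (hx.1.trans hx.2)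
  obtain ⟨L, hL0, hL⟩ := exists_abs_dRho_le (a := a) (b := b) hf hs hkK
  have hle : |V x (Φ x)| ≤ |V y (Φ y)| * Real.exp (L * (b - a)) :=
    norm_le_mul_exp_of_mem (u := fun φ ↦ V φ (Φ φ)) hL0
      (fun φ hφ ↦ hV.hasDerivWithinAt hs hΦ hφ)
      (fun φ hφ ↦ by rw [norm_mul]; gcongr; exact hL φ hφ _ (hΦk hφ)) hy hx
  intro h0
  rw [h0, abs_zero, zero_mul] at hle
  exact h (abs_nonpos_iff.1 hle)

lemma abs_slope_sub_deriv_le {g g' : ℝ → ℝ} {x y η : ℝ}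
    (hg : ∀ ξ ∈ uIcc x y, HasDerivAt g (g' ξ) ξ) (hη : ∀ ξ ∈ uIcc x y, |g' ξ - g' x| ≤ η)
    (hxy : y ≠ x) : |(g y - g x) / (y - x) - g' x| ≤ η := by
  have hd : ∀ ξ ∈ uIcc x y,
      HasDerivWithinAt (fun ξ ↦ g ξ - g' x * ξ) (g' ξ - g' x) (uIcc x y) ξ := fun ξ hξ ↦ by
    simpa using ((hg ξ hξ).fun_sub ((hasDerivAt_id ξ).const_mul (g' x))).hasDerivWithinAt
  have hyx : y - x ≠ 0 := sub_ne_zero.2 hxy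
  have hslope : (g y - g x) / (y - x) - g' x
      = (g y - g' x * y - (g x - g' x * x)) / (y - x) := by field_simp; ring
  rw [hslope, abs_div, div_le_iff₀ (abs_pos.2 hyx)]
  exact (convex_uIcc x y).norm_image_sub_le_of_norm_hasDerivWithin_le hd hη
    left_mem_uIcc right_mem_uIcc

/-- The quotient of `Ψ - Φ` by `V` along `Φ` would be constant for a linear equation; its
logarithmic derivative is a difference quotient of `f` minus a derivative of `f`. -/
lemma IsInvIntFactorOn.abs_log_sub_le (hV : IsInvIntFactorOn f s V)
    (hf : ContDiffOn ℝ 1 (uncurry f) (univ ×ˢ s)) (hs : IsOpen s) (hs' : s.OrdConnected)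
    (hΦ : IsSolOn f s a b Φ) (hΨ : IsSolOn f s a b Ψ) (hne : ∀ φ ∈ Icc a b, Ψ φ ≠ Φ φ)
    (hV0 : ∀ φ ∈ Icc a b, V φ (Φ φ) ≠ 0) {η : ℝ}
    (hη : ∀ φ ∈ Icc a b, ∀ ξ ∈ uIcc (Φ φ) (Ψ φ), |dRho f φ ξ - dRho f φ (Φ φ)| ≤ η)
    (hab : a ≤ b) :
    |Real.log ((Ψ b - Φ b) / V b (Φ b)) - Real.log ((Ψ a - Φ a) / V a (Φ a))| ≤ η * (b - a) := by
  have hder : ∀ φ ∈ Icc a b, HasDerivWithinAt (fun φ ↦ Real.log ((Ψ φ - Φ φ) / V φ (Φ φ)))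
      ((f φ (Ψ φ) - f φ (Φ φ)) / (Ψ φ - Φ φ) - dRho f φ (Φ φ)) (Icc a b) φ := by
    intro φ hφ
    have hsub := sub_ne_zero.2 (hne φ hφ)
    have hVφ := hV0 φ hφ
    convert! (((hΨ.ode φ hφ).sub (hΦ.ode φ hφ)).div (hV.hasDerivWithinAt hs hΦ hφ) hVφ).log
      (div_ne_zero hsub hVφ) using 1
    simp only [Pi.sub_apply, Pi.div_apply]
    field_simp
  have hbound : ∀ φ ∈ Icc a b,
      |(f φ (Ψ φ) - f φ (Φ φ)) / (Ψ φ - Φ φ) - dRho f φ (Φ φ)| ≤ η := fun φ hφ ↦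
    abs_slope_sub_deriv_le
      (fun ξ hξ ↦ hasDerivAt_dRho hf hs (hs'.uIcc_subset (hΦ.mem hφ) (hΨ.mem hφ) hξ))
      (hη φ hφ) (hne φ hφ)
  simpa [abs_of_nonneg (sub_nonneg.2 hab)] using
    (convex_Icc a b).norm_image_sub_le_of_norm_hasDerivWithin_le hder hbound
      (left_mem_Icc.2 hab) (right_mem_Icc.2 hab)

section Flow

variable {Φ : ℝ → ℝ → ℝ} {x₀ : ℝ} (hf : ContDiffOn ℝ 1 (uncurry f) (univ ×ˢ s)) (hs : IsOpen s)
  (hs' : s.OrdConnected) (hab : a ≤ b) (hΦ : ∀ᶠ x in 𝓝 x₀, IsSolOn f s a b (Φ x) ∧ Φ x a = x)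
include hf hs hs' hab hΦ

lemma eventually_flow_lipschitz :
    ∃ C k K, Icc k K ⊆ s ∧ MapsTo (Φ x₀) (Icc a b) (Icc k K) ∧
      ∀ᶠ x in 𝓝 x₀, MapsTo (Φ x) (Icc a b) (Icc k K) ∧
        ∀ φ ∈ Icc a b, |Φ x φ - Φ x₀ φ| ≤ C * |x - x₀| := by
  obtain ⟨y, z, hx₀, hnhds, hyz⟩ := exists_Icc_mem_subset_of_mem_nhds hΦ
  have hy := hyz (left_mem_Icc.2 (hx₀.1.trans hx₀.2))
  have hz := hyz (right_mem_Icc.2 (hx₀.1.trans hx₀.2))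
  have hx₀' := hyz hx₀
  obtain ⟨C, k, K, hkK, hmem, hlip⟩ :=
    IsSolOn.exists_lipschitz_of_between hf hs hs' hy.1 hz.1 (left_mem_Icc.2 hab)
  rw [hy.2, hz.2] at hmem hlip
  refine ⟨C, k, K, hkK, hmem _ hx₀'.1 (by rwa [hx₀'.2]), mem_of_superset hnhds fun x hx ↦ ?_⟩
  have hx' := hyz hx
  refine ⟨hmem _ hx'.1 (by rwa [hx'.2]), fun φ hφ ↦ ?_⟩
  simpa only [hx'.2, hx₀'.2] using
    hlip _ _ hx'.1 hx₀'.1 (by rwa [hx'.2]) (by rwa [hx₀'.2]) φ hφ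

lemma eventually_abs_dRho_flow_sub_le {η : ℝ} (hη : 0 < η) :
    ∀ᶠ x in 𝓝 x₀, ∀ φ ∈ Icc a b, ∀ ξ ∈ uIcc (Φ x₀ φ) (Φ x φ),
      |dRho f φ ξ - dRho f φ (Φ x₀ φ)| ≤ η := by
  obtain ⟨C, k, K, hkK, hx₀, hev⟩ := eventually_flow_lipschitz hf hs hs' hab hΦ
  have huc := (isCompact_Icc.prod isCompact_Icc).uniformContinuousOn_of_continuous
    ((continuousOn_dRho hf hs).mono (prod_mono (subset_univ (Icc a b)) hkK))
  obtain ⟨δ, hδ, hδη⟩ := Metric.uniformContinuousOn_iff.1 huc η hη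
  have hsmall : ∀ᶠ x in 𝓝 x₀, C * |x - x₀| < δ :=
    Tendsto.eventually_lt_const (by simpa using hδ)
      (Continuous.tendsto (f := fun x ↦ C * |x - x₀|) (by fun_prop) x₀)
  filter_upwards [hev, hsmall] with x ⟨hx, hlip⟩ hxδ φ hφ ξ hξ
  have hdist : dist ((φ, ξ) : ℝ × ℝ) (φ, Φ x₀ φ) < δ := by
    rw [Prod.dist_eq, dist_self, max_eq_right dist_nonneg, Real.dist_eq]
    exact ((abs_sub_left_of_mem_uIcc hξ).trans (hlip φ hφ)).trans_lt hxδ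
  exact (hδη _ ⟨hφ, uIcc_subset_Icc (hx₀ hφ) (hx hφ) hξ⟩ _ ⟨hφ, hx₀ hφ⟩ hdist).le

lemma IsInvIntFactorOn.tendsto_log_flow (hV : IsInvIntFactorOn f s V) (hV0 : V a x₀ ≠ 0) :
    Tendsto (fun x ↦ Real.log ((Φ x b - Φ x₀ b) / V b (Φ x₀ b)) - Real.log ((x - x₀) / V a x₀))
      (𝓝[≠] x₀) (𝓝 0) := by
  obtain ⟨hS, hSa⟩ := hΦ.self_of_nhds
  rw [Metric.tendsto_nhds]
  intro ε hε
  have hη : 0 < ε / (b - a + 1) := div_pos hε (by linarith)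
  filter_upwards [hΦ.filter_mono nhdsWithin_le_nhds,
    (eventually_abs_dRho_flow_sub_le hf hs hs' hab hΦ hη).filter_mono nhdsWithin_le_nhds,
    self_mem_nhdsWithin] with x ⟨hx, hxa⟩ hdRho hne
  have hVne : ∀ φ ∈ Icc a b, V φ (Φ x₀ φ) ≠ 0 := fun φ hφ ↦
    hV.ne_zero hf hs hs' hS (left_mem_Icc.2 hab) hφ (by rwa [hSa])
  have hsep : ∀ φ ∈ Icc a b, Φ x φ ≠ Φ x₀ φ := fun φ hφ heq ↦ hne <| by
    simpa only [mem_singleton_iff, hxa, hSa] using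
      IsSolOn.eqOn hf hs hs' hx hS hφ heq (left_mem_Icc.2 hab)
  have hlog := hV.abs_log_sub_le hf hs hs' hS hx hsep hVne hdRho hab
  rw [hxa, hSa] at hlog
  rw [Real.dist_eq, sub_zero]
  refine hlog.trans_lt ?_
  rw [div_mul_eq_mul_div, div_lt_iff₀ (by linarith)]
  exact mul_lt_mul_of_pos_left (by linarith) hε

lemma slope_flow_pos {x : ℝ} (hx : IsSolOn f s a b (Φ x) ∧ Φ x a = x) (hne : x ≠ x₀) :
    0 < (Φ x b - Φ x₀ b) / (x - x₀) := by
  obtain ⟨hS, hSa⟩ := hΦ.self_of_nhds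
  have haI := left_mem_Icc.2 hab
  have hbI := right_mem_Icc.2 hab
  rcases lt_or_gt_of_ne hne with h | h
  · exact div_pos_of_neg_of_neg
      (sub_neg.2 (IsSolOn.lt_of_lt hf hs hs' hx.1 hS haI hbI (by rwa [hx.2, hSa]))) (sub_neg.2 h)
  · exact div_pos
      (sub_pos.2 (IsSolOn.lt_of_lt hf hs hs' hS hx.1 haI hbI (by rwa [hx.2, hSa]))) (sub_pos.2 h)

/-- Absolute values spare the proof that `V` keeps its sign along a solution. -/
lemma IsInvIntFactorOn.hasDerivAt_flow (hV : IsInvIntFactorOn f s V) (hV0 : V a x₀ ≠ 0) :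
    HasDerivAt (fun x ↦ Φ x b) |V b (Φ x₀ b) / V a x₀| x₀ := by
  obtain ⟨hS, hSa⟩ := hΦ.self_of_nhds
  have hVb : V b (Φ x₀ b) ≠ 0 :=
    hV.ne_zero hf hs hs' hS (left_mem_Icc.2 hab) (right_mem_Icc.2 hab) (by rwa [hSa])
  rw [hasDerivAt_iff_tendsto_slope]
  have hexp := ((Real.continuous_exp.tendsto 0).comp
    (hV.tendsto_log_flow hf hs hs' hab hΦ hV0)).mul_const |V b (Φ x₀ b) / V a x₀|
  rw [Real.exp_zero, one_mul] at hexp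
  refine hexp.congr' ?_
  filter_upwards [hΦ.filter_mono nhdsWithin_le_nhds, self_mem_nhdsWithin] with x hx hne
  have hslope := slope_flow_pos hf hs hs' hab hΦ hx hne
  have hx0 : x - x₀ ≠ 0 := sub_ne_zero.2 hne
  have hΦ0 : Φ x b - Φ x₀ b ≠ 0 := fun h ↦ by simp [h] at hslope
  rw [slope_def_field, Function.comp_apply, ← Real.log_div (by positivity) (by positivity),
    Real.exp_log_eq_abs (by positivity), ← abs_mul, ← abs_of_pos hslope]
  congr 1
  field_simp

end Flow

end InverseIntegratingFactor

section InverseFunction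

lemma continuousOn_invFunOn {X Y : Type*} [TopologicalSpace X] [TopologicalSpace Y] [T2Space Y]
    [Nonempty X] {s : Set X} {g : X → Y} (hs : IsCompact s) (hg : ContinuousOn g s)
    (hinj : InjOn g s) : ContinuousOn (invFunOn g s) (g '' s) := by
  refine continuousOn_iff_isClosed.2 fun t ht ↦
    ⟨g '' (s ∩ t), ((hs.inter_right ht).image_of_continuousOn (hg.mono inter_subset_left)).isClosed,
      Set.ext fun y ↦ ⟨?_, ?_⟩⟩
  · rintro ⟨hyt, hy⟩
    exact ⟨⟨_, ⟨invFunOn_mem hy, hyt⟩, invFunOn_eq hy⟩, hy⟩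
  · rintro ⟨⟨x, ⟨hxs, hxt⟩, rfl⟩, hy⟩
    exact ⟨by rwa [mem_preimage, hinj.leftInvOn_invFunOn hxs], hy⟩

variable {x x' y y' : ℝ → ℝ} {a b t : ℝ}

lemma strictMonoOn_or_strictAntiOn_of_deriv_ne_zero
    (hx : ∀ t ∈ Icc a b, HasDerivWithinAt x (x' t) (Icc a b) t) (hne : ∀ t ∈ Icc a b, x' t ≠ 0) :
    StrictMonoOn x (Icc a b) ∧ (∀ t ∈ Icc a b, 0 < x' t) ∨
      StrictAntiOn x (Icc a b) ∧ ∀ t ∈ Icc a b, x' t < 0 := by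
  have hc : ContinuousOn x (Icc a b) := HasDerivWithinAt.continuousOn hx
  have hint : ∀ t ∈ interior (Icc a b), HasDerivWithinAt x (x' t) (interior (Icc a b)) t :=
    fun t ht ↦ (hx t (interior_subset ht)).mono interior_subset
  rcases hasDerivWithinAt_forall_lt_or_forall_gt_of_forall_ne (convex_Icc a b) hx hne
    with hneg | hpos
  · exact Or.inr ⟨strictAntiOn_of_hasDerivWithinAt_neg (convex_Icc a b) hc hint
      fun t ht ↦ hneg t (interior_subset ht), hneg⟩
  · exact Or.inl ⟨strictMonoOn_of_hasDerivWithinAt_pos (convex_Icc a b) hc hint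
      fun t ht ↦ hpos t (interior_subset ht), hpos⟩

lemma injOn_of_deriv_ne_zero (hx : ∀ t ∈ Icc a b, HasDerivWithinAt x (x' t) (Icc a b) t)
    (hne : ∀ t ∈ Icc a b, x' t ≠ 0) : InjOn x (Icc a b) := by
  rcases strictMonoOn_or_strictAntiOn_of_deriv_ne_zero hx hne with h | h
  exacts [h.1.injOn, h.1.injOn]

lemma deriv_mul_sub_pos (hab : a < b)
    (hx : ∀ t ∈ Icc a b, HasDerivWithinAt x (x' t) (Icc a b) t) (hne : ∀ t ∈ Icc a b, x' t ≠ 0) :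
    0 < x' a * (x b - x a) := by
  have ha := left_mem_Icc.2 hab.le
  have hb := right_mem_Icc.2 hab.le
  rcases strictMonoOn_or_strictAntiOn_of_deriv_ne_zero hx hne with ⟨hm, hpos⟩ | ⟨hm, hneg⟩
  · exact mul_pos (hpos a ha) (sub_pos.2 (hm ha hb hab))
  · exact mul_pos_of_neg_of_neg (hneg a ha) (sub_neg.2 (hm ha hb hab))

lemma hasDerivWithinAt_invFunOn (hx : ∀ t ∈ Icc a b, HasDerivWithinAt x (x' t) (Icc a b) t)
    (hne : ∀ t ∈ Icc a b, x' t ≠ 0) (ht : t ∈ Icc a b) :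
    HasDerivWithinAt (invFunOn x (Icc a b)) (x' t)⁻¹ (x '' Icc a b) (x t) := by
  have hinj := injOn_of_deriv_ne_zero hx hne
  have hxt : invFunOn x (Icc a b) (x t) = t := hinj.leftInvOn_invFunOn ht
  have hcont := continuousOn_invFunOn isCompact_Icc (HasDerivWithinAt.continuousOn hx) hinj
  have hfd : HasFDerivWithinAt x (ContinuousLinearEquiv.unitsEquivAut ℝ (Units.mk0 _ (hne t ht)) :
      ℝ →L[ℝ] ℝ) (Icc a b) (invFunOn x (Icc a b) (x t)) := by
    rw [hxt]
    exact hx t ht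
  have hinv := HasFDerivWithinAt.of_local_left_inverse
    (tendsto_nhdsWithin_iff.2 ⟨hcont _ (mem_image_of_mem x ht),
      eventually_mem_nhdsWithin.mono fun _ ↦ invFunOn_mem⟩)
    hfd (mem_image_of_mem x ht) (eventually_mem_nhdsWithin.mono fun _ ↦ invFunOn_eq)
  simpa using hinv.hasDerivWithinAt

lemma hasDerivWithinAt_comp_invFunOn (hx : ∀ t ∈ Icc a b, HasDerivWithinAt x (x' t) (Icc a b) t)
    (hne : ∀ t ∈ Icc a b, x' t ≠ 0) (ht : t ∈ Icc a b)
    (hy : HasDerivWithinAt y (y' t) (Icc a b) t) :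
    HasDerivWithinAt (y ∘ invFunOn x (Icc a b)) (y' t / x' t) (x '' Icc a b) (x t) := by
  rw [← (injOn_of_deriv_ne_zero hx hne).leftInvOn_invFunOn ht] at hy
  simpa [div_eq_mul_inv, (injOn_of_deriv_ne_zero hx hne).leftInvOn_invFunOn ht] using
    hy.comp (x t) (hasDerivWithinAt_invFunOn hx hne ht) fun _ ↦ invFunOn_mem

lemma uIcc_subset_image_Icc {g : ℝ → ℝ} {u : ℝ} (hg : ContinuousOn g (Icc a b))
    (ht : t ∈ Icc a b) (hu : u ∈ Icc a b) : uIcc (g t) (g u) ⊆ g '' Icc a b :=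
  (isPreconnected_Icc.image g hg).ordConnected.uIcc_subset (mem_image_of_mem g ht)
    (mem_image_of_mem g hu)

lemma exists_autonomous {w : ℝ → ℝ} (hw : Continuous w) (hne : ∀ x, w x ≠ 0) (x₀ : ℝ) {l : ℝ}
    (hl : 0 < l) : ∃ T > 0, ∃ τ : ℝ → ℝ, τ 0 = x₀ ∧ (τ T = x₀ + l ∨ τ T = x₀ - l) ∧
      ∀ t ∈ Icc 0 T, HasDerivWithinAt τ (w (τ t)) (Icc 0 T) t := by
  set I := Icc (x₀ - l) (x₀ + l)
  set g := fun x ↦ ∫ s in x₀..x, (w s)⁻¹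
  have hg0 : g x₀ = 0 := intervalIntegral.integral_same
  have hg : ∀ x ∈ I, HasDerivWithinAt g (w x)⁻¹ I x := fun x _ ↦
    ((hw.inv₀ hne).integral_hasStrictDerivAt x₀ x).hasDerivAt.hasDerivWithinAt
  have hg' : ∀ x ∈ I, (w x)⁻¹ ≠ 0 := fun x _ ↦ inv_ne_zero (hne x)
  have hinv : LeftInvOn (invFunOn g I) g I := (injOn_of_deriv_ne_zero hg hg').leftInvOn_invFunOn
  have hx₀ : x₀ ∈ I := ⟨by linarith, by linarith⟩
  have hminus : x₀ - l ∈ I := ⟨le_rfl, by linarith⟩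
  have hplus : x₀ + l ∈ I := ⟨by linarith, le_rfl⟩
  obtain ⟨y, hyI, hy, hgy⟩ : ∃ y ∈ I, (y = x₀ + l ∨ y = x₀ - l) ∧ 0 < g y := by
    rcases strictMonoOn_or_strictAntiOn_of_deriv_ne_zero hg hg' with ⟨hm, -⟩ | ⟨hm, -⟩
    · exact ⟨_, hplus, Or.inl rfl, hg0 ▸ hm hx₀ hplus (by linarith)⟩
    · exact ⟨_, hminus, Or.inr rfl, hg0 ▸ hm hminus hx₀ (by linarith)⟩
  have hsub : Icc 0 (g y) ⊆ g '' I := by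
    rw [← hg0]
    exact Icc_subset_uIcc.trans
      (uIcc_subset_image_Icc (HasDerivWithinAt.continuousOn hg) hx₀ hyI)
  refine ⟨g y, hgy, invFunOn g I, by rw [← hg0, hinv hx₀], by rwa [hinv hyI], fun t ht ↦ ?_⟩
  obtain ⟨x, hx, rfl⟩ := hsub ht
  simpa [hinv hx] using (hasDerivWithinAt_invFunOn hg hg' hx).mono hsub

end InverseFunction

section WeightedPolarCoordinates

/-- The weighted polar blow-up `(φ, ρ) ↦ (ρ ^ p * cos φ, ρ ^ q * sin φ)`. -/
def blow (p q : ℕ) (z : ℝ × ℝ) : ℝ × ℝ := (z.2 ^ p * Real.cos z.1, z.2 ^ q * Real.sin z.1)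

/-- The square of the Euclidean norm of `(x / ρ ^ p, y / ρ ^ q)`, for `z = (x, y)`; it takes the
value `1` exactly when `ρ` is the weighted radius of `z`. -/
def radialGauge (p q : ℕ) (z : ℝ × ℝ) (ρ : ℝ) : ℝ := z.1 ^ 2 / (ρ ^ p) ^ 2 + z.2 ^ 2 / (ρ ^ q) ^ 2

/-- The weighted radius of a nonzero point `z`: the `ρ > 0` such that `z = blow p q (φ, ρ)` for
some `φ`. -/
def radius (p q : ℕ) (z : ℝ × ℝ) : ℝ := Classical.epsilon fun ρ ↦ 0 < ρ ∧ radialGauge p q z ρ = 1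

variable {p q : ℕ} {z : ℝ × ℝ} {φ ρ : ℝ}

lemma radialGauge_strictAntiOn (hp : 0 < p) (hq : 0 < q) (hz : z ≠ 0) :
    StrictAntiOn (radialGauge p q z) (Ioi 0) := by
  intro ρ hρ σ _ h
  rw [mem_Ioi] at hρ
  have hP : ρ ^ p < σ ^ p := pow_lt_pow_left₀ h hρ.le hp.ne'
  have hQ : ρ ^ q < σ ^ q := pow_lt_pow_left₀ h hρ.le hq.ne'
  rcases not_and_or.1 fun h : z.1 = 0 ∧ z.2 = 0 ↦ hz (Prod.ext h.1 h.2) with hx | hy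
  · exact add_lt_add_of_lt_of_le (by gcongr) (by gcongr)
  · exact add_lt_add_of_le_of_lt (by gcongr) (by gcongr)

lemma continuousOn_radialGauge : ContinuousOn (radialGauge p q z) (Ioi 0) := by
  intro ρ hρ
  have := pow_pos (mem_Ioi.1 hρ) p
  have := pow_pos (mem_Ioi.1 hρ) q
  unfold radialGauge
  fun_prop (disch := positivity)

lemma tendsto_radialGauge_atTop (hp : 0 < p) (hq : 0 < q) (z : ℝ × ℝ) :
    Tendsto (radialGauge p q z) atTop (𝓝 0) := by
  have h : ∀ {n : ℕ} (x : ℝ), 0 < n → Tendsto (fun ρ : ℝ ↦ x ^ 2 / (ρ ^ n) ^ 2) atTop (𝓝 0) :=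
    fun x hn ↦ tendsto_const_nhds.div_atTop
      ((tendsto_pow_atTop two_ne_zero).comp (tendsto_pow_atTop hn.ne'))
  rw [← add_zero 0]
  exact (h z.1 hp).add (h z.2 hq)

lemma exists_one_le_radialGauge (hp : 0 < p) (hq : 0 < q) (hz : z ≠ 0) :
    ∃ ρ > 0, 1 ≤ radialGauge p q z ρ := by
  have h : ∀ {n : ℕ} {x : ℝ}, 0 < n → x ≠ 0 → ∃ ρ > 0, 1 ≤ x ^ 2 / (ρ ^ n) ^ 2 := by
    intro n x hn hx
    refine ⟨min 1 |x|, lt_min one_pos (abs_pos.2 hx), ?_⟩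
    have hle : (min 1 |x|) ^ n ≤ |x| :=
      (pow_le_of_le_one (by positivity) (min_le_left _ _) hn.ne').trans (min_le_right _ _)
    rw [one_le_div (by positivity), ← sq_abs x]
    gcongr
  rcases not_and_or.1 fun h : z.1 = 0 ∧ z.2 = 0 ↦ hz (Prod.ext h.1 h.2) with hx | hy
  · obtain ⟨ρ, hρ, h1⟩ := h hp hx
    exact ⟨ρ, hρ, h1.trans (le_add_of_nonneg_right (by positivity))⟩
  · obtain ⟨ρ, hρ, h1⟩ := h hq hy
    exact ⟨ρ, hρ, h1.trans (le_add_of_nonneg_left (by positivity))⟩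

lemma exists_radialGauge_eq_one (hp : 0 < p) (hq : 0 < q) (hz : z ≠ 0) :
    ∃ ρ, 0 < ρ ∧ radialGauge p q z ρ = 1 := by
  obtain ⟨σ, hσ, hge⟩ := exists_one_le_radialGauge hp hq hz
  obtain ⟨τ, hτ, hle⟩ := ((eventually_gt_atTop 0).and
    ((tendsto_radialGauge_atTop hp hq z).eventually_le_const one_pos)).exists
  exact isPreconnected_Ioi.intermediate_value hτ hσ continuousOn_radialGauge ⟨hle, hge⟩

lemma radius_pos (hp : 0 < p) (hq : 0 < q) (hz : z ≠ 0) : 0 < radius p q z :=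
  (Classical.epsilon_spec (exists_radialGauge_eq_one hp hq hz)).1

lemma radialGauge_radius (hp : 0 < p) (hq : 0 < q) (hz : z ≠ 0) :
    radialGauge p q z (radius p q z) = 1 :=
  (Classical.epsilon_spec (exists_radialGauge_eq_one hp hq hz)).2

lemma lt_radius_iff (hp : 0 < p) (hq : 0 < q) (hz : z ≠ 0) (hρ : 0 < ρ) :
    ρ < radius p q z ↔ 1 < radialGauge p q z ρ := by
  rw [← radialGauge_radius hp hq hz]
  exact ((radialGauge_strictAntiOn hp hq hz).lt_iff_gt (radius_pos hp hq hz) hρ).symm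

lemma radius_lt_iff (hp : 0 < p) (hq : 0 < q) (hz : z ≠ 0) (hρ : 0 < ρ) :
    radius p q z < ρ ↔ radialGauge p q z ρ < 1 := by
  rw [← radialGauge_radius hp hq hz]
  exact ((radialGauge_strictAntiOn hp hq hz).lt_iff_gt hρ (radius_pos hp hq hz)).symm

lemma continuous_radialGauge_left (p q : ℕ) (ρ : ℝ) : Continuous fun z ↦ radialGauge p q z ρ := by
  unfold radialGauge
  fun_prop

lemma continuousAt_radius (hp : 0 < p) (hq : 0 < q) (hz : z ≠ 0) :
    ContinuousAt (radius p q) z := by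
  have hne : ∀ᶠ w in 𝓝 z, w ≠ 0 := eventually_ne_nhds hz
  have hcont := fun ρ ↦ (continuous_radialGauge_left p q ρ).continuousAt (x := z)
  refine tendsto_order.2 ⟨fun l hl ↦ ?_, fun u hu ↦ ?_⟩
  · rcases le_or_gt l 0 with hl0 | hl0
    · filter_upwards [hne] with w hw using hl0.trans_lt (radius_pos hp hq hw)
    · filter_upwards [hne, (hcont l).eventually_const_lt ((lt_radius_iff hp hq hz hl0).1 hl)]
        with w hw using (lt_radius_iff hp hq hw hl0).2
  · have hu0 : 0 < u := (radius_pos hp hq hz).trans hu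
    filter_upwards [hne, (hcont u).eventually_lt_const ((radius_lt_iff hp hq hz hu0).1 hu)]
      with w hw using (radius_lt_iff hp hq hw hu0).2

lemma exists_radius_lt (hp : 0 < p) (hq : 0 < q) (hρ : 0 < ρ) :
    ∃ δ > 0, ∀ z : ℝ × ℝ, z ≠ 0 → ‖z‖ < δ → radius p q z < ρ := by
  have h : ∀ᶠ z in 𝓝 (0 : ℝ × ℝ), radialGauge p q z ρ < 1 :=
    (continuous_radialGauge_left p q ρ).continuousAt.eventually_lt_const (by simp [radialGauge])
  obtain ⟨δ, hδ, h⟩ := Metric.eventually_nhds_iff.1 h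
  exact ⟨δ, hδ, fun z hz hzδ ↦ (radius_lt_iff hp hq hz hρ).2 (h (by simpa using hzδ))⟩

lemma radialGauge_blow (hρ : 0 < ρ) : radialGauge p q (blow p q (φ, ρ)) ρ = 1 := by
  have := (pow_pos hρ p).ne'
  have := (pow_pos hρ q).ne'
  simp only [radialGauge, blow, mul_pow]
  rw [mul_div_cancel_left₀ _ (by positivity), mul_div_cancel_left₀ _ (by positivity),
    Real.cos_sq_add_sin_sq]

lemma blow_ne_zero (hρ : 0 < ρ) : blow p q (φ, ρ) ≠ 0 := by
  intro h
  simpa [h, radialGauge] using radialGauge_blow (p := p) (q := q) (φ := φ) hρ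

lemma radius_blow (hp : 0 < p) (hq : 0 < q) (hρ : 0 < ρ) : radius p q (blow p q (φ, ρ)) = ρ :=
  (radialGauge_strictAntiOn hp hq (blow_ne_zero hρ)).injOn (radius_pos hp hq (blow_ne_zero hρ)) hρ
    ((radialGauge_radius hp hq (blow_ne_zero hρ)).trans (radialGauge_blow hρ).symm)

lemma norm_blow_le (hp : 0 < p) (hq : 0 < q) (hρ : |ρ| ≤ 1) : ‖blow p q (φ, ρ)‖ ≤ |ρ| := by
  have h : ∀ {n : ℕ} {x : ℝ}, 0 < n → |x| ≤ 1 → |ρ ^ n * x| ≤ |ρ| := by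
    intro n x hn hx
    rw [abs_mul, abs_pow]
    exact (mul_le_of_le_one_right (by positivity) hx).trans
      (pow_le_of_le_one (abs_nonneg _) hρ hn.ne')
  exact max_le (h hp (Real.abs_cos_le_one φ)) (h hq (Real.abs_sin_le_one φ))

lemma blow_add_two_pi : blow p q (φ + 2 * Real.pi, ρ) = blow p q (φ, ρ) := by
  simp [blow]

/-- The angle of `(α * cos θ, β * sin θ)`, as a continuous function of `θ` that agrees with `θ` on
the axes. -/
def twist (α β θ : ℝ) : ℝ :=
  θ + Real.arctan ((β - α) * Real.sin θ * Real.cos θ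
    / (α * Real.cos θ ^ 2 + β * Real.sin θ ^ 2))

lemma cos_sin_sq_combination_pos {α β : ℝ} (hα : 0 < α) (hβ : 0 < β) (θ : ℝ) :
    0 < α * Real.cos θ ^ 2 + β * Real.sin θ ^ 2 := by
  have h := Real.cos_sq_add_sin_sq θ
  nlinarith [lt_min hα hβ, min_le_left α β, min_le_right α β, sq_nonneg (Real.cos θ),
    sq_nonneg (Real.sin θ)]

lemma exists_eq_mul_cos_twist {α β : ℝ} (hα : 0 < α) (hβ : 0 < β) (θ : ℝ) :
    ∃ n > 0, α * Real.cos θ = n * Real.cos (twist α β θ) ∧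
      β * Real.sin θ = n * Real.sin (twist α β θ) := by
  set d := α * Real.cos θ ^ 2 + β * Real.sin θ ^ 2 with hd
  set c := (β - α) * Real.sin θ * Real.cos θ with hc
  have hd0 : 0 < d := cos_sin_sq_combination_pos hα hβ θ
  obtain ⟨κ, hκ, hcos, hsin⟩ : ∃ κ > 0, Real.cos (Real.arctan (c / d)) = κ ∧
      Real.sin (Real.arctan (c / d)) = c / d * κ :=
    ⟨_, Real.cos_arctan_pos _, rfl, by
      rw [← Real.tan_mul_cos (Real.cos_arctan_pos _).ne', Real.tan_arctan]⟩
  have hcs := Real.cos_sq_add_sin_sq θ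
  refine ⟨d / κ, div_pos hd0 hκ, ?_, ?_⟩
  · rw [twist, Real.cos_add, hcos, hsin]
    field_simp
    rw [hc, hd]
    linear_combination (-α * Real.cos θ) * hcs
  · rw [twist, Real.sin_add, hcos, hsin]
    field_simp
    rw [hc, hd]
    linear_combination (-β * Real.sin θ) * hcs

lemma twist_of_sin_eq_zero {α β θ : ℝ} (h : Real.sin θ = 0) : twist α β θ = θ := by
  simp [twist, h]

lemma twist_add_two_pi (α β θ : ℝ) : twist α β (θ + 2 * Real.pi) = twist α β θ + 2 * Real.pi := by
  simp only [twist, Real.sin_add_two_pi, Real.cos_add_two_pi]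
  ring

lemma continuousOn_twist {X : Type*} [TopologicalSpace X] {s : Set X} {α β θ : X → ℝ}
    (hα : ContinuousOn α s) (hβ : ContinuousOn β s) (hθ : ContinuousOn θ s)
    (hα0 : ∀ x ∈ s, 0 < α x) (hβ0 : ∀ x ∈ s, 0 < β x) :
    ContinuousOn (fun x ↦ twist (α x) (β x) (θ x)) s := by
  have hd : ∀ x ∈ s, α x * Real.cos (θ x) ^ 2 + β x * Real.sin (θ x) ^ 2 ≠ 0 := fun x hx ↦
    (cos_sin_sq_combination_pos (hα0 x hx) (hβ0 x hx) _).ne'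
  unfold twist
  fun_prop (disch := assumption)

/-- The weighted angle of the point `z` with polar angle `θ`. -/
def weightedAngle (p q : ℕ) (z : ℝ × ℝ) (θ : ℝ) : ℝ := twist (radius p q z ^ q) (radius p q z ^ p) θ

lemma weightedAngle_of_sin_eq_zero {θ : ℝ} (h : Real.sin θ = 0) : weightedAngle p q z θ = θ :=
  twist_of_sin_eq_zero h

variable {s θ : ℝ}

lemma polar_ne_zero (hs : 0 < s) : ((s * Real.cos θ, s * Real.sin θ) : ℝ × ℝ) ≠ 0 := by
  intro h
  obtain ⟨hc, hs'⟩ := Prod.mk_eq_zero.1 h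
  have := Real.cos_sq_add_sin_sq θ
  simp_all [hs.ne']

lemma blow_weightedAngle (hp : 0 < p) (hq : 0 < q) (hs : 0 < s)
    (hz : z = (s * Real.cos θ, s * Real.sin θ)) :
    blow p q (weightedAngle p q z θ, radius p q z) = z := by
  have hz0 : z ≠ 0 := hz ▸ polar_ne_zero hs
  have h1 := radialGauge_radius hp hq hz0
  rw [weightedAngle]
  set ρ := radius p q z
  have hρp : 0 < ρ ^ p := pow_pos (radius_pos hp hq hz0) p
  have hρq : 0 < ρ ^ q := pow_pos (radius_pos hp hq hz0) q
  obtain ⟨n, hn, hcos, hsin⟩ := exists_eq_mul_cos_twist hρq hρp θ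
  set φ := twist (ρ ^ q) (ρ ^ p) θ
  set N := s * n / (ρ ^ p * ρ ^ q) with hN
  have hz1 : z.1 = N * (ρ ^ p * Real.cos φ) := by
    rw [hz, hN]
    field_simp
    linear_combination hcos
  have hz2 : z.2 = N * (ρ ^ q * Real.sin φ) := by
    rw [hz, hN]
    field_simp
    linear_combination hsin
  have hN1 : N = 1 := by
    have hN2 : N ^ 2 = 1 := by
      rw [radialGauge, hz1, hz2] at h1
      field_simp at h1
      rwa [Real.cos_sq_add_sin_sq, mul_one] at h1
    exact (pow_eq_one_iff_of_nonneg (by positivity) two_ne_zero).1 hN2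
  rw [hN1, one_mul] at hz1 hz2
  exact Prod.ext hz1.symm hz2.symm

end WeightedPolarCoordinates

section PolarEquation

variable {p q r : ℕ} {P Q : ℝ → ℝ → ℝ} {e φ ρ : ℝ}

lemma jac_pos (hp : 0 < p) (hq : 0 < q) (hρ : 0 < ρ) : 0 < jac p q φ ρ :=
  mul_pos (pow_pos hρ _) (cos_sin_sq_combination_pos (Nat.cast_pos.2 hp) (Nat.cast_pos.2 hq) φ)

/-- The differential of the weighted polar blow-up `blow p q`; its determinant is `-jac p q`. -/
def blowDeriv (p q : ℕ) (z : ℝ × ℝ) : ℝ × ℝ →L[ℝ] ℝ × ℝ :=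
  ((-(z.2 ^ p * Real.sin z.1)) • ContinuousLinearMap.fst ℝ ℝ ℝ
      + (p * z.2 ^ (p - 1) * Real.cos z.1) • ContinuousLinearMap.snd ℝ ℝ ℝ).prod
    ((z.2 ^ q * Real.cos z.1) • ContinuousLinearMap.fst ℝ ℝ ℝ
      + (q * z.2 ^ (q - 1) * Real.sin z.1) • ContinuousLinearMap.snd ℝ ℝ ℝ)

lemma hasFDerivAt_blow (p q : ℕ) (z : ℝ × ℝ) : HasFDerivAt (blow p q) (blowDeriv p q z) z := by
  have h1 : HasFDerivAt (fun z : ℝ × ℝ ↦ z.1) (ContinuousLinearMap.fst ℝ ℝ ℝ) z := hasFDerivAt_fst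
  have h2 : HasFDerivAt (fun z : ℝ × ℝ ↦ z.2) (ContinuousLinearMap.snd ℝ ℝ ℝ) z := hasFDerivAt_snd
  convert! ((h2.pow p).mul h1.cos).prodMk ((h2.pow q).mul h1.sin) using 1
  ext <;> simp [blowDeriv] <;> ring

lemma jac_mul_fst (hp : 0 < p) (hq : 0 < q) (w : ℝ × ℝ) :
    jac p q φ ρ * w.1 = p * ρ ^ (p - 1) * Real.cos φ * (blowDeriv p q (φ, ρ) w).2
      - q * ρ ^ (q - 1) * Real.sin φ * (blowDeriv p q (φ, ρ) w).1 := by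
  obtain ⟨p, rfl⟩ := Nat.exists_eq_succ_of_ne_zero hp.ne'
  obtain ⟨q, rfl⟩ := Nat.exists_eq_succ_of_ne_zero hq.ne'
  simp only [jac, blowDeriv, ContinuousLinearMap.prod_apply, add_apply,
    smul_apply, ContinuousLinearMap.coe_fst', ContinuousLinearMap.coe_snd',
    smul_eq_mul, Nat.succ_eq_add_one, Nat.add_one_sub_one, ← add_assoc]
  ring

lemma jac_mul_snd (hp : 0 < p) (hq : 0 < q) (w : ℝ × ℝ) :
    jac p q φ ρ * w.2 = ρ ^ q * Real.cos φ * (blowDeriv p q (φ, ρ) w).1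
      + ρ ^ p * Real.sin φ * (blowDeriv p q (φ, ρ) w).2 := by
  obtain ⟨p, rfl⟩ := Nat.exists_eq_succ_of_ne_zero hp.ne'
  obtain ⟨q, rfl⟩ := Nat.exists_eq_succ_of_ne_zero hq.ne'
  simp only [jac, blowDeriv, ContinuousLinearMap.prod_apply, add_apply,
    smul_apply, ContinuousLinearMap.coe_fst', ContinuousLinearMap.coe_snd',
    smul_eq_mul, Nat.succ_eq_add_one, Nat.add_one_sub_one, ← add_assoc]
  ring

lemma ker_blowDeriv (hp : 0 < p) (hq : 0 < q) (hρ : 0 < ρ) :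
    LinearMap.ker (blowDeriv p q (φ, ρ)).toLinearMap = ⊥ := by
  refine LinearMap.ker_eq_bot'.2 fun w hw ↦ ?_
  replace hw : blowDeriv p q (φ, ρ) w = 0 := hw
  have h1 := jac_mul_fst (φ := φ) (ρ := ρ) hp hq w
  have h2 := jac_mul_snd (φ := φ) (ρ := ρ) hp hq w
  have hjac := (jac_pos (φ := φ) hp hq hρ).ne'
  ext <;> simp_all

lemma blowDeriv_polar (hp : 0 < p) (hq : 0 < q) (hρ : 0 < ρ) :
    blowDeriv p q (φ, ρ) (ρ ^ r * Theta p q r P Q φ ρ, ρ ^ r * Rad p q r P Q φ ρ)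
      = (polar p q P φ ρ, polar p q Q φ ρ) := by
  obtain ⟨w, hw⟩ := LinearMap.surjective_of_injective
    (LinearMap.ker_eq_bot.1 (ker_blowDeriv (φ := φ) hp hq hρ)) (polar p q P φ ρ, polar p q Q φ ρ)
  replace hw : blowDeriv p q (φ, ρ) w = (polar p q P φ ρ, polar p q Q φ ρ) := hw
  have hjac := (jac_pos (φ := φ) hp hq hρ).ne'
  have hr := (pow_pos hρ r).ne'
  have h1 : ρ ^ r * Theta p q r P Q φ ρ = w.1 := by
    rw [Theta, if_neg hρ.ne']
    field_simp
    rw [jac_mul_fst hp hq, hw]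
  have h2 : ρ ^ r * Rad p q r P Q φ ρ = w.2 := by
    rw [Rad]
    field_simp
    rw [jac_mul_snd hp hq, hw]
  rw [h1, h2, Prod.mk.eta, hw]

lemma hasDerivWithinAt_polar (hp : 0 < p) (hq : 0 < q) {I : Set ℝ} {t : ℝ} (ht : t ∈ I)
    {φ ρ : ℝ → ℝ} {γ : ℝ → ℝ × ℝ} (hφ : ContinuousWithinAt φ I t) (hρ : ContinuousWithinAt ρ I t)
    (hρ0 : 0 < ρ t) (hγ : ∀ s ∈ I, blow p q (φ s, ρ s) = γ s)
    (hode : HasDerivWithinAt γ (P (γ t).1 (γ t).2, Q (γ t).1 (γ t).2) I t) :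
    HasDerivWithinAt φ (ρ t ^ r * Theta p q r P Q (φ t) (ρ t)) I t ∧
      HasDerivWithinAt ρ (ρ t ^ r * Rad p q r P Q (φ t) (ρ t)) I t := by
  obtain ⟨B, hB⟩ := LinearMap.exists_leftInverse_of_injective
    (blowDeriv p q (φ t, ρ t)).toLinearMap (ker_blowDeriv hp hq hρ0)
  have hBA : LeftInverse (LinearMap.toContinuousLinearMap B) (blowDeriv p q (φ t, ρ t)) :=
    fun w ↦ LinearMap.congr_fun hB w
  have hlim : Tendsto (fun s ↦ (φ s, ρ s)) (𝓝[I] t) (𝓝[univ] (φ t, ρ t)) := by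
    rw [nhdsWithin_univ]
    exact hφ.prodMk_nhds hρ
  have hmain := (HasFDerivWithinAt.of_comp_of_leftInverse (g := fun s ↦ (φ s, ρ s)) hlim
    (hasFDerivAt_blow p q _).hasFDerivWithinAt hode.hasFDerivWithinAt
    (eventually_mem_nhdsWithin.mono hγ) hBA ht).hasDerivWithinAt
  have hpolar : (P (γ t).1 (γ t).2, Q (γ t).1 (γ t).2)
      = blowDeriv p q (φ t, ρ t)
        (ρ t ^ r * Theta p q r P Q (φ t) (ρ t), ρ t ^ r * Rad p q r P Q (φ t) (ρ t)) := by
    rw [blowDeriv_polar hp hq hρ0, ← hγ t ht]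
    rfl
  rw [ContinuousLinearMap.comp_apply, ContinuousLinearMap.toSpanSingleton_apply, one_smul, hpolar,
    hBA] at hmain
  exact ⟨hmain.fst, hmain.snd⟩

lemma polar_add_two_pi (f : ℝ → ℝ → ℝ) : polar p q f (φ + 2 * Real.pi) ρ = polar p q f φ ρ := by
  simp [polar]

lemma Theta_add_two_pi : Theta p q r P Q (φ + 2 * Real.pi) ρ = Theta p q r P Q φ ρ := by
  simp [Theta, jac, polar_add_two_pi]

lemma Rad_add_two_pi : Rad p q r P Q (φ + 2 * Real.pi) ρ = Rad p q r P Q φ ρ := by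
  simp [Rad, jac, polar_add_two_pi]

lemma F_add_two_pi : F p q r P Q (φ + 2 * Real.pi) ρ = F p q r P Q φ ρ := by
  rw [F, Rad_add_two_pi, Theta_add_two_pi, F]

/-- `e` is so small that `P`, `Q` are analytic at the points of norm less than `e` and the angular
component of the polar vector field does not vanish for `0 < ρ < e`. -/
structure IsRegularStrip (p q r : ℕ) (P Q : ℝ → ℝ → ℝ) (e : ℝ) : Prop where
  p_pos : 0 < p
  q_pos : 0 < q
  pos : 0 < e
  le_one : e ≤ 1
  analyticAt_left : ∀ z : ℝ × ℝ, ‖z‖ < e → AnalyticAt ℝ (fun z : ℝ × ℝ ↦ P z.1 z.2) z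
  analyticAt_right : ∀ z : ℝ × ℝ, ‖z‖ < e → AnalyticAt ℝ (fun z : ℝ × ℝ ↦ Q z.1 z.2) z
  Theta_ne_zero : ∀ φ, ∀ ρ ∈ Ioo 0 e, Theta p q r P Q φ ρ ≠ 0

lemma IsRegularStrip.mono {e' : ℝ} (h : IsRegularStrip p q r P Q e) (h0 : 0 < e') (he : e' ≤ e) :
    IsRegularStrip p q r P Q e' where
  p_pos := h.p_pos
  q_pos := h.q_pos
  pos := h0
  le_one := he.trans h.le_one
  analyticAt_left z hz := h.analyticAt_left z (hz.trans_le he)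
  analyticAt_right z hz := h.analyticAt_right z (hz.trans_le he)
  Theta_ne_zero φ ρ hρ := h.Theta_ne_zero φ ρ (Ioo_subset_Ioo_right he hρ)

lemma contDiff_blow {n : WithTop ℕ∞} : ContDiff ℝ n (blow p q) := by
  unfold blow
  fun_prop

lemma contDiffAt_polar {n : WithTop ℕ∞} (hp : 0 < p) (hq : 0 < q) (he : e ≤ 1) {f : ℝ → ℝ → ℝ}
    (hf : ∀ z : ℝ × ℝ, ‖z‖ < e → AnalyticAt ℝ (fun z : ℝ × ℝ ↦ f z.1 z.2) z) {z : ℝ × ℝ}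
    (hz : |z.2| < e) : ContDiffAt ℝ n (fun z ↦ polar p q f z.1 z.2) z :=
  ((hf (blow p q z) ((norm_blow_le hp hq (hz.le.trans he)).trans_lt hz)).contDiffAt).comp z
    contDiff_blow.contDiffAt

namespace IsRegularStrip

lemma contDiffAt_polar_div {n : WithTop ℕ∞} (h : IsRegularStrip p q r P Q e)
    {a b : ℝ × ℝ → ℝ} (ha : ContDiff ℝ n a) (hb : ContDiff ℝ n b) {z : ℝ × ℝ}
    (hz : z.2 ∈ Ioo 0 e) :
    ContDiffAt ℝ n (fun z ↦ (a z * polar p q P z.1 z.2 + b z * polar p q Q z.1 z.2)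
      / (jac p q z.1 z.2 * z.2 ^ r)) z := by
  have hz' : |z.2| < e := by simpa only [abs_of_pos hz.1] using hz.2
  have hP := contDiffAt_polar (n := n) h.p_pos h.q_pos h.le_one h.analyticAt_left hz'
  have hQ := contDiffAt_polar (n := n) h.p_pos h.q_pos h.le_one h.analyticAt_right hz'
  refine ContDiffAt.div (by fun_prop) (by unfold jac; fun_prop) ?_
  exact mul_ne_zero (jac_pos h.p_pos h.q_pos hz.1).ne' (pow_pos hz.1 r).ne'

lemma contDiffOn_Theta {n : WithTop ℕ∞} (h : IsRegularStrip p q r P Q e) :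
    ContDiffOn ℝ n (uncurry (Theta p q r P Q)) (univ ×ˢ Ioo 0 e) := by
  refine ContDiffOn.congr (fun z hz ↦ (h.contDiffAt_polar_div
    (a := fun z ↦ -(q * z.2 ^ (q - 1) * Real.sin z.1))
    (b := fun z ↦ p * z.2 ^ (p - 1) * Real.cos z.1)
    (by fun_prop) (by fun_prop) hz.2).contDiffWithinAt) fun z hz ↦ ?_
  rw [uncurry, Theta, if_neg hz.2.1.ne']
  ring

lemma contDiffOn_Rad {n : WithTop ℕ∞} (h : IsRegularStrip p q r P Q e) :
    ContDiffOn ℝ n (uncurry (Rad p q r P Q)) (univ ×ˢ Ioo 0 e) := fun z hz ↦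
  (h.contDiffAt_polar_div (a := fun z ↦ z.2 ^ q * Real.cos z.1)
    (b := fun z ↦ z.2 ^ p * Real.sin z.1) (by fun_prop) (by fun_prop) hz.2).contDiffWithinAt

lemma contDiffOn_F {n : WithTop ℕ∞} (h : IsRegularStrip p q r P Q e) :
    ContDiffOn ℝ n (uncurry (F p q r P Q)) (univ ×ˢ Ioo 0 e) :=
  h.contDiffOn_Rad.div h.contDiffOn_Theta fun z hz ↦ h.Theta_ne_zero z.1 z.2 hz.2

end IsRegularStrip

end PolarEquation

section PoincareMap

variable {p q r : ℕ} {P Q : ℝ → ℝ → ℝ} {e : ℝ}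

lemma isSolOn_comp_invFunOn {f : ℝ → ℝ → ℝ} {s : Set ℝ} {a b t u : ℝ} {φ ρ φ' ρ' : ℝ → ℝ}
    (hφ : ∀ t ∈ Icc a b, HasDerivWithinAt φ (φ' t) (Icc a b) t)
    (hρ : ∀ t ∈ Icc a b, HasDerivWithinAt ρ (ρ' t) (Icc a b) t) (hne : ∀ t ∈ Icc a b, φ' t ≠ 0)
    (hs : MapsTo ρ (Icc a b) s) (hf : ∀ t ∈ Icc a b, ρ' t / φ' t = f (φ t) (ρ t))
    (ht : t ∈ Icc a b) (hu : u ∈ Icc a b) :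
    IsSolOn f s (φ t ⊓ φ u) (φ t ⊔ φ u) (ρ ∘ invFunOn φ (Icc a b)) := by
  have hsub := uIcc_subset_image_Icc (HasDerivWithinAt.continuousOn hφ) ht hu
  have hleft := (injOn_of_deriv_ne_zero hφ hne).leftInvOn_invFunOn
  refine ⟨fun _ hv ↦ ?_, fun _ hv ↦ ?_⟩ <;> obtain ⟨v, hvI, rfl⟩ := hsub hv
  · simpa only [comp_apply, hleft hvI] using hs hvI
  · rw [comp_apply, hleft hvI, ← hf v hvI]
    exact (hasDerivWithinAt_comp_invFunOn hφ hne hvI (hρ v hvI)).mono hsub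

namespace IsTurn

variable {ε T t : ℝ} {γ : ℝ → ℝ × ℝ} {θ : ℝ → ℝ}

lemma ne_zero (hT : IsTurn P Q ε T γ θ) (ht : t ∈ Icc 0 T) : γ t ≠ 0 := by
  obtain ⟨s, hs, hγ⟩ := hT.angle t ht
  exact hγ ▸ polar_ne_zero hs

lemma blow_weightedAngle (hT : IsTurn P Q ε T γ θ) (hp : 0 < p) (hq : 0 < q) (ht : t ∈ Icc 0 T) :
    blow p q (weightedAngle p q (γ t) (θ t), radius p q (γ t)) = γ t := by
  obtain ⟨s, hs, hγ⟩ := hT.angle t ht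
  exact Monodromic.blow_weightedAngle hp hq hs hγ

lemma continuousOn_radius (hT : IsTurn P Q ε T γ θ) (hp : 0 < p) (hq : 0 < q) :
    ContinuousOn (fun t ↦ radius p q (γ t)) (Icc 0 T) := fun t ht ↦
  (continuousAt_radius hp hq (hT.ne_zero ht)).comp_continuousWithinAt
    (hT.ode t ht).continuousWithinAt

lemma continuousOn_weightedAngle (hT : IsTurn P Q ε T γ θ) (hp : 0 < p) (hq : 0 < q) :
    ContinuousOn (fun t ↦ weightedAngle p q (γ t) (θ t)) (Icc 0 T) :=
  have hρ := hT.continuousOn_radius hp hq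
  have hρ0 : ∀ t ∈ Icc 0 T, 0 < radius p q (γ t) := fun _ ht ↦ radius_pos hp hq (hT.ne_zero ht)
  continuousOn_twist (hρ.pow q) (hρ.pow p) hT.cont (fun t ht ↦ pow_pos (hρ0 t ht) q)
    fun t ht ↦ pow_pos (hρ0 t ht) p

lemma exists_isSolOn (hT : IsTurn P Q ε T γ θ) (h : IsRegularStrip p q r P Q e)
    (hsmall : ∀ t ∈ Icc 0 T, radius p q (γ t) < e) :
    0 < Theta p q r P Q (weightedAngle p q (γ 0) (θ 0)) (radius p q (γ 0))
        * (weightedAngle p q (γ T) (θ T) - weightedAngle p q (γ 0) (θ 0)) ∧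
      ∃ Φ : ℝ → ℝ, ∀ t ∈ Icc 0 T, Φ (weightedAngle p q (γ t) (θ t)) = radius p q (γ t) ∧
        IsSolOn (F p q r P Q) (Ioo 0 e)
          (weightedAngle p q (γ 0) (θ 0) ⊓ weightedAngle p q (γ t) (θ t))
          (weightedAngle p q (γ 0) (θ 0) ⊔ weightedAngle p q (γ t) (θ t)) Φ := by
  have hφ := hT.continuousOn_weightedAngle h.p_pos h.q_pos
  have hρ := hT.continuousOn_radius h.p_pos h.q_pos
  have hρ0 : ∀ t ∈ Icc 0 T, 0 < radius p q (γ t) := fun t ht ↦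
    radius_pos h.p_pos h.q_pos (hT.ne_zero ht)
  have hblow : ∀ t ∈ Icc 0 T, blow p q (weightedAngle p q (γ t) (θ t), radius p q (γ t)) = γ t :=
    fun t ht ↦ hT.blow_weightedAngle h.p_pos h.q_pos ht
  have hd := fun t (ht : t ∈ Icc 0 T) ↦ hasDerivWithinAt_polar (r := r) h.p_pos h.q_pos ht
    (hφ t ht) (hρ t ht) (hρ0 t ht) hblow (hT.ode t ht)
  set φ := fun t ↦ weightedAngle p q (γ t) (θ t)
  set ρ := fun t ↦ radius p q (γ t)
  have hne : ∀ t ∈ Icc 0 T, ρ t ^ r * Theta p q r P Q (φ t) (ρ t) ≠ 0 := fun t ht ↦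
    mul_ne_zero (pow_pos (hρ0 t ht) r).ne' (h.Theta_ne_zero _ _ ⟨hρ0 t ht, hsmall t ht⟩)
  have h0 : (0 : ℝ) ∈ Icc 0 T := left_mem_Icc.2 hT.pos.le
  refine ⟨?_, ρ ∘ invFunOn φ (Icc 0 T), fun t ht ↦ ⟨?_, ?_⟩⟩
  · have := deriv_mul_sub_pos hT.pos (fun t ht ↦ (hd t ht).1) hne
    rw [mul_assoc] at this
    exact pos_of_mul_pos_right this (pow_pos (hρ0 0 h0) r).le
  · exact congrArg ρ
      ((injOn_of_deriv_ne_zero (fun t ht ↦ (hd t ht).1) hne).leftInvOn_invFunOn ht)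
  · exact isSolOn_comp_invFunOn (fun t ht ↦ (hd t ht).1) (fun t ht ↦ (hd t ht).2) hne
      (fun t ht ↦ ⟨hρ0 t ht, hsmall t ht⟩)
      (fun t ht ↦ mul_div_mul_left _ _ (pow_pos (hρ0 t ht) r).ne') h0 ht

lemma weightedAngle_of_axis (hT : IsTurn P Q ε T γ θ) {ρ : ℝ} (hρ : 0 < ρ)
    (h0 : γ 0 = blow p q (0, ρ)) : (∃ k : ℤ, weightedAngle p q (γ 0) (θ 0) = k * (2 * Real.pi)) ∧
      |weightedAngle p q (γ T) (θ T) - weightedAngle p q (γ 0) (θ 0)| = 2 * Real.pi := by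
  obtain ⟨s, hs, hang⟩ := hT.angle 0 (left_mem_Icc.2 hT.pos.le)
  rw [h0, blow, Real.cos_zero, Real.sin_zero, mul_one, mul_zero, Prod.mk.injEq] at hang
  have hsin : Real.sin (θ 0) = 0 := (mul_eq_zero.1 hang.2.symm).resolve_left hs.ne'
  have hcos : 0 < Real.cos (θ 0) := pos_of_mul_pos_right (hang.1 ▸ pow_pos hρ p) hs.le
  have hcos1 : Real.cos (θ 0) = 1 := by
    nlinarith [Real.cos_sq_add_sin_sq (θ 0)]
  have hsinT : Real.sin (θ T) = 0 := by
    rcases (abs_eq Real.two_pi_pos.le).1 hT.turn with h | h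
    · rw [eq_add_of_sub_eq' h, Real.sin_add_two_pi, hsin]
    · rw [eq_add_of_sub_eq' h, ← sub_eq_add_neg, Real.sin_sub_two_pi, hsin]
  rw [weightedAngle_of_sin_eq_zero hsin, weightedAngle_of_sin_eq_zero hsinT]
  obtain ⟨k, hk⟩ := (Real.cos_eq_one_iff _).1 hcos1
  exact ⟨⟨k, hk.symm⟩, hT.turn⟩

end IsTurn

lemma IsMonodromic.exists_isTurn_radius_lt (hm : IsMonodromic P Q) (hp : 0 < p) (hq : 0 < q)
    (he : 0 < e) : ∃ δ > 0, ∀ φ, ∀ ρ ∈ Ioo 0 δ, ∃ ε T γ θ, IsTurn P Q ε T γ θ ∧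
      γ 0 = blow p q (φ, ρ) ∧ ∀ t ∈ Icc 0 T, radius p q (γ t) < e := by
  obtain ⟨ε, hε, hrad⟩ := exists_radius_lt hp hq he
  obtain ⟨δ, hδ, hturn⟩ := hm.2.2 ε hε
  refine ⟨min 1 δ, lt_min one_pos hδ, fun φ ρ hρ ↦ ?_⟩
  have hnorm : ‖blow p q (φ, ρ)‖ < δ := by
    obtain ⟨h1, hlt⟩ := lt_min_iff.1 ((abs_of_pos hρ.1).trans_lt hρ.2)
    exact (norm_blow_le hp hq h1.le).trans_lt hlt
  obtain ⟨T, γ, θ, hT, h0⟩ := hturn _ (blow_ne_zero hρ.1) hnorm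
  exact ⟨ε, T, γ, θ, hT, h0, fun t ht ↦ hrad _ (hT.ne_zero ht) (hT.small t ht)⟩

namespace IsRegularStrip

lemma exists_isSolOn_of_axis (h : IsRegularStrip p q r P Q e) (hm : IsMonodromic P Q) :
    ∃ δ > 0, ∀ ρ ∈ Ioo 0 δ, ∃ Φ, IsSolOn (F p q r P Q) (Ioo 0 e) 0 (2 * Real.pi) Φ ∧
      (0 < Theta p q r P Q 0 ρ ∧ Φ 0 = ρ ∨ Theta p q r P Q 0 ρ < 0 ∧ Φ (2 * Real.pi) = ρ) := by
  obtain ⟨δ, hδ, hturn⟩ := hm.exists_isTurn_radius_lt h.p_pos h.q_pos h.pos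
  refine ⟨δ, hδ, fun ρ hρ ↦ ?_⟩
  obtain ⟨ε, T, γ, θ, hT, h0, hsmall⟩ := hturn 0 ρ hρ
  have hTT : T ∈ Icc 0 T := right_mem_Icc.2 hT.pos.le
  obtain ⟨⟨k, hk⟩, hφT⟩ := hT.weightedAngle_of_axis hρ.1 h0
  obtain ⟨hdir, Φ, hΦ⟩ := hT.exists_isSolOn h hsmall
  have hΘ : Periodic (fun φ ↦ Theta p q r P Q φ ρ) (2 * Real.pi) := fun _ ↦ Theta_add_two_pi
  have hF : ∀ (k : ℤ) φ ρ, F p q r P Q (φ + k * (2 * Real.pi)) ρ = F p q r P Q φ ρ := fun k φ ρ ↦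
    Periodic.int_mul (f := fun φ ↦ F p q r P Q φ ρ) (fun _ ↦ F_add_two_pi) k φ
  have hρ0 : radius p q (γ 0) = ρ := by rw [h0, radius_blow h.p_pos h.q_pos hρ.1]
  obtain ⟨hΦ0, -⟩ := hΦ 0 (left_mem_Icc.2 hT.pos.le)
  obtain ⟨-, hsol⟩ := hΦ T hTT
  rw [hk, hρ0] at hΦ0 hdir
  rw [hk] at hsol hφT
  rw [hΘ.int_mul_eq] at hdir
  set φT := weightedAngle p q (γ T) (θ T)
  rcases (abs_eq Real.two_pi_pos.le).1 hφT with h1 | h1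
  · rw [h1] at hdir
    refine ⟨fun φ ↦ Φ (φ + k * (2 * Real.pi)), ?_,
      .inl ⟨pos_of_mul_pos_left hdir Real.two_pi_pos.le, ?_⟩⟩
    · rw [inf_of_le_left (by linarith [Real.two_pi_pos]),
        sup_of_le_right (by linarith [Real.two_pi_pos])] at hsol
      have := hsol.shift (hF k)
      rwa [h1, sub_self] at this
    · simpa only [zero_add] using hΦ0
  · rw [h1] at hdir
    refine ⟨fun φ ↦ Φ (φ + (k - 1 : ℤ) * (2 * Real.pi)), ?_, .inr ⟨?_, ?_⟩⟩
    · rw [inf_of_le_right (by linarith [Real.two_pi_pos]),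
        sup_of_le_left (by linarith [Real.two_pi_pos])] at hsol
      convert! hsol.shift (hF (k - 1)) using 1 <;> push_cast <;> linarith
    · exact neg_of_mul_pos_left hdir (neg_nonpos.2 Real.two_pi_pos.le)
    · have hk1 : 2 * Real.pi + (k - 1 : ℤ) * (2 * Real.pi) = k * (2 * Real.pi) := by
        push_cast
        ring
      simpa only [hk1] using hΦ0

end IsRegularStrip

lemma continuousOn_flow {f : ℝ → ℝ → ℝ} {s : Set ℝ} {a b x y c : ℝ} {Φ : ℝ → ℝ → ℝ}
    (hf : ContDiffOn ℝ 1 (uncurry f) (univ ×ˢ s)) (hs : IsOpen s) (hs' : s.OrdConnected)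
    (hc : c ∈ Icc a b) (hxy : x ≤ y)
    (hΦ : ∀ u ∈ Icc x y, IsSolOn f s a b (Φ u) ∧ Φ u c = u) {φ : ℝ} (hφ : φ ∈ Icc a b) :
    ContinuousOn (fun u ↦ Φ u φ) (Icc x y) := by
  have hx := hΦ x (left_mem_Icc.2 hxy)
  have hy := hΦ y (right_mem_Icc.2 hxy)
  obtain ⟨C, _, _, -, -, hlip⟩ := IsSolOn.exists_lipschitz_of_between hf hs hs' hx.1 hy.1 hc
  rw [hx.2, hy.2] at hlip
  refine (LipschitzOnWith.of_dist_le_mul (K := C.toNNReal) fun u hu v hv ↦ ?_).continuousOn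
  have huv := hlip (Φ u) (Φ v) (hΦ u hu).1 (hΦ v hv).1 ((hΦ u hu).2.symm ▸ hu)
    ((hΦ v hv).2.symm ▸ hv) φ hφ
  rw [(hΦ u hu).2, (hΦ v hv).2] at huv
  exact huv.trans (mul_le_mul_of_nonneg_right (Real.le_coe_toNNReal C) (abs_nonneg _))

lemma exists_isSolOn_forward_of_backward {f : ℝ → ℝ → ℝ} {a b : ℝ} (hab : a ≤ b) (he : 0 < e)
    (hf : ContDiffOn ℝ 1 (uncurry f) (univ ×ˢ Ioo 0 e))
    (hbwd : ∀ ε ∈ Ioc 0 e, ∃ δ > 0, ∀ ρ ∈ Ioo 0 δ, ∃ Φ, IsSolOn f (Ioo 0 ε) a b Φ ∧ Φ b = ρ) :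
    ∃ δ > 0, ∀ ρ ∈ Ioo 0 δ, ∃ Φ, IsSolOn f (Ioo 0 e) a b Φ ∧ Φ a = ρ := by
  obtain ⟨δ, hδ, hΨ⟩ := hbwd e (right_mem_Ioc.2 he)
  choose! Ψ hΨ using hΨ
  have ha : a ∈ Icc a b := left_mem_Icc.2 hab
  have hb : b ∈ Icc a b := right_mem_Icc.2 hab
  have hδ2 : δ / 2 ∈ Ioo 0 δ := ⟨half_pos hδ, half_lt_self hδ⟩
  refine ⟨Ψ (δ / 2) a, ((hΨ _ hδ2).1.mem ha).1, fun ρ hρ ↦ ?_⟩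
  have hρe : ρ ∈ Ioc 0 e := ⟨hρ.1, (hρ.2.trans ((hΨ _ hδ2).1.mem ha).2).le⟩
  obtain ⟨δ', hδ', hbwd'⟩ := hbwd ρ hρe
  set x := min (δ' / 2) (δ / 2)
  have hx : x ∈ Ioo 0 δ' := ⟨lt_min (half_pos hδ') hδ2.1, min_lt_of_left_lt (half_lt_self hδ')⟩
  have hmem : ∀ y ∈ Icc x (δ / 2), y ∈ Ioo 0 δ := fun y hy ↦
    ⟨hx.1.trans_le hy.1, hy.2.trans_lt hδ2.2⟩
  have hxδ := hmem x (left_mem_Icc.2 (min_le_right _ _))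
  obtain ⟨Φ, hΦ, hΦb⟩ := hbwd' x hx
  have hlt : Ψ x a < ρ := by
    rw [IsSolOn.eqOn hf isOpen_Ioo ordConnected_Ioo (hΨ x hxδ).1
      (hΦ.mono_set (Ioo_subset_Ioo_right hρe.2)) hb ((hΨ x hxδ).2.trans hΦb.symm) ha]
    exact (hΦ.mem ha).2
  have hcont : ContinuousOn (fun y ↦ Ψ y a) (Icc x (δ / 2)) :=
    continuousOn_flow hf isOpen_Ioo ordConnected_Ioo hb (min_le_right _ _)
      (fun y hy ↦ hΨ y (hmem y hy)) ha
  obtain ⟨y, hy, hya⟩ := intermediate_value_Icc (min_le_right _ _) hcont ⟨hlt.le, hρ.2.le⟩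
  exact ⟨Ψ y, (hΨ y (hmem y hy)).1, hya⟩

namespace IsRegularStrip

lemma Theta_pos_or_neg (h : IsRegularStrip p q r P Q e) (φ : ℝ) :
    (∀ ρ ∈ Ioo 0 e, 0 < Theta p q r P Q φ ρ) ∨ ∀ ρ ∈ Ioo 0 e, Theta p q r P Q φ ρ < 0 := by
  have hc : ContinuousOn (Theta p q r P Q φ) (Ioo 0 e) :=
    (h.contDiffOn_Theta (n := 0)).continuousOn.comp (f := fun ρ ↦ (φ, ρ)) (by fun_prop)
      fun ρ hρ ↦ ⟨mem_univ φ, hρ⟩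
  by_contra! hcon
  obtain ⟨⟨x, hx, hx'⟩, y, hy, hy'⟩ := hcon
  obtain ⟨ρ, hρ, h0⟩ := isPreconnected_Ioo.intermediate_value hx hy hc ⟨hx', hy'⟩
  exact h.Theta_ne_zero φ ρ hρ h0

lemma exists_isSolOn (h : IsRegularStrip p q r P Q e) (hm : IsMonodromic P Q) :
    ∃ δ > 0, ∀ ρ ∈ Ioo 0 δ, ∃ Φ, IsSolOn (F p q r P Q) (Ioo 0 e) 0 (2 * Real.pi) Φ ∧ Φ 0 = ρ := by
  rcases h.Theta_pos_or_neg 0 with hpos | hneg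
  · obtain ⟨δ, hδ, hax⟩ := h.exists_isSolOn_of_axis hm
    refine ⟨min δ e, lt_min hδ h.pos, fun ρ hρ ↦ ?_⟩
    obtain ⟨Φ, hΦ, ⟨-, h0⟩ | ⟨hlt, -⟩⟩ := hax ρ (Ioo_subset_Ioo_right (min_le_left _ _) hρ)
    · exact ⟨Φ, hΦ, h0⟩
    · exact absurd hlt (hpos ρ (Ioo_subset_Ioo_right (min_le_right _ _) hρ)).not_gt
  · refine exists_isSolOn_forward_of_backward Real.two_pi_pos.le h.pos h.contDiffOn_F ?_
    intro ε hε
    obtain ⟨δ, hδ, hax⟩ := (h.mono hε.1 hε.2).exists_isSolOn_of_axis hm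
    refine ⟨min δ e, lt_min hδ h.pos, fun ρ hρ ↦ ?_⟩
    obtain ⟨Φ, hΦ, ⟨hlt, -⟩ | ⟨-, h0⟩⟩ := hax ρ (Ioo_subset_Ioo_right (min_le_left _ _) hρ)
    · exact absurd hlt (hneg ρ (Ioo_subset_Ioo_right (min_le_right _ _) hρ)).not_gt
    · exact ⟨Φ, hΦ, h0⟩

lemma exists_isPoincareMap (h : IsRegularStrip p q r P Q e) (hm : IsMonodromic P Q) :
    ∃ Pi : ℝ → ℝ, IsPoincareMap p q r P Q Pi := by
  obtain ⟨δ₀, hδ₀, hΨ⟩ := h.exists_isSolOn hm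
  choose! Ψ hΨ using hΨ
  refine ⟨fun ρ ↦ Ψ ρ (2 * Real.pi), fun ε hε ↦ ?_⟩
  obtain ⟨δ, hδ, hsol⟩ := (h.mono (lt_min hε h.pos) (min_le_right ε e)).exists_isSolOn hm
  refine ⟨min δ δ₀, lt_min hδ hδ₀, fun ρ hρ hρδ ↦ ?_⟩
  obtain ⟨Φ, hΦ, hΦ0⟩ := hsol ρ ⟨hρ, hρδ.trans_le (min_le_left _ _)⟩
  obtain ⟨hΨρ, hΨ0⟩ := hΨ ρ ⟨hρ, hρδ.trans_le (min_le_right _ _)⟩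
  refine ⟨Φ, hΦ0, ?_, fun φ hφ ↦
    ⟨(hΦ.mem hφ).1, (hΦ.mem hφ).2.trans_le (min_le_left _ _), hΦ.ode φ hφ⟩⟩
  exact IsSolOn.eqOn h.contDiffOn_F isOpen_Ioo ordConnected_Ioo
    (hΦ.mono_set (Ioo_subset_Ioo_right (min_le_right _ _))) hΨρ
    (left_mem_Icc.2 Real.two_pi_pos.le) (hΦ0.trans hΨ0.symm) (right_mem_Icc.2 Real.two_pi_pos.le)

end IsRegularStrip

lemma IsPoincareMap.exists_isSolOn {Pi : ℝ → ℝ} (hPi : IsPoincareMap p q r P Q Pi) (he : 0 < e) :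
    ∃ δ > 0, ∀ ρ ∈ Ioo 0 δ, ∃ Φ, IsSolOn (F p q r P Q) (Ioo 0 e) 0 (2 * Real.pi) Φ ∧ Φ 0 = ρ ∧
      Φ (2 * Real.pi) = Pi ρ := by
  obtain ⟨δ, hδ, h⟩ := hPi e he
  refine ⟨δ, hδ, fun ρ hρ ↦ ?_⟩
  obtain ⟨Φ, h0, h2π, hΦ⟩ := h ρ hρ.1 hρ.2
  exact ⟨Φ, ⟨fun φ hφ ↦ ⟨(hΦ φ hφ).1, (hΦ φ hφ).2.1⟩, fun φ hφ ↦ (hΦ φ hφ).2.2⟩, h0, h2π⟩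

end PoincareMap

section ClosedOrbits

variable {p q r : ℕ} {P Q : ℝ → ℝ → ℝ} {e : ℝ}

lemma IsSolOn.hasDerivAt_of_periodic {f : ℝ → ℝ → ℝ} {s : Set ℝ} {c : ℝ} {Ψ : ℝ → ℝ}
    (hΨ : IsSolOn f s 0 c Ψ) (hc : 0 < c) (hf : Periodic f c) (hper : Periodic Ψ c) (x : ℝ) :
    Ψ x ∈ s ∧ HasDerivAt Ψ (f x (Ψ x)) x := by
  obtain ⟨k, hk, -⟩ := existsUnique_add_zsmul_mem_Ico hc x (0 : ℝ)
  rw [zero_add, zsmul_eq_mul] at hk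
  have hΨk : (fun y ↦ Ψ (y + k * c)) = Ψ := (hper.int_mul k).funext
  suffices h : Ψ (x + k * c) ∈ s ∧
      HasDerivAt Ψ (f (x + k * c) (Ψ (x + k * c))) (x + k * c) by
    have hd := h.2.comp_add_const x (k * c)
    rw [hΨk, hper.int_mul k, hf.int_mul k] at hd
    exact ⟨hper.int_mul k x ▸ h.1, hd⟩
  generalize x + k * c = y at hk
  refine ⟨hΨ.mem (Ico_subset_Icc_self hk), ?_⟩
  have hy := hΨ.ode y (Ico_subset_Icc_self hk)
  rcases hk.1.eq_or_lt with rfl | hpos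
  · have hleft := (hΨ.shift fun φ ρ ↦ congrFun (hf φ) ρ).ode 0 ⟨by linarith, by linarith⟩
    rw [hper, hper.funext, zero_sub, sub_self] at hleft
    refine (hleft.union hy).hasDerivAt ?_
    rw [Icc_union_Icc_eq_Icc (by linarith) hc.le]
    exact Icc_mem_nhds (neg_neg_of_pos hc) hc
  · exact hy.hasDerivAt (Icc_mem_nhds hpos hk.2)

lemma IsSolOn.exists_periodic {f : ℝ → ℝ → ℝ} {s : Set ℝ} {c : ℝ} {Φ : ℝ → ℝ}
    (hΦ : IsSolOn f s 0 c Φ) (hc : 0 < c) (hf : Periodic f c) (hend : Φ c = Φ 0) :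
    ∃ Ψ : ℝ → ℝ, Periodic Ψ c ∧ Ψ 0 = Φ 0 ∧ ∀ x, Ψ x ∈ s ∧ HasDerivAt Ψ (f x (Ψ x)) x := by
  have hper : Periodic (fun x ↦ Φ (toIcoMod hc 0 x)) c := (toIcoMod_periodic hc 0).comp Φ
  refine ⟨_, hper, by simp, (hΦ.congr fun x hx ↦ ?_).hasDerivAt_of_periodic hc hf hper⟩
  rcases hx.2.eq_or_lt with rfl | hlt
  · rw [hper.eq.trans (congrArg Φ (toIcoMod_apply_left hc 0)), hend]
  · rw [(toIcoMod_eq_self hc).2 ⟨hx.1, by rwa [zero_add]⟩]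

lemma abs_sub_eq_two_pi_of_add_two_pi {θ : ℝ → ℝ}
    (hθ : ∀ x, θ (x + 2 * Real.pi) = θ x + 2 * Real.pi) {x y : ℝ}
    (h : y = x + 2 * Real.pi ∨ y = x - 2 * Real.pi) : |θ y - θ x| = 2 * Real.pi := by
  rcases h with rfl | rfl
  · rw [hθ, add_sub_cancel_left, abs_of_pos Real.two_pi_pos]
  · rw [← abs_neg, neg_sub, ← sub_add_cancel x (2 * Real.pi), hθ, sub_add_cancel,
      add_sub_cancel_left, abs_of_pos Real.two_pi_pos]

lemma exists_angle_blow {Ψ : ℝ → ℝ} (hΨ : Continuous Ψ) (hpos : ∀ x, 0 < Ψ x)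
    (hper : Periodic Ψ (2 * Real.pi)) :
    ∃ θ : ℝ → ℝ, Continuous θ ∧ (∀ x, θ (x + 2 * Real.pi) = θ x + 2 * Real.pi) ∧
      ∀ x, ∃ s > 0, blow p q (x, Ψ x) = (s * Real.cos (θ x), s * Real.sin (θ x)) := by
  refine ⟨fun x ↦ twist (Ψ x ^ p) (Ψ x ^ q) x, continuousOn_univ.1 ?_, fun x ↦ ?_, fun x ↦ ?_⟩
  · exact continuousOn_twist (hΨ.pow p).continuousOn (hΨ.pow q).continuousOn continuousOn_id
      (fun x _ ↦ pow_pos (hpos x) p) fun x _ ↦ pow_pos (hpos x) q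
  · simp only [hper x, twist_add_two_pi]
  · obtain ⟨n, hn, h1, h2⟩ := exists_eq_mul_cos_twist (pow_pos (hpos x) p) (pow_pos (hpos x) q) x
    exact ⟨n, hn, Prod.ext h1 h2⟩

lemma IsRegularStrip.hasDerivWithinAt_blow (h : IsRegularStrip p q r P Q e) {Ψ τ : ℝ → ℝ}
    {I : Set ℝ} {t : ℝ} (hmem : Ψ (τ t) ∈ Ioo 0 e)
    (hΨ : HasDerivAt Ψ (F p q r P Q (τ t) (Ψ (τ t))) (τ t))
    (hτ : HasDerivWithinAt τ (Ψ (τ t) ^ r * Theta p q r P Q (τ t) (Ψ (τ t))) I t) :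
    HasDerivWithinAt (fun t ↦ blow p q (τ t, Ψ (τ t)))
      (P (blow p q (τ t, Ψ (τ t))).1 (blow p q (τ t, Ψ (τ t))).2,
        Q (blow p q (τ t, Ψ (τ t))).1 (blow p q (τ t, Ψ (τ t))).2) I t := by
  have hF : F p q r P Q (τ t) (Ψ (τ t)) * (Ψ (τ t) ^ r * Theta p q r P Q (τ t) (Ψ (τ t)))
      = Ψ (τ t) ^ r * Rad p q r P Q (τ t) (Ψ (τ t)) := by
    rw [F, mul_left_comm, div_mul_cancel₀ _ (h.Theta_ne_zero _ _ hmem)]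
  have hpair := hτ.prodMk (hΨ.comp_hasDerivWithinAt t hτ)
  rw [hF] at hpair
  have hblow := (hasFDerivAt_blow p q (τ t, Ψ (τ t))).comp_hasDerivWithinAt t hpair
  rwa [blowDeriv_polar h.p_pos h.q_pos hmem.1] at hblow

lemma IsRegularStrip.exists_isTurn_of_periodic (h : IsRegularStrip p q r P Q e) {Ψ : ℝ → ℝ}
    (hΨ : ∀ x, Ψ x ∈ Ioo 0 e ∧ HasDerivAt Ψ (F p q r P Q x (Ψ x)) x)
    (hper : Periodic Ψ (2 * Real.pi)) (φ : ℝ) :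
    ∃ T γ θ, IsTurn P Q e T γ θ ∧ γ 0 = blow p q (φ, Ψ φ) ∧ γ T = blow p q (φ, Ψ φ) := by
  have hΨc : Continuous Ψ := continuous_iff_continuousAt.2 fun x ↦ (hΨ x).2.continuousAt
  have hpos : ∀ x, 0 < Ψ x := fun x ↦ (hΨ x).1.1
  have hw : Continuous fun x ↦ Ψ x ^ r * Theta p q r P Q x (Ψ x) :=
    (hΨc.pow r).mul ((h.contDiffOn_Theta (n := 0)).continuousOn.comp_continuous
      (continuous_id.prodMk hΨc) fun x ↦ ⟨mem_univ x, (hΨ x).1⟩)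
  obtain ⟨T, hT, τ, hτ0, hτT, hτ⟩ := exists_autonomous hw
    (fun x ↦ mul_ne_zero (pow_pos (hpos x) r).ne' (h.Theta_ne_zero _ _ (hΨ x).1)) φ
    Real.two_pi_pos
  have hbper : Periodic (fun x ↦ blow p q (x, Ψ x)) (2 * Real.pi) := fun x ↦ by
    simp only [hper x, blow_add_two_pi]
  have hend : blow p q (τ T, Ψ (τ T)) = blow p q (φ, Ψ φ) := by
    rcases hτT with h1 | h1 <;> rw [h1]
    exacts [hbper φ, hbper.sub_eq φ]
  obtain ⟨θ, hθ, hθper, hang⟩ := exists_angle_blow (p := p) (q := q) hΨc hpos hper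
  refine ⟨T, fun t ↦ blow p q (τ t, Ψ (τ t)), θ ∘ τ,
    ⟨hT, fun t ht ↦ h.hasDerivWithinAt_blow (hΨ _).1 (hΨ _).2 (hτ t ht), fun t _ ↦ ?_,
    hθ.comp_continuousOn fun t ht ↦ (hτ t ht).continuousWithinAt, fun t _ ↦ hang (τ t), ?_⟩,
    by simp only [hτ0], hend⟩
  · have habs : |Ψ (τ t)| < e := (abs_of_pos (hpos _)).trans_lt (hΨ _).1.2
    exact (norm_blow_le h.p_pos h.q_pos (habs.le.trans h.le_one)).trans_lt habs
  · rw [comp_apply, comp_apply, hτ0]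
    exact abs_sub_eq_two_pi_of_add_two_pi hθper hτT

lemma IsTurn.exists_angle_eq_int_mul_two_pi {ε T : ℝ} {γ : ℝ → ℝ × ℝ} {θ : ℝ → ℝ}
    (hT : IsTurn P Q ε T γ θ) : ∃ t ∈ Icc 0 T, ∃ k : ℤ, θ t = k * (2 * Real.pi) := by
  have hlen : uIcc (θ 0) (θ T) = Icc (θ 0 ⊓ θ T) (θ 0 ⊓ θ T + 2 * Real.pi) := by
    rw [← hT.turn, uIcc, ← max_sub_min_eq_abs, inf_comm, sup_comm, max_def, min_def]
    congr 1
    split_ifs <;> ring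
  obtain ⟨k, hk, -⟩ := existsUnique_add_zsmul_mem_Ico Real.two_pi_pos 0 (θ 0 ⊓ θ T)
  rw [zero_add, zsmul_eq_mul] at hk
  obtain ⟨t, ht, h⟩ := uIcc_subset_image_Icc hT.cont (left_mem_Icc.2 hT.pos.le)
    (right_mem_Icc.2 hT.pos.le) (hlen ▸ Ico_subset_Icc_self hk)
  exact ⟨t, ht, k, h⟩

lemma IsMonodromic.exists_isSolOn_to_axis (hm : IsMonodromic P Q)
    (h : IsRegularStrip p q r P Q e) : ∃ δ > 0, ∀ z : ℝ × ℝ, z ≠ 0 → ‖z‖ < δ →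
      ∃ φ, ∃ k : ℤ, ∃ Φ : ℝ → ℝ, blow p q (φ, Φ φ) = z ∧
        IsSolOn (F p q r P Q) (Ioo 0 e) (φ ⊓ k * (2 * Real.pi)) (φ ⊔ k * (2 * Real.pi)) Φ := by
  obtain ⟨ε, hε, hrad⟩ := exists_radius_lt h.p_pos h.q_pos h.pos
  obtain ⟨δ, hδ, hturn⟩ := hm.2.2 ε hε
  refine ⟨δ, hδ, fun z hz hzδ ↦ ?_⟩
  obtain ⟨T, γ, θ, hT, rfl⟩ := hturn z hz hzδ
  obtain ⟨t, ht, k, hk⟩ := hT.exists_angle_eq_int_mul_two_pi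
  obtain ⟨-, Φ, hΦ⟩ := hT.exists_isSolOn h fun t ht ↦ hrad _ (hT.ne_zero ht) (hT.small t ht)
  have hsin : Real.sin (θ t) = 0 := by
    rw [hk, ← zero_add (_ * _), Real.sin_add_int_mul_two_pi, Real.sin_zero]
  have h0 : (0 : ℝ) ∈ Icc 0 T := left_mem_Icc.2 hT.pos.le
  refine ⟨weightedAngle p q (γ 0) (θ 0), k, Φ, ?_, ?_⟩
  · rw [(hΦ 0 h0).1, hT.blow_weightedAngle h.p_pos h.q_pos h0]
  · rw [← hk, ← weightedAngle_of_sin_eq_zero (p := p) (q := q) (z := γ t) hsin]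
    exact (hΦ t ht).2

lemma IsRegularStrip.isCenter_of_poincareMap_eq_id (h : IsRegularStrip p q r P Q e)
    (hm : IsMonodromic P Q) {Pi : ℝ → ℝ} (hPi : IsPoincareMap p q r P Q Pi)
    (hid : ∀ᶠ ρ in 𝓝[>] 0, Pi ρ = ρ) : IsCenter P Q := by
  refine ⟨hm.1, hm.2.1, fun ε hε ↦ ?_⟩
  obtain ⟨d, hd, hid⟩ := mem_nhdsGT_iff_exists_Ioo_subset.1 hid
  have h₁ := h.mono (lt_min hε h.pos) (min_le_right ε e)
  obtain ⟨δ₁, hδ₁, hsol⟩ := hPi.exists_isSolOn h₁.pos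
  have h₂ := h.mono (lt_min (lt_min hδ₁ hd) h.pos) (min_le_right (min δ₁ d) e)
  obtain ⟨δ, hδ, hΦ⟩ := hm.exists_isSolOn_to_axis h₂
  refine ⟨δ, hδ, fun z hz hzδ ↦ ?_⟩
  obtain ⟨φ, k, Φ, hz, hΦ⟩ := hΦ z hz hzδ
  set φ₁ := k * (2 * Real.pi) with hφ₁
  obtain ⟨hρ₀, hρ⟩ := hΦ.mem (x := φ₁) ⟨inf_le_right, le_sup_right⟩
  obtain ⟨hρ₁, hρd⟩ := lt_min_iff.1 (lt_min_iff.1 hρ).1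
  obtain ⟨Φ₁, hΦ₁, hΦ₁0, hΦ₁e⟩ := hsol _ ⟨hρ₀, hρ₁⟩
  obtain ⟨Ψ, hper, hΨ0, hΨ⟩ := hΦ₁.exists_periodic Real.two_pi_pos
    (fun φ ↦ funext fun ρ ↦ F_add_two_pi) (by rw [hΦ₁e, hΦ₁0, hid ⟨hρ₀, hρd⟩])
  have hΨe : ∀ x, Ψ x ∈ Ioo 0 e := fun x ↦ Ioo_subset_Ioo_right (min_le_right _ _) (hΨ x).1
  have heq : Ψ φ = Φ φ := IsSolOn.eqOn h.contDiffOn_F isOpen_Ioo ordConnected_Ioo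
    ⟨fun x _ ↦ hΨe x, fun x _ ↦ (hΨ x).2.hasDerivWithinAt⟩
    (hΦ.mono_set (Ioo_subset_Ioo_right (min_le_right _ _))) ⟨inf_le_right, le_sup_right⟩
    (by rw [hφ₁, hper.int_mul_eq, hΨ0, hΦ₁0]) ⟨inf_le_left, le_sup_left⟩
  obtain ⟨T, γ, θ, hT, h0, hend⟩ := h₁.exists_isTurn_of_periodic hΨ hper φ
  rw [heq, hz] at h0 hend
  exact ⟨T, γ, θ, { hT with small := fun t ht ↦ (hT.small t ht).trans_le (min_le_left _ _) },
    h0, hend⟩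

end ClosedOrbits

section RegularLimit

open Asymptotics
open scoped ContDiff

/-- The filter of points `(φ, ρ)` with `φ ∈ K` and `ρ → 0⁺`; properties that hold eventually along
it hold for small `ρ > 0`, uniformly in `φ ∈ K`. -/
def nearAxis (K : Set ℝ) : Filter (ℝ × ℝ) := 𝓟 K ×ˢ 𝓝[>] 0

variable {K : Set ℝ} {f u v : ℝ → ℝ → ℝ} {u₀ v₀ : ℝ → ℝ} {e : ℝ}

lemma eventually_nearAxis_iff {P : ℝ × ℝ → Prop} :
    (∀ᶠ z in nearAxis K, P z) ↔ ∃ δ > 0, ∀ φ ∈ K, ∀ ρ ∈ Ioo 0 δ, P (φ, ρ) := by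
  refine ((hasBasis_principal K).prod (nhdsGT_basis (0 : ℝ))).eventually_iff.trans ?_
  simp only [true_and, Prod.exists, Prod.forall, mem_prod, and_imp, exists_const]
  grind

lemma eventually_nearAxis_pos (K : Set ℝ) : ∀ᶠ z in nearAxis K, z.1 ∈ K ∧ 0 < z.2 :=
  eventually_nearAxis_iff.2 ⟨1, one_pos, fun _ hφ _ hρ ↦ ⟨hφ, hρ.1⟩⟩

lemma tendsto_snd_nearAxis (K : Set ℝ) : Tendsto Prod.snd (nearAxis K) (𝓝 0) :=
  tendsto_snd.mono_right nhdsWithin_le_nhds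

lemma isBigO_snd_one (K : Set ℝ) : (Prod.snd : ℝ × ℝ → ℝ) =O[nearAxis K] fun _ ↦ (1 : ℝ) :=
  (tendsto_snd_nearAxis K).isBigO_one ℝ

lemma isBigO_fst_of_continuousOn (hK : IsCompact K) (hu₀ : ContinuousOn u₀ K) :
    (fun z ↦ u₀ z.1) =O[nearAxis K] fun _ ↦ (1 : ℝ) := by
  obtain ⟨C, hC⟩ := hK.exists_bound_of_continuousOn hu₀
  refine .of_bound C ((eventually_nearAxis_pos K).mono fun z hz ↦ ?_)
  simpa using hC z.1 hz.1

lemma isBigO_one_nearAxis (hK : IsCompact K) (he : 0 < e)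
    (hf : ContinuousOn (uncurry f) (univ ×ˢ Ioo (-e) e)) :
    uncurry f =O[nearAxis K] fun _ ↦ (1 : ℝ) := by
  have hsub : K ×ˢ Icc 0 (e / 2) ⊆ univ ×ˢ Ioo (-e) e :=
    prod_mono (subset_univ _) (Icc_subset_Ioo (by linarith) (by linarith))
  obtain ⟨C, hC⟩ := (hK.prod isCompact_Icc).exists_bound_of_continuousOn (hf.mono hsub)
  refine .of_bound C (eventually_nearAxis_iff.2 ⟨e / 2, half_pos he, fun φ hφ ρ hρ ↦ ?_⟩)
  simpa using hC (φ, ρ) ⟨hφ, Ioo_subset_Icc_self hρ⟩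

lemma isBigO_pow_succ_of_hasDerivAt {f' : ℝ → ℝ → ℝ} {N : ℕ} (he : 0 < e)
    (hf : ∀ φ ∈ K, ∀ ρ ∈ Ioo (-e) e, HasDerivAt (f φ) (f' φ ρ) ρ) (hf0 : ∀ φ ∈ K, f φ 0 = 0)
    (hf' : uncurry f' =O[nearAxis K] fun z ↦ z.2 ^ N) :
    uncurry f =O[nearAxis K] fun z ↦ z.2 ^ (N + 1) := by
  obtain ⟨C, hC⟩ := hf'.bound
  obtain ⟨δ, hδ, hδC⟩ := eventually_nearAxis_iff.1 hC
  refine .of_bound C (eventually_nearAxis_iff.2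
    ⟨min δ e, lt_min hδ he, fun φ hφ ρ ⟨hρ0, hρ⟩ ↦ ?_⟩)
  obtain ⟨hρδ, hρe⟩ := lt_min_iff.1 hρ
  have hder : ∀ x ∈ Icc 0 ρ, HasDerivAt (f φ) (f' φ x) x := fun x hx ↦
    hf φ hφ x ⟨by linarith [hx.1], hx.2.trans_lt hρe⟩
  obtain ⟨x, hx, hslope⟩ := exists_hasDerivAt_eq_slope (f φ) (f' φ) hρ0
    (fun x hx ↦ (hder x hx).continuousAt.continuousWithinAt)
    (fun x hx ↦ hder x (Ioo_subset_Icc_self hx))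
  have hbound : |f' φ x| ≤ C * x ^ N := by
    simpa [abs_of_pos hx.1] using hδC φ hφ x ⟨hx.1, hx.2.trans hρδ⟩
  have hC0 : 0 ≤ C := nonneg_of_mul_nonneg_left ((abs_nonneg _).trans hbound) (pow_pos hx.1 N)
  rw [hf0 φ hφ, sub_zero, sub_zero, eq_div_iff hρ0.ne'] at hslope
  simp only [uncurry_apply_pair, ← hslope, norm_mul, norm_pow, Real.norm_eq_abs, abs_of_pos hρ0]
  calc |f' φ x| * ρ ≤ C * ρ ^ N * ρ := by
        have := hx.1.le
        have := hx.2.le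
        gcongr
        exact hbound.trans (by gcongr)
    _ = C * ρ ^ (N + 1) := by ring

lemma contDiffOn_dRho_iterate (hf : ContDiffOn ℝ ∞ (uncurry f) (univ ×ˢ Ioo (-e) e)) (N : ℕ) :
    ContDiffOn ℝ ∞ (uncurry (dRho^[N] f)) (univ ×ˢ Ioo (-e) e) := by
  induction N with
  | zero => exact hf
  | succ N ih =>
    rw [iterate_succ_apply']
    exact contDiffOn_dRho le_rfl ih isOpen_Ioo

lemma dRho_iterate (f : ℝ → ℝ → ℝ) (N : ℕ) (φ : ℝ) : dRho^[N] f φ = iteratedDeriv N (f φ) := by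
  induction N with
  | zero => simp
  | succ N ih =>
    ext ρ
    rw [iterate_succ_apply', iteratedDeriv_succ, dRho, ih]

lemma continuousOn_dRho_iterate_zero (he : 0 < e)
    (hf : ContDiffOn ℝ ∞ (uncurry f) (univ ×ˢ Ioo (-e) e)) (N : ℕ) :
    ContinuousOn (fun φ ↦ dRho^[N] f φ 0 / N.factorial) K :=
  ContinuousOn.div_const ((contDiffOn_dRho_iterate hf N).continuousOn.comp
    (f := fun φ : ℝ ↦ (φ, 0)) (by fun_prop) fun _ _ ↦ ⟨mem_univ _, neg_lt_zero.2 he, he⟩) _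

lemma isBigO_sub_taylor_nearAxis (hK : IsCompact K) (he : 0 < e) {N : ℕ}
    (hf : ContDiffOn ℝ ∞ (uncurry f) (univ ×ˢ Ioo (-e) e))
    (h0 : ∀ φ ∈ K, ∀ k < N, dRho^[k] f φ 0 = 0) :
    (fun z ↦ f z.1 z.2 - dRho^[N] f z.1 0 / N.factorial * z.2 ^ N)
      =O[nearAxis K] fun z ↦ z.2 ^ (N + 1) := by
  have hder {f : ℝ → ℝ → ℝ} (hf : ContDiffOn ℝ ∞ (uncurry f) (univ ×ˢ Ioo (-e) e)) (φ : ℝ) {ρ : ℝ}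
      (hρ : ρ ∈ Ioo (-e) e) : HasDerivAt (f φ) (dRho f φ ρ) ρ :=
    hasDerivAt_dRho (hf.of_le (by simp)) isOpen_Ioo hρ
  induction N generalizing f with
  | zero =>
    have h := isBigO_pow_succ_of_hasDerivAt (K := K) (N := 0) (f := fun φ ρ ↦ f φ ρ - f φ 0) he
      (fun φ _ ρ hρ ↦ (hder hf φ hρ).sub_const (f φ 0)) (fun φ _ ↦ sub_self _) <| by
        simpa using isBigO_one_nearAxis hK he (continuousOn_dRho (hf.of_le (by simp)) isOpen_Ioo)
    simpa [uncurry_def] using h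
  | succ N ih =>
    have hf' := ih (contDiffOn_dRho le_rfl hf isOpen_Ioo) fun φ hφ k hk ↦ by
      rw [← iterate_succ_apply]
      exact h0 φ hφ (k + 1) (by omega)
    refine isBigO_pow_succ_of_hasDerivAt
      (f := fun φ ρ ↦ f φ ρ - dRho^[N + 1] f φ 0 / (N + 1).factorial * ρ ^ (N + 1)) he
      (fun φ _ ρ hρ ↦ (hder hf φ hρ).sub ((hasDerivAt_pow (N + 1) ρ).const_mul _))
      (fun φ hφ ↦ by simpa using h0 φ hφ 0 N.succ_pos) (hf'.congr_left fun z ↦ ?_)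
    have : (N.factorial : ℝ) ≠ 0 := by positivity
    simp only [uncurry, iterate_succ_apply, Nat.factorial_succ, Nat.add_one_sub_one]
    push_cast
    field_simp

lemma isBigO_pow_nearAxis (hK : IsCompact K) (he : 0 < e) {N : ℕ}
    (hf : ContDiffOn ℝ ∞ (uncurry f) (univ ×ˢ Ioo (-e) e))
    (h0 : ∀ φ ∈ K, ∀ k < N, dRho^[k] f φ 0 = 0) :
    uncurry f =O[nearAxis K] fun z ↦ z.2 ^ N := by
  have hrem : (fun z ↦ f z.1 z.2 - dRho^[N] f z.1 0 / N.factorial * z.2 ^ N)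
      =O[nearAxis K] fun z ↦ z.2 ^ N :=
    (isBigO_sub_taylor_nearAxis hK he hf h0).trans <| by
      simpa [pow_succ] using (isBigO_refl (fun z : ℝ × ℝ ↦ z.2 ^ N) _).mul (isBigO_snd_one K)
  have hmain : (fun z ↦ dRho^[N] f z.1 0 / N.factorial * z.2 ^ N)
      =O[nearAxis K] fun z ↦ z.2 ^ N := by
    simpa using (isBigO_fst_of_continuousOn hK (continuousOn_dRho_iterate_zero he hf N)).mul
      (isBigO_refl (fun z ↦ z.2 ^ N) _)
  simpa [uncurry_def] using hrem.add hmain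

/-- `u φ ρ` tends to `u₀ φ` at the rate `O(ρ)` as `ρ → 0⁺`, uniformly for `φ ∈ K`, and `ρ ∂u/∂ρ`
stays bounded. This is all that is needed of an analytic extension of `u` to `ρ = 0`. -/
structure HasRegularLimit (K : Set ℝ) (u : ℝ → ℝ → ℝ) (u₀ : ℝ → ℝ) : Prop where
  continuousOn : ContinuousOn u₀ K
  differentiableAt : ∀ᶠ z in nearAxis K, DifferentiableAt ℝ (u z.1) z.2
  sub_isBigO : (fun z ↦ u z.1 z.2 - u₀ z.1) =O[nearAxis K] Prod.snd
  mul_dRho_isBigO : (fun z ↦ z.2 * dRho u z.1 z.2) =O[nearAxis K] fun _ ↦ (1 : ℝ)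

lemma hasRegularLimit_of_continuousOn (hu₀ : ContinuousOn u₀ K) :
    HasRegularLimit K (fun φ _ ↦ u₀ φ) u₀ where
  continuousOn := hu₀
  differentiableAt := .of_forall fun _ ↦ differentiableAt_const _
  sub_isBigO := (isBigO_zero _ _).congr_left fun z ↦ (sub_self (u₀ z.1)).symm
  mul_dRho_isBigO := (isBigO_zero _ _).congr_left fun z ↦ by simp [dRho]

namespace HasRegularLimit

lemma congr (hu : HasRegularLimit K u u₀) (huv : ∀ φ ∈ K, ∀ ρ > 0, v φ ρ = u φ ρ) :
    HasRegularLimit K v u₀ := by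
  have hev : ∀ᶠ z in nearAxis K, v z.1 =ᶠ[𝓝 z.2] u z.1 :=
    (eventually_nearAxis_pos K).mono fun z hz ↦ (lt_mem_nhds hz.2).mono (huv z.1 hz.1)
  refine ⟨hu.continuousOn, ?_, hu.sub_isBigO.congr' ?_ .rfl, hu.mul_dRho_isBigO.congr' ?_ .rfl⟩
  · filter_upwards [hev, hu.differentiableAt] with z hz hd using hd.congr_of_eventuallyEq hz
  · filter_upwards [hev] with z hz using by rw [hz.eq_of_nhds]
  · filter_upwards [hev] with z hz using by rw [dRho, dRho, hz.deriv_eq]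

lemma isBigO_one (hu : HasRegularLimit K u u₀) (hK : IsCompact K) :
    uncurry u =O[nearAxis K] fun _ ↦ (1 : ℝ) := by
  simpa [uncurry_def] using (hu.sub_isBigO.trans (isBigO_snd_one K)).add
    (isBigO_fst_of_continuousOn hK hu.continuousOn)

lemma add (hu : HasRegularLimit K u u₀) (hv : HasRegularLimit K v v₀) :
    HasRegularLimit K (fun φ ρ ↦ u φ ρ + v φ ρ) fun φ ↦ u₀ φ + v₀ φ where
  continuousOn := hu.continuousOn.add hv.continuousOn
  differentiableAt := by
    filter_upwards [hu.differentiableAt, hv.differentiableAt] with z h₁ h₂ using h₁.add h₂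
  sub_isBigO := (hu.sub_isBigO.add hv.sub_isBigO).congr_left fun z ↦ by ring
  mul_dRho_isBigO := (hu.mul_dRho_isBigO.add hv.mul_dRho_isBigO).congr' (by
    filter_upwards [hu.differentiableAt, hv.differentiableAt] with z h₁ h₂
    rw [dRho, dRho, dRho, deriv_fun_add h₁ h₂, mul_add]) .rfl

lemma mul (hu : HasRegularLimit K u u₀) (hv : HasRegularLimit K v v₀) (hK : IsCompact K) :
    HasRegularLimit K (fun φ ρ ↦ u φ ρ * v φ ρ) fun φ ↦ u₀ φ * v₀ φ where
  continuousOn := hu.continuousOn.mul hv.continuousOn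
  differentiableAt := by
    filter_upwards [hu.differentiableAt, hv.differentiableAt] with z h₁ h₂ using h₁.mul h₂
  sub_isBigO := by
    have h₁ := hu.sub_isBigO.mul (hv.isBigO_one hK)
    have h₂ := (isBigO_fst_of_continuousOn hK hu.continuousOn).mul hv.sub_isBigO
    simp only [mul_one, one_mul] at h₁ h₂
    exact (h₁.add h₂).congr_left fun z ↦ by simp only [uncurry]; ring
  mul_dRho_isBigO := by
    have h₁ := hu.mul_dRho_isBigO.mul (hv.isBigO_one hK)
    have h₂ := (hu.isBigO_one hK).mul hv.mul_dRho_isBigO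
    simp only [mul_one] at h₁ h₂
    refine (h₁.add h₂).congr' ?_ .rfl
    filter_upwards [hu.differentiableAt, hv.differentiableAt] with z hz₁ hz₂
    simp only [dRho, uncurry, deriv_fun_mul hz₁ hz₂]
    ring

lemma exists_le_abs (hu : HasRegularLimit K u u₀) (hK : IsCompact K) (hne : ∀ φ ∈ K, u₀ φ ≠ 0) :
    ∃ τ > 0, ∀ᶠ z in nearAxis K, τ ≤ |u z.1 z.2| := by
  obtain ⟨τ, hτ, hle⟩ : ∃ τ > 0, ∀ φ ∈ K, τ ≤ |u₀ φ| :=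
    hK.exists_forall_le' hu.continuousOn.abs fun φ hφ ↦ abs_pos.2 (hne φ hφ)
  refine ⟨τ / 2, half_pos hτ, ?_⟩
  have hlim := hu.sub_isBigO.trans_tendsto (tendsto_snd_nearAxis K)
  filter_upwards [eventually_nearAxis_pos K, hlim.norm.eventually_lt_const
    (u := τ / 2) (by simpa using half_pos hτ)] with z hz hlt
  have htri := abs_sub_abs_le_abs_sub (u₀ z.1) (u z.1 z.2)
  rw [abs_sub_comm] at htri
  linarith [hle z.1 hz.1, Real.norm_eq_abs (u z.1 z.2 - u₀ z.1)]

lemma inv (hu : HasRegularLimit K u u₀) (hK : IsCompact K) (hne : ∀ φ ∈ K, u₀ φ ≠ 0) :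
    HasRegularLimit K (fun φ ρ ↦ (u φ ρ)⁻¹) fun φ ↦ (u₀ φ)⁻¹ := by
  obtain ⟨τ, hτ, hle⟩ := hu.exists_le_abs hK hne
  have hu0 : ∀ᶠ z in nearAxis K, u z.1 z.2 ≠ 0 := hle.mono fun z hz ↦ abs_pos.1 (hτ.trans_le hz)
  have hinv : (fun z ↦ (u z.1 z.2)⁻¹) =O[nearAxis K] fun _ ↦ (1 : ℝ) :=
    .of_bound τ⁻¹ (hle.mono fun z hz ↦ by simpa using inv_anti₀ hτ hz)
  have hinv₀ := isBigO_fst_of_continuousOn hK (hu.continuousOn.inv₀ hne)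
  refine ⟨hu.continuousOn.inv₀ hne, ?_, ?_, ?_⟩
  · filter_upwards [hu.differentiableAt, hu0] with z hd h0 using hd.inv h0
  · have h := ((hu.sub_isBigO.mul hinv).mul hinv₀).neg_left
    simp only [mul_one] at h
    refine h.congr' ?_ .rfl
    filter_upwards [hu0, eventually_nearAxis_pos K] with z h0 hz
    have := hne z.1 hz.1
    simp only [Pi.inv_apply]
    field_simp
    ring
  · have h := ((hu.mul_dRho_isBigO.mul hinv).mul hinv).neg_left
    simp only [mul_one] at h
    refine h.congr' ?_ .rfl
    filter_upwards [hu.differentiableAt, hu0] with z hd h0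
    simp only [dRho, deriv_fun_inv'' hd h0]
    field_simp

end HasRegularLimit

lemma eventually_nearAxis_hasDerivAt_dRho (he : 0 < e)
    (hf : ContDiffOn ℝ ∞ (uncurry f) (univ ×ˢ Ioo (-e) e)) :
    ∀ᶠ z in nearAxis K, 0 < z.2 ∧ HasDerivAt (f z.1) (dRho f z.1 z.2) z.2 :=
  eventually_nearAxis_iff.2 ⟨e, he, fun φ _ ρ hρ ↦ ⟨hρ.1, hasDerivAt_dRho (hf.of_le (by simp))
    isOpen_Ioo ⟨by linarith [hρ.1], hρ.2⟩⟩⟩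

lemma mul_dRho_div_pow_isBigO (hK : IsCompact K) (he : 0 < e) {n : ℕ}
    (hf : ContDiffOn ℝ ∞ (uncurry f) (univ ×ˢ Ioo (-e) e))
    (h0 : ∀ φ ∈ K, ∀ k < n + 1, dRho^[k] f φ 0 = 0) :
    (fun z ↦ z.2 * dRho (fun φ ρ ↦ f φ ρ / ρ ^ (n + 1)) z.1 z.2) =O[nearAxis K]
      fun _ ↦ (1 : ℝ) := by
  have hdf := isBigO_pow_nearAxis (N := n) hK he (contDiffOn_dRho le_rfl hf isOpen_Ioo)
    fun φ hφ k hk ↦ by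
      rw [← iterate_succ_apply]
      exact h0 φ hφ (k + 1) (by omega)
  have hcancel : ∀ k : ℕ, (fun z : ℝ × ℝ ↦ z.2 ^ k * (z.2 ^ k)⁻¹) =ᶠ[nearAxis K] fun _ ↦ 1 :=
    fun k ↦ (eventually_nearAxis_pos K).mono fun z hz ↦ mul_inv_cancel₀ (pow_pos hz.2 k).ne'
  have hinv : ∀ k : ℕ, (fun z : ℝ × ℝ ↦ (z.2 ^ k)⁻¹) =O[nearAxis K] fun z ↦ (z.2 ^ k)⁻¹ :=
    fun k ↦ isBigO_refl _ _
  refine (((hdf.mul (hinv n)).trans_eventuallyEq (hcancel n)).sub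
    (((isBigO_pow_nearAxis hK he hf h0).mul ((hinv (n + 1)).const_mul_left
      (n + 1 : ℝ))).trans_eventuallyEq (hcancel (n + 1)))).congr' ?_ .rfl
  filter_upwards [eventually_nearAxis_hasDerivAt_dRho he hf] with z hz
  have := hz.1.ne'
  have hd := hz.2.fun_div (hasDerivAt_pow (n + 1) z.2) (pow_pos hz.1 _).ne'
  rw [dRho, hd.deriv]
  simp only [uncurry, Nat.add_one_sub_one]
  push_cast
  field_simp
  ring

lemma hasRegularLimit_div_pow (hK : IsCompact K) (he : 0 < e) {n : ℕ} (hn : 0 < n)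
    (hf : ContDiffOn ℝ ∞ (uncurry f) (univ ×ˢ Ioo (-e) e))
    (h0 : ∀ φ ∈ K, ∀ k < n, dRho^[k] f φ 0 = 0) :
    HasRegularLimit K (fun φ ρ ↦ f φ ρ / ρ ^ n) fun φ ↦ dRho^[n] f φ 0 / n.factorial := by
  obtain ⟨n, rfl⟩ := Nat.exists_eq_add_one.2 hn
  have hder := eventually_nearAxis_hasDerivAt_dRho (K := K) he hf
  refine ⟨continuousOn_dRho_iterate_zero he hf _, ?_, ?_, mul_dRho_div_pow_isBigO hK he hf h0⟩
  · filter_upwards [hder] with z hz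
    exact hz.2.differentiableAt.div (by fun_prop) (pow_pos hz.1 _).ne'
  · refine ((isBigO_sub_taylor_nearAxis hK he hf h0).mul
      (isBigO_refl (fun z ↦ (z.2 ^ (n + 1))⁻¹) _)).congr'
      (hder.mono fun z hz ↦ ?_) (hder.mono fun z hz ↦ ?_)
    · have := hz.1.ne'
      field_simp
    · beta_reduce
      rw [pow_succ', mul_inv_cancel_right₀ (pow_pos hz.1 _).ne']

end RegularLimit

section ArcBounds

open Asymptotics
open scoped ContDiff

variable {p q r : ℕ} {P Q : ℝ → ℝ → ℝ} {K : Set ℝ} {e a b : ℝ}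

lemma quasiPart_cos_sin (p q : ℕ) (f : ℝ → ℝ → ℝ) (k : ℕ) (φ : ℝ) :
    quasiPart p q f k (Real.cos φ) (Real.sin φ) = dRho^[k] (polar p q f) φ 0 / k.factorial := by
  rw [dRho_iterate]
  rfl

lemma hasRegularLimit_polar_div_pow {n : ℕ} (hp : 0 < p) (hq : 0 < q) (hn : 0 < n) (he : 0 < e)
    (he1 : e ≤ 1) {f : ℝ → ℝ → ℝ}
    (hf : ∀ z : ℝ × ℝ, ‖z‖ < e → AnalyticAt ℝ (fun z : ℝ × ℝ ↦ f z.1 z.2) z)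
    (h0 : ∀ k < n, ∀ x y, quasiPart p q f k x y = 0) (hK : IsCompact K) :
    HasRegularLimit K (fun φ ρ ↦ polar p q f φ ρ / ρ ^ n)
      fun φ ↦ quasiPart p q f n (Real.cos φ) (Real.sin φ) := by
  have hsm : ContDiffOn ℝ ∞ (uncurry (polar p q f)) (univ ×ˢ Ioo (-e) e) := fun z hz ↦
    (contDiffAt_polar hp hq he1 hf (abs_lt.2 hz.2)).contDiffWithinAt
  simp only [quasiPart_cos_sin]
  refine hasRegularLimit_div_pow hK he hn hsm fun φ _ k hk ↦ ?_
  have hk0 := h0 k hk (Real.cos φ) (Real.sin φ)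
  rw [quasiPart_cos_sin] at hk0
  exact (div_eq_zero_iff.1 hk0).resolve_right (by positivity)

namespace IsRegularStrip

lemma hasRegularLimit_left (h : IsRegularStrip p q r P Q e) (hr : IsLeadingDegree p q r P Q)
    (hK : IsCompact K) : HasRegularLimit K (fun φ ρ ↦ polar p q P φ ρ / ρ ^ (p + r))
      fun φ ↦ quasiPart p q P (p + r) (Real.cos φ) (Real.sin φ) :=
  hasRegularLimit_polar_div_pow h.p_pos h.q_pos (Nat.add_pos_left h.p_pos r) h.pos h.le_one
    h.analyticAt_left hr.1 hK

lemma hasRegularLimit_right (h : IsRegularStrip p q r P Q e) (hr : IsLeadingDegree p q r P Q)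
    (hK : IsCompact K) : HasRegularLimit K (fun φ ρ ↦ polar p q Q φ ρ / ρ ^ (q + r))
      fun φ ↦ quasiPart p q Q (q + r) (Real.cos φ) (Real.sin φ) :=
  hasRegularLimit_polar_div_pow h.p_pos h.q_pos (Nat.add_pos_left h.q_pos r) h.pos h.le_one
    h.analyticAt_right hr.2.1 hK

lemma hasRegularLimit_combination (h : IsRegularStrip p q r P Q e)
    (hr : IsLeadingDegree p q r P Q) (hK : IsCompact K) {α β : ℝ → ℝ} (hα : Continuous α)
    (hβ : Continuous β) :
    HasRegularLimit K
      (fun φ ρ ↦ (α φ * (polar p q P φ ρ / ρ ^ (p + r)) + β φ * (polar p q Q φ ρ / ρ ^ (q + r)))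
        * (p * Real.cos φ ^ 2 + q * Real.sin φ ^ 2 : ℝ)⁻¹)
      fun φ ↦ (α φ * quasiPart p q P (p + r) (Real.cos φ) (Real.sin φ)
        + β φ * quasiPart p q Q (q + r) (Real.cos φ) (Real.sin φ))
        * (p * Real.cos φ ^ 2 + q * Real.sin φ ^ 2 : ℝ)⁻¹ := by
  have hw : Continuous fun φ : ℝ ↦ (p * Real.cos φ ^ 2 + q * Real.sin φ ^ 2 : ℝ)⁻¹ :=
    Continuous.inv₀ (by fun_prop) fun φ ↦
      (cos_sin_sq_combination_pos (Nat.cast_pos.2 h.p_pos) (Nat.cast_pos.2 h.q_pos) φ).ne'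
  exact ((((hasRegularLimit_of_continuousOn hα.continuousOn).mul
    (h.hasRegularLimit_left hr hK) hK).add ((hasRegularLimit_of_continuousOn hβ.continuousOn).mul
    (h.hasRegularLimit_right hr hK) hK)).mul
    (hasRegularLimit_of_continuousOn hw.continuousOn) hK)

lemma hasRegularLimit_Theta (h : IsRegularStrip p q r P Q e) (hr : IsLeadingDegree p q r P Q)
    (hK : IsCompact K) : HasRegularLimit K (Theta p q r P Q) fun φ ↦ Theta p q r P Q φ 0 := by
  have h0 : (fun φ ↦ Theta p q r P Q φ 0) = fun φ ↦
      (-(q * Real.sin φ) * quasiPart p q P (p + r) (Real.cos φ) (Real.sin φ)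
        + p * Real.cos φ * quasiPart p q Q (q + r) (Real.cos φ) (Real.sin φ))
        * (p * Real.cos φ ^ 2 + q * Real.sin φ ^ 2 : ℝ)⁻¹ := by
    ext φ
    rw [Theta, if_pos rfl]
    ring
  rw [h0]
  refine (h.hasRegularLimit_combination hr hK (α := fun φ ↦ -(q * Real.sin φ))
    (β := fun φ ↦ p * Real.cos φ) (by fun_prop) (by fun_prop)).congr fun φ _ ρ hρ ↦ ?_
  obtain ⟨p', rfl⟩ := Nat.exists_eq_add_one.2 h.p_pos
  obtain ⟨q', rfl⟩ := Nat.exists_eq_add_one.2 h.q_pos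
  have hw := cos_sin_sq_combination_pos (Nat.cast_pos.2 h.p_pos) (Nat.cast_pos.2 h.q_pos) φ
  rw [Theta, if_neg hρ.ne', jac, show p' + 1 + (q' + 1) - 1 = p' + q' + 1 by omega]
  simp only [Nat.add_one_sub_one]
  have hw' := hw.ne'
  field_simp
  ring

lemma hasRegularLimit_Rad_div (h : IsRegularStrip p q r P Q e) (hr : IsLeadingDegree p q r P Q)
    (hK : IsCompact K) : ∃ R₀, HasRegularLimit K (fun φ ρ ↦ Rad p q r P Q φ ρ / ρ) R₀ := by
  refine ⟨_, (h.hasRegularLimit_combination hr hK Real.continuous_cos Real.continuous_sin).congr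
    fun φ _ ρ hρ ↦ ?_⟩
  obtain ⟨p', rfl⟩ := Nat.exists_eq_add_one.2 h.p_pos
  have := (cos_sin_sq_combination_pos (Nat.cast_pos.2 h.p_pos) (Nat.cast_pos.2 h.q_pos) φ).ne'
  rw [Rad, jac, show p' + 1 + q - 1 = p' + q by omega]
  field_simp
  ring

lemma exists_F_bounds (h : IsRegularStrip p q r P Q e) (hr : IsLeadingDegree p q r P Q)
    (hK : IsCompact K) (hΩ : ∀ φ ∈ K, φ ∉ Omega p q r P Q) :
    ∃ e' > 0, ∃ L, 0 ≤ L ∧ ∀ φ ∈ K, ∀ ρ ∈ Ioo 0 e',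
      |F p q r P Q φ ρ| ≤ L * ρ ∧ |dRho (F p q r P Q) φ ρ| ≤ L := by
  obtain ⟨R₀, hR⟩ := h.hasRegularLimit_Rad_div hr hK
  have hG := hR.mul ((h.hasRegularLimit_Theta hr hK).inv hK hΩ) hK
  set G := fun φ ρ ↦ Rad p q r P Q φ ρ / ρ * (Theta p q r P Q φ ρ)⁻¹
  have hFG : ∀ φ, ∀ ρ > 0, F p q r P Q φ ρ = ρ * G φ ρ := fun φ ρ hρ ↦ by
    simp only [F, G]
    field_simp
  have hF : uncurry (F p q r P Q) =O[nearAxis K] Prod.snd := by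
    refine ((isBigO_refl Prod.snd (nearAxis K)).mul (hG.isBigO_one hK)).congr'
      ((eventually_nearAxis_pos K).mono fun z hz ↦ (hFG z.1 z.2 hz.2).symm) ?_
    simp
  have hdF : uncurry (dRho (F p q r P Q)) =O[nearAxis K] fun _ ↦ (1 : ℝ) := by
    refine ((hG.isBigO_one hK).add hG.mul_dRho_isBigO).congr' ?_ .rfl
    filter_upwards [eventually_nearAxis_pos K, hG.differentiableAt] with z hz hd
    have hprod := ((hasDerivAt_id z.2).mul hd.hasDerivAt).congr_of_eventuallyEq
      ((lt_mem_nhds hz.2).mono (hFG z.1))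
    simp [uncurry, dRho, hprod.deriv]
  obtain ⟨L₁, hL₁, hFL⟩ := hF.exists_nonneg
  obtain ⟨L₂, -, hdFL⟩ := hdF.exists_nonneg
  obtain ⟨e', he', hboth⟩ := eventually_nearAxis_iff.1 (hFL.bound.and hdFL.bound)
  refine ⟨e', he', max L₁ L₂, le_max_of_le_left hL₁, fun φ hφ ρ hρ ↦ ?_⟩
  obtain ⟨hFρ, hdFρ⟩ := hboth φ hφ ρ hρ
  simp only [uncurry, Real.norm_eq_abs, abs_of_pos hρ.1, abs_one, mul_one] at hFρ hdFρ
  exact ⟨hFρ.trans (mul_le_mul_of_nonneg_right (le_max_left _ _) hρ.1.le),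
    hdFρ.trans (le_max_right _ _)⟩

end IsRegularStrip

lemma zpow_le_pow_natAbs_mul_zpow {x y E : ℝ} (hx : 0 < x) (hy : 0 < y) (hyx : y ≤ E * x)
    (hxy : x ≤ E * y) (m : ℤ) : y ^ m ≤ E ^ m.natAbs * x ^ m := by
  obtain ⟨n, rfl | rfl⟩ := m.eq_nat_or_neg
  · simpa only [zpow_natCast, Int.natAbs_natCast, mul_pow] using pow_le_pow_left₀ hy.le hyx n
  · simp only [zpow_neg, zpow_natCast, Int.natAbs_neg, Int.natAbs_natCast]
    rw [← div_eq_mul_inv, inv_eq_one_div, div_le_div_iff₀ (pow_pos hy n) (pow_pos hx n), one_mul,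
      ← mul_pow]
    exact pow_le_pow_left₀ hx.le hxy n

/-- The reason is that `F = O(ρ)` and `∂F/∂ρ = O(1)` on an arc of non-characteristic
directions. -/
lemma IsRegularStrip.exists_abs_div_zpow_le (h : IsRegularStrip p q r P Q e)
    (hr : IsLeadingDegree p q r P Q) {V : ℝ → ℝ → ℝ}
    (hV : IsInvIntFactorOn (F p q r P Q) (Ioo 0 e) V) (hΩ : ∀ φ ∈ Icc a b, φ ∉ Omega p q r P Q)
    (m : ℤ) : ∃ κ > 0, ∃ e' > 0, ∀ Φ, IsSolOn (F p q r P Q) (Ioo 0 e') a b Φ →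
      ∀ x ∈ Icc a b, ∀ y ∈ Icc a b, |V y (Φ y)| / Φ y ^ m ≤ κ * (|V x (Φ x)| / Φ x ^ m) := by
  obtain ⟨e₁, he₁, L, hL0, hL⟩ := h.exists_F_bounds hr isCompact_Icc hΩ
  set E := Real.exp (L * (b - a))
  have hE : 0 < E := Real.exp_pos _
  refine ⟨E * E ^ m.natAbs, mul_pos hE (pow_pos hE _), min e₁ e, lt_min he₁ h.pos,
    fun Φ hΦ x hx y hy ↦ ?_⟩
  have hpos : ∀ {z}, z ∈ Icc a b → 0 < Φ z := fun hz ↦ (hΦ.mem hz).1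
  have hΦ₁ : ∀ z ∈ Icc a b, Φ z ∈ Ioo 0 e₁ := fun z hz ↦
    Ioo_subset_Ioo_right (min_le_left _ _) (hΦ.mem hz)
  have hΦE : ∀ {x y}, x ∈ Icc a b → y ∈ Icc a b → Φ y ≤ E * Φ x := fun {x y} hx hy ↦ by
    have hle := norm_le_mul_exp_of_mem hL0 hΦ.ode (fun z hz ↦ by
      simpa [abs_of_pos (hpos hz)] using (hL z hz _ (hΦ₁ z hz)).1) hx hy
    rwa [Real.norm_of_nonneg (hpos hx).le, Real.norm_of_nonneg (hpos hy).le, mul_comm] at hle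
  have hVE : |V y (Φ y)| ≤ |V x (Φ x)| * E :=
    norm_le_mul_exp_of_mem (u := fun z ↦ V z (Φ z)) hL0
      (fun z hz ↦ hV.hasDerivWithinAt isOpen_Ioo
        (hΦ.mono_set (Ioo_subset_Ioo_right (min_le_right _ _))) hz)
      (fun z hz ↦ by
        rw [norm_mul]
        exact mul_le_mul_of_nonneg_right (hL z hz _ (hΦ₁ z hz)).2 (norm_nonneg _)) hx hy
  have hpow := zpow_le_pow_natAbs_mul_zpow (hpos hy) (hpos hx) (hΦE hy hx) (hΦE hx hy) m
  have hxm := zpow_pos (hpos hx) m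
  have hym := zpow_pos (hpos hy) m
  rw [mul_div_assoc', div_le_div_iff₀ hym hxm]
  calc |V y (Φ y)| * Φ x ^ m ≤ |V x (Φ x)| * E * (E ^ m.natAbs * Φ y ^ m) := by gcongr
    _ = E * E ^ m.natAbs * |V x (Φ x)| * Φ y ^ m := by ring

lemma IsRegularStrip.leading_coeff_eq_zero (h : IsRegularStrip p q r P Q e)
    (hr : IsLeadingDegree p q r P Q) {Pi : ℝ → ℝ} (hPi : IsPoincareMap p q r P Q Pi)
    {V : ℝ → ℝ → ℝ} (hV : IsInvIntFactorOn (F p q r P Q) (Ioo 0 e) V) (ha : 0 ≤ a)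
    (hb : b ≤ 2 * Real.pi) (hΩ : ∀ φ ∈ Icc a b, φ ∉ Omega p q r P Q) {x y A : ℝ}
    (hx : x ∈ Icc a b) (hy : y ∈ Icc a b) {m : ℤ}
    (hVx : Tendsto (fun ρ ↦ V x ρ / ρ ^ m) (𝓝[>] 0) (𝓝 0))
    (hVy : Tendsto (fun ρ ↦ V y ρ / ρ ^ m) (𝓝[>] 0) (𝓝 A)) : A = 0 := by
  obtain ⟨κ, hκ, e₁, he₁, hcmp⟩ := h.exists_abs_div_zpow_le hr hV hΩ m
  by_contra hA
  have hA' : 0 < |A| / 2 := half_pos (abs_pos.2 hA)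
  have hy_gt : ∀ᶠ ρ in 𝓝[>] (0 : ℝ), |A| / 2 < |V y ρ / ρ ^ m| :=
    hVy.abs.eventually_const_lt (half_lt_self (abs_pos.2 hA))
  have hx_lt : ∀ᶠ ρ in 𝓝[>] (0 : ℝ), |V x ρ / ρ ^ m| < |A| / 2 / κ :=
    hVx.abs.eventually_lt_const (by simpa only [abs_zero] using div_pos hA' hκ)
  obtain ⟨e₂, he₂, hgtlt⟩ := mem_nhdsGT_iff_exists_Ioo_subset.1 (hy_gt.and hx_lt)
  obtain ⟨δ, hδ, hsol⟩ := hPi.exists_isSolOn (lt_min he₁ he₂)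
  obtain ⟨Φ, hΦ, -⟩ := hsol (δ / 2) ⟨half_pos hδ, half_lt_self hδ⟩
  replace hΦ := hΦ.mono ha hb
  have hle := hcmp Φ (hΦ.mono_set (Ioo_subset_Ioo_right (min_le_left _ _))) x hx y hy
  have hΦ₂ : MapsTo Φ (Icc a b) (Ioo 0 e₂) :=
    hΦ.mem.mono_right (Ioo_subset_Ioo_right (min_le_right _ _))
  have hgt := (hgtlt (hΦ₂ hy)).1
  have hlt := (hgtlt (hΦ₂ hx)).2
  rw [abs_div, abs_of_pos (zpow_pos (hΦ.mem hy).1 m)] at hgt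
  rw [abs_div, abs_of_pos (zpow_pos (hΦ.mem hx).1 m), lt_div_iff₀' hκ] at hlt
  exact (hgt.trans_le hle).not_gt hlt

end ArcBounds

section LaurentPrimitive

open scoped ContDiff

lemma exists_analyticAt_eq_of_hasSum {c : ℕ → ℝ} {B : ℝ → ℝ} {δ : ℝ} (hδ : 0 < δ)
    (h : ∀ ρ ∈ Ioo 0 δ, HasSum (fun k ↦ c k * ρ ^ k) (B ρ)) :
    ∃ g : ℝ → ℝ, AnalyticAt ℝ g 0 ∧ g 0 = c 0 ∧ EqOn B g (Ioo 0 δ) := by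
  set S := FormalMultilinearSeries.ofScalars ℝ c
  have hval : ∀ x, S.sum x = ∑' n, c n * x ^ n := fun x ↦ by
    simp only [FormalMultilinearSeries.sum, S, FormalMultilinearSeries.ofScalars_apply_eq,
      smul_eq_mul]
  have hδ₂ : 0 < δ / 2 := half_pos hδ
  have hrad : ENNReal.ofNNReal (δ / 2).toNNReal ≤ S.radius := by
    refine S.le_radius_of_tendsto (l := 0) ?_
    have hterms := (h (δ / 2) ⟨hδ₂, half_lt_self hδ⟩).summable.tendsto_atTop_zero.norm
    rw [norm_zero] at hterms
    refine hterms.congr fun n ↦ ?_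
    rw [FormalMultilinearSeries.ofScalars_norm, norm_mul, norm_pow, Real.norm_of_nonneg hδ₂.le,
      Real.coe_toNNReal _ hδ₂.le]
  have hpos : 0 < S.radius := (ENNReal.coe_pos.2 (Real.toNNReal_pos.2 hδ₂)).trans_le hrad
  refine ⟨S.sum, (S.hasFPowerSeriesOnBall hpos).analyticAt, ?_, fun ρ hρ ↦ ?_⟩
  · rw [hval, tsum_eq_single 0 fun n hn ↦ by simp [hn]]
    simp
  · rw [hval, (h ρ hρ).tsum_eq]

lemma exists_analyticAt_zpow_mul_eq_of_hasSum {c : ℕ → ℝ} {B : ℝ → ℝ} {m : ℤ} {δ : ℝ} (hδ : 0 < δ)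
    (h : ∀ ρ ∈ Ioo 0 δ, HasSum (fun k : ℕ ↦ c k * ρ ^ (m + k : ℤ)) (B ρ)) :
    ∃ g : ℝ → ℝ, AnalyticAt ℝ g 0 ∧ g 0 = c 0 ∧ EqOn B (fun ρ ↦ ρ ^ m * g ρ) (Ioo 0 δ) := by
  obtain ⟨g, hg, hg0, hB⟩ := exists_analyticAt_eq_of_hasSum (B := fun ρ ↦ B ρ / ρ ^ m) hδ
    fun ρ hρ ↦ ((h ρ hρ).div_const (ρ ^ m)).congr_fun fun k ↦ by
      have hne := zpow_ne_zero m hρ.1.ne'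
      rw [zpow_add₀ hρ.1.ne', zpow_natCast]
      field_simp
  refine ⟨g, hg, hg0, fun ρ hρ ↦ ?_⟩
  simp only
  rw [← hB hρ, mul_div_cancel₀ _ (zpow_ne_zero _ hρ.1.ne')]

lemma exists_contDiffAt_hasDerivAt {g : ℝ → ℝ} {x₀ : ℝ} (hg : AnalyticAt ℝ g x₀) :
    ∃ G : ℝ → ℝ, ContDiffAt ℝ ∞ G x₀ ∧ ∀ᶠ x in 𝓝 x₀, HasDerivAt G (g x) x := by
  obtain ⟨ε, hε, han⟩ := Metric.eventually_nhds_iff_ball.1 hg.eventually_analyticAt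
  have hcont : ContinuousOn g (Metric.ball x₀ ε) := fun x hx ↦
    (han x hx).continuousAt.continuousWithinAt
  set G := fun x ↦ ∫ t in x₀..x, g t
  have hderiv : ∀ x ∈ Metric.ball x₀ ε, HasDerivAt G (g x) x := fun x hx ↦ by
    have hsub : uIcc x₀ x ⊆ Metric.ball x₀ ε :=
      (convex_ball x₀ ε).ordConnected.uIcc_subset (Metric.mem_ball_self hε) hx
    exact intervalIntegral.integral_hasDerivAt_right (hcont.mono hsub).intervalIntegrable
      (hcont.stronglyMeasurableAtFilter Metric.isOpen_ball x hx) (han x hx).continuousAt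
  have hG : ContDiffOn ℝ ∞ G (Metric.ball x₀ ε) :=
    (contDiffOn_infty_iff_deriv_of_isOpen Metric.isOpen_ball).2
      ⟨fun x hx ↦ (hderiv x hx).differentiableAt.differentiableWithinAt,
        ContDiffOn.congr (fun x hx ↦ (han x hx).contDiffAt.contDiffWithinAt)
          fun x hx ↦ (hderiv x hx).deriv⟩
  exact ⟨G, hG.contDiffAt (Metric.ball_mem_nhds x₀ hε),
    Metric.eventually_nhds_iff_ball.2 ⟨ε, hε, hderiv⟩⟩

/-- The general shape, with `A` smooth at `0`, of a primitive of a function that has a pole of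
order at most `n + 1` at `0`. -/
def laurentLog (n : ℕ) (A : ℝ → ℝ) (κ x : ℝ) : ℝ := A x / x ^ n + κ * Real.log x

lemma exists_hasDerivAt_laurentLog (n : ℕ) {g : ℝ → ℝ} (hg : AnalyticAt ℝ g 0) :
    ∃ (A : ℝ → ℝ) (κ : ℝ), ContDiffAt ℝ ∞ A 0 ∧ (n = 0 → κ = g 0) ∧ (n ≠ 0 → n * A 0 = -g 0) ∧
      ∀ᶠ x in 𝓝[>] (0 : ℝ), HasDerivAt (laurentLog n A κ) (g x / x ^ (n + 1)) x := by
  have hsplit : ∀ (g : ℝ → ℝ) (x : ℝ), g x = g 0 + x * dslope g 0 x := fun g x ↦ by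
    simpa using (eq_add_of_sub_eq' (sub_smul_dslope g 0 x).symm)
  have hslope : ∀ {g : ℝ → ℝ}, AnalyticAt ℝ g 0 → AnalyticAt ℝ (dslope g 0) 0 := fun ⟨_, hs⟩ ↦
    ⟨_, hs.has_fpower_series_dslope_fslope⟩
  induction n generalizing g with
  | zero =>
    obtain ⟨A, hA, hderiv⟩ := exists_contDiffAt_hasDerivAt (hslope hg)
    refine ⟨A, g 0, hA, fun _ ↦ rfl, fun h ↦ absurd rfl h, ?_⟩
    filter_upwards [hderiv.filter_mono nhdsWithin_le_nhds, self_mem_nhdsWithin] with x hx hx0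
    have hx0 : x ≠ 0 := (mem_Ioi.1 hx0).ne'
    refine ((hx.fun_add ((Real.hasDerivAt_log hx0).const_mul (g 0))).congr_deriv
      ?_).congr_of_eventuallyEq (.of_forall fun y ↦ by simp [laurentLog])
    rw [hsplit g x]
    field_simp
    ring
  | succ n ih =>
    obtain ⟨A, κ, hA, -, -, hderiv⟩ := ih (hslope hg)
    refine ⟨fun x ↦ -g 0 / (n + 1) + x * A x, κ, contDiffAt_const.add (contDiffAt_id.mul hA),
      fun h ↦ absurd h n.succ_ne_zero, fun _ ↦ by push_cast; field_simp; ring, ?_⟩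
    filter_upwards [hderiv, self_mem_nhdsWithin] with x hx hx0
    have hx0 : 0 < x := hx0
    have hpow : HasDerivAt (fun x : ℝ ↦ -g 0 / (n + 1) * (x ^ (n + 1))⁻¹)
        (g 0 / x ^ (n + 2)) x := by
      convert! ((hasDerivAt_pow (n + 1) x).fun_inv (pow_ne_zero _ hx0.ne')).const_mul
        (-g 0 / (n + 1 : ℝ)) using 1
      push_cast
      field_simp
      ring
    refine ((hpow.fun_add hx).congr_deriv ?_).congr_of_eventuallyEq ?_
    · rw [hsplit g x]
      field_simp
      ring
    · filter_upwards [lt_mem_nhds hx0] with y hy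
      simp only [laurentLog]
      field_simp
      ring

lemma exists_contDiffAt_implicit {E : ℝ × ℝ → ℝ} {x₀ w₀ e' : ℝ} {k : WithTop ℕ∞} (hk : k ≠ 0)
    (hE : ContDiffAt ℝ k E (x₀, w₀)) (hE' : HasDerivAt (fun w ↦ E (x₀, w)) e' w₀) (he' : e' ≠ 0) :
    ∃ ψ : ℝ → ℝ, ContDiffAt ℝ k ψ x₀ ∧ ψ x₀ = w₀ ∧ ∀ᶠ x in 𝓝 x₀, E (x, ψ x) = E (x₀, w₀) := by
  have hfd : fderiv ℝ E (x₀, w₀) (0, 1) = e' :=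
    (HasFDerivAt.comp_hasDerivAt w₀ (f := fun w ↦ (x₀, w)) (hE.differentiableAt hk).hasFDerivAt
      ((hasDerivAt_const w₀ x₀).prodMk (hasDerivAt_id w₀))).unique hE'
  have hinv : (fderiv ℝ E (x₀, w₀) ∘L .inr ℝ ℝ ℝ).IsInvertible := by
    refine ⟨ContinuousLinearEquiv.unitsEquivAut ℝ (Units.mk0 e' he'), ?_⟩
    ext
    simp [hfd]
  exact ⟨hE.implicitFunction hk hinv, hE.contDiffAt_implicitFunction hk hinv,
    hE.implicitFunction_apply_self hk hinv, hE.eventually_apply_implicitFunction hk hinv⟩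

/-- The equation `laurentLog n A κ (x * w) = laurentLog n A κ x + c` multiplied by `x ^ n`, so that
it makes sense at `x = 0`. -/
def quotientEqn (n : ℕ) (A : ℝ → ℝ) (κ c : ℝ) (z : ℝ × ℝ) : ℝ :=
  A (z.1 * z.2) / z.2 ^ n - A z.1 + z.1 ^ n * (κ * Real.log z.2 - c)

lemma quotientEqn_eq {n : ℕ} {A : ℝ → ℝ} {κ c x w : ℝ} (hx : 0 < x) (hw : 0 < w) :
    quotientEqn n A κ c (x, w) =
      x ^ n * (laurentLog n A κ (x * w) - (laurentLog n A κ x + c)) := by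
  simp only [quotientEqn, laurentLog, Real.log_mul hx.ne' hw.ne', mul_pow]
  field_simp
  ring

lemma contDiffAt_quotientEqn {n : ℕ} {A : ℝ → ℝ} {κ c w : ℝ} (hA : ContDiffAt ℝ ∞ A 0)
    (hw : 0 < w) : ContDiffAt ℝ ∞ (quotientEqn n A κ c) (0, w) := by
  have hmul : ContDiffAt ℝ ∞ (fun z : ℝ × ℝ ↦ A (z.1 * z.2)) (0, w) :=
    ContDiffAt.comp (g := A) (0, w) (by simpa using hA) (contDiffAt_fst.mul contDiffAt_snd)
  have hfst : ContDiffAt ℝ ∞ (fun z : ℝ × ℝ ↦ A z.1) (0, w) :=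
    ContDiffAt.comp (g := A) (0, w) hA contDiffAt_fst
  exact ((hmul.div (contDiffAt_snd.pow n) (pow_ne_zero _ hw.ne')).sub hfst).add
    ((contDiffAt_fst.pow n).mul
      ((contDiffAt_const.mul (contDiffAt_snd.log hw.ne')).sub contDiffAt_const))

lemma exists_quotientEqn_eq_zero {n : ℕ} {A : ℝ → ℝ} {κ : ℝ} (c : ℝ) (hκ : n = 0 → κ ≠ 0)
    (hA : n ≠ 0 → A 0 ≠ 0) :
    ∃ w > 0, quotientEqn n A κ c (0, w) = 0 ∧ (w = 1 ↔ n ≠ 0 ∨ c = 0) ∧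
      ∃ e' ≠ 0, HasDerivAt (fun w ↦ quotientEqn n A κ c (0, w)) e' w := by
  simp only [quotientEqn, zero_mul]
  rcases eq_or_ne n 0 with rfl | hn
  · have hκ := hκ rfl
    have hw := Real.exp_pos (c / κ)
    refine ⟨Real.exp (c / κ), hw, ?_, ?_, κ * (Real.exp (c / κ))⁻¹,
      mul_ne_zero hκ (inv_ne_zero hw.ne'), ?_⟩
    · simp [mul_div_cancel₀ c hκ]
    · simp [hκ]
    · simpa using ((Real.hasDerivAt_log hw.ne').const_mul κ).sub_const c
  · refine ⟨1, one_pos, by simp [hn], by simp [hn], -(n * A 0),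
      neg_ne_zero.2 (mul_ne_zero (Nat.cast_ne_zero.2 hn) (hA hn)), ?_⟩
    simpa [hn, div_eq_mul_inv, mul_comm] using
      (((hasDerivAt_pow n (1 : ℝ)).fun_inv (pow_ne_zero _ one_ne_zero)).const_mul (A 0)).sub_const
        (A 0)

lemma exists_contDiffAt_laurentLog_mul_eq {n : ℕ} {A : ℝ → ℝ} {κ : ℝ} (hA : ContDiffAt ℝ ∞ A 0)
    (hκ : n = 0 → κ ≠ 0) (hA0 : n ≠ 0 → A 0 ≠ 0) (c : ℝ) :
    ∃ ψ : ℝ → ℝ, ContDiffAt ℝ ∞ ψ 0 ∧ 0 < ψ 0 ∧ (ψ 0 = 1 ↔ n ≠ 0 ∨ c = 0) ∧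
      ∀ᶠ x in 𝓝[>] 0, laurentLog n A κ (x * ψ x) = laurentLog n A κ x + c := by
  obtain ⟨w, hw, hE, hw1, e', he', hE'⟩ := exists_quotientEqn_eq_zero c hκ hA0
  obtain ⟨ψ, hψ, rfl, hψE⟩ :=
    exists_contDiffAt_implicit (by simp) (contDiffAt_quotientEqn hA hw) hE' he'
  refine ⟨ψ, hψ, hw, hw1, ?_⟩
  filter_upwards [(hψE.and (hψ.continuousAt.eventually_const_lt hw)).filter_mono nhdsWithin_le_nhds,
    self_mem_nhdsWithin] with x ⟨hx, hψx⟩ hx0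
  rw [hE, quotientEqn_eq hx0 hψx] at hx
  exact sub_eq_zero.1 ((mul_eq_zero.1 hx).resolve_left (pow_ne_zero n (mem_Ioi.1 hx0).ne'))

end LaurentPrimitive

section TimeFunction

open scoped ContDiff

/-- `W` is a time function of the autonomous equation `x' = V x` on `s`: it increases at unit speed
along the solutions, so that `W (Pi x) = W x + c` says that `Pi` is the time-`c` map. -/
structure IsTimeFunctionOn (V W : ℝ → ℝ) (s : Set ℝ) : Prop where
  ne_zero : ∀ x ∈ s, V x ≠ 0
  hasDerivAt : ∀ x ∈ s, HasDerivAt W (V x)⁻¹ x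

namespace IsTimeFunctionOn

variable {V W : ℝ → ℝ} {s : Set ℝ}

lemma exists_sub_eq_mul (hW : IsTimeFunctionOn V W s) (hs : s.OrdConnected) {x y : ℝ} (hx : x ∈ s)
    (hy : y ∈ s) : ∃ ξ ∈ uIcc x y, y - x = (W y - W x) * V ξ := by
  wlog hxy : x < y generalizing x y
  · rcases (not_lt.1 hxy).eq_or_lt with rfl | hyx
    · exact ⟨y, left_mem_uIcc, by simp⟩
    · obtain ⟨ξ, hξ, h⟩ := this hy hx hyx
      exact ⟨ξ, uIcc_comm x y ▸ hξ, by linear_combination -h⟩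
  have hsub : Icc x y ⊆ s := hs.out hx hy
  obtain ⟨ξ, hξ, h⟩ := exists_hasDerivAt_eq_slope W (fun z ↦ (V z)⁻¹) hxy
    (fun z hz ↦ (hW.hasDerivAt z (hsub hz)).continuousAt.continuousWithinAt)
    fun z hz ↦ hW.hasDerivAt z (hsub (Ioo_subset_Icc_self hz))
  have hVξ := hW.ne_zero ξ (hsub (Ioo_subset_Icc_self hξ))
  refine ⟨ξ, Icc_subset_uIcc (Ioo_subset_Icc_self hξ), ?_⟩
  rw [eq_div_iff (sub_pos.2 hxy).ne'] at h
  rw [← h]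
  field_simp

lemma injOn (hW : IsTimeFunctionOn V W s) (hs : s.OrdConnected) : InjOn W s := fun x hx y hy h ↦ by
  obtain ⟨ξ, -, hξ⟩ := hW.exists_sub_eq_mul hs hx hy
  rw [h, sub_self, zero_mul, sub_eq_zero] at hξ
  exact hξ.symm

lemma exists_comp_eq_add_const (hW : IsTimeFunctionOn V W s) {t : Set ℝ} (ht : IsOpen t)
    (ht' : IsPreconnected t) (hts : t ⊆ s) {Pi : ℝ → ℝ} (hPi : MapsTo Pi t s)
    (hPi' : ∀ x ∈ t, HasDerivAt Pi (V (Pi x) / V x) x) : ∃ c, ∀ x ∈ t, W (Pi x) = W x + c := by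
  have hderiv : ∀ x ∈ t, HasDerivAt (fun x ↦ W (Pi x) - W x) 0 x := fun x hx ↦ by
    have hne := hW.ne_zero _ (hPi hx)
    refine (((hW.hasDerivAt _ (hPi hx)).comp x (hPi' x hx)).sub
      (hW.hasDerivAt x (hts hx))).congr_deriv ?_
    rw [inv_mul_eq_div, div_div_cancel_left' hne, sub_self]
  obtain ⟨c, hc⟩ := ht.exists_is_const_of_deriv_eq_zero ht'
    (fun x hx ↦ (hderiv x hx).differentiableAt.differentiableWithinAt)
    fun x hx ↦ (hderiv x hx).deriv
  exact ⟨c, fun x hx ↦ eq_add_of_sub_eq' (hc x hx)⟩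

end IsTimeFunctionOn

variable {m : ℤ} {b W Pi : ℝ → ℝ} {c d : ℝ}

lemma exists_isTimeFunctionOn (hb : ContinuousAt b 0) (hb0 : b 0 ≠ 0)
    (hW : ∀ᶠ x in 𝓝[>] 0, HasDerivAt W (x ^ m * b x)⁻¹ x) :
    ∃ d > 0, IsTimeFunctionOn (fun x ↦ x ^ m * b x) W (Ioo 0 d) := by
  obtain ⟨d, hd, h⟩ := mem_nhdsGT_iff_exists_Ioo_subset.1
    (((hb.eventually_ne hb0).filter_mono nhdsWithin_le_nhds).and hW)
  exact ⟨d, hd, fun x hx ↦ mul_ne_zero (zpow_ne_zero m hx.1.ne') (h hx).1, fun x hx ↦ (h hx).2⟩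

lemma IsTimeFunctionOn.exists_eventually_comp_eq_add_const {V : ℝ → ℝ}
    (hW : IsTimeFunctionOn V W (Ioo 0 d)) (hd : 0 < d) (hPi : Tendsto Pi (𝓝[>] 0) (𝓝[>] 0))
    (hPi' : ∀ᶠ x in 𝓝[>] 0, HasDerivAt Pi (V (Pi x) / V x) x) :
    ∃ c, ∀ᶠ x in 𝓝[>] 0, W (Pi x) = W x + c := by
  obtain ⟨δ, hδ, h⟩ := mem_nhdsGT_iff_exists_Ioo_subset.1
    ((hPi.eventually (Ioo_mem_nhdsGT hd)).and hPi')
  obtain ⟨c, hc⟩ := hW.exists_comp_eq_add_const (t := Ioo 0 (min δ d)) isOpen_Ioo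
    isPreconnected_Ioo (Ioo_subset_Ioo_right (min_le_right _ _))
    (fun x hx ↦ (h (Ioo_subset_Ioo_right (min_le_left _ _) hx)).1)
    fun x hx ↦ (h (Ioo_subset_Ioo_right (min_le_left _ _) hx)).2
  exact ⟨c, eventually_of_mem (Ioo_mem_nhdsGT (lt_min hδ hd)) hc⟩

lemma IsTimeFunctionOn.eventually_eq_of_comp_eq {V Pi' : ℝ → ℝ}
    (hW : IsTimeFunctionOn V W (Ioo 0 d)) (hd : 0 < d) (hPi : Tendsto Pi (𝓝[>] 0) (𝓝[>] 0))
    (hPi' : Tendsto Pi' (𝓝[>] 0) (𝓝[>] 0)) (h : ∀ᶠ x in 𝓝[>] 0, W (Pi x) = W (Pi' x)) :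
    ∀ᶠ x in 𝓝[>] 0, Pi x = Pi' x := by
  filter_upwards [h, hPi.eventually (Ioo_mem_nhdsGT hd), hPi'.eventually (Ioo_mem_nhdsGT hd)]
    with x hx hPix hPix'
  exact hW.injOn ordConnected_Ioo hPix hPix' hx

lemma eventually_eq_id_of_nonpos (hm : m ≤ 0) (hb : AnalyticAt ℝ b 0) (hb0 : b 0 ≠ 0)
    (hPi : Tendsto Pi (𝓝[>] 0) (𝓝[>] 0))
    (hPi' : ∀ᶠ x in 𝓝[>] 0, HasDerivAt Pi (Pi x ^ m * b (Pi x) / (x ^ m * b x)) x) :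
    ∀ᶠ x in 𝓝[>] 0, Pi x = x := by
  obtain ⟨k, hk⟩ := Int.eq_ofNat_of_zero_le (neg_nonneg.2 hm)
  obtain ⟨W, hWc, hW⟩ := exists_contDiffAt_hasDerivAt ((analyticAt_id.pow k).mul (hb.inv hb0))
  obtain ⟨d, hd, hWd⟩ := exists_isTimeFunctionOn (m := m) (W := W) hb.continuousAt hb0 <| by
    filter_upwards [hW.filter_mono nhdsWithin_le_nhds] with x hx
    rw [mul_inv, ← zpow_neg, hk]
    simpa using hx
  obtain ⟨c, hc⟩ := hWd.exists_eventually_comp_eq_add_const hd hPi hPi'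
  have hWt : Tendsto W (𝓝[>] 0) (𝓝 (W 0)) :=
    hWc.continuousAt.tendsto.mono_left nhdsWithin_le_nhds
  have hc0 : W 0 = W 0 + c := tendsto_nhds_unique ((hWt.comp hPi).congr' hc) (hWt.add_const c)
  refine hWd.eventually_eq_of_comp_eq hd hPi tendsto_id ?_
  simpa [left_eq_add.1 hc0] using hc

lemma IsTimeFunctionOn.tendsto_sub_div_zpow
    (hW : IsTimeFunctionOn (fun x ↦ x ^ m * b x) W (Ioo 0 d)) (hd : 0 < d) (hb : ContinuousAt b 0)
    (hPi : Tendsto Pi (𝓝[>] 0) (𝓝[>] 0)) (hPix : Tendsto (fun x ↦ Pi x / x) (𝓝[>] 0) (𝓝 1))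
    (hc : ∀ᶠ x in 𝓝[>] 0, W (Pi x) = W x + c) :
    Tendsto (fun x ↦ (Pi x - x) / x ^ m) (𝓝[>] 0) (𝓝 (c * b 0)) := by
  have hmean : ∀ᶠ x in 𝓝[>] (0 : ℝ), ∃ s ∈ uIcc 1 (Pi x / x),
      (Pi x - x) / x ^ m = c * (s ^ m * b (x * s)) := by
    filter_upwards [hc, Ioo_mem_nhdsGT hd, hPi.eventually (Ioo_mem_nhdsGT hd)] with x hcx hx hPi
    obtain ⟨ξ, hξ, hsub⟩ := hW.exists_sub_eq_mul ordConnected_Ioo hx hPi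
    refine ⟨ξ / x, ?_, ?_⟩
    · rw [← div_self hx.1.ne', ← image_div_const_uIcc]
      exact mem_image_of_mem _ hξ
    · rw [hsub, hcx, mul_div_cancel₀ _ hx.1.ne', div_zpow, add_sub_cancel_left]
      ring
  obtain ⟨s, hs⟩ := hmean.choice
  have hs1 : Tendsto s (𝓝[>] 0) (𝓝 1) :=
    tendsto_of_tendsto_of_tendsto_of_le_of_le'
      (by simpa using (tendsto_const_nhds (x := (1 : ℝ))).min hPix)
      (by simpa using (tendsto_const_nhds (x := (1 : ℝ))).max hPix)
      (hs.mono fun x hx ↦ hx.1.1) (hs.mono fun x hx ↦ hx.1.2)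
  have hxs : Tendsto (fun x ↦ x * s x) (𝓝[>] 0) (𝓝 0) := by
    simpa using (tendsto_nhdsWithin_of_tendsto_nhds tendsto_id).mul hs1
  have hlim := ((hs1.zpow₀ m (Or.inl one_ne_zero)).mul (hb.tendsto.comp hxs)).const_mul c
  rw [one_zpow, one_mul] at hlim
  exact hlim.congr' (hs.mono fun x hx ↦ hx.2.symm)

/-- For `m ≥ 1` the time function has the form `laurentLog`, and the implicit function theorem
solves `W (x * ψ) = W x + c` for `ψ`. -/
lemma eventually_eq_id_or_exists_contDiffAt_quotient (hb : AnalyticAt ℝ b 0) (hb0 : b 0 ≠ 0)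
    (hPi : Tendsto Pi (𝓝[>] 0) (𝓝[>] 0))
    (hPi' : ∀ᶠ x in 𝓝[>] 0, HasDerivAt Pi (Pi x ^ m * b (Pi x) / (x ^ m * b x)) x) :
    (∀ᶠ x in 𝓝[>] 0, Pi x = x) ∨
      0 < m ∧ ∃ ψ : ℝ → ℝ, ContDiffAt ℝ ∞ ψ 0 ∧ (∀ᶠ x in 𝓝[>] 0, Pi x = x * ψ x) ∧
        (m = 1 → ψ 0 ≠ 1) ∧
        (m ≠ 1 → ∃ α ≠ 0, Tendsto (fun x ↦ (Pi x - x) / x ^ m) (𝓝[>] 0) (𝓝 α)) := by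
  rcases le_or_gt m 0 with hm | hm
  · exact .inl (eventually_eq_id_of_nonpos hm hb hb0 hPi hPi')
  obtain ⟨n, rfl⟩ : ∃ n : ℕ, m = n + 1 := ⟨(m - 1).toNat, by omega⟩
  obtain ⟨A, κ, hA, hκ, hA0, hWA⟩ := exists_hasDerivAt_laurentLog n (hb.inv hb0)
  obtain ⟨d, hd, hW⟩ := exists_isTimeFunctionOn (m := n + 1) (W := laurentLog n A κ)
    hb.continuousAt hb0 <| hWA.mono fun x hx ↦ hx.congr_deriv <| by
      rw [_root_.Pi.inv_apply, mul_inv, div_eq_inv_mul]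
      norm_cast
  obtain ⟨c, hc⟩ := hW.exists_eventually_comp_eq_add_const hd hPi hPi'
  rcases eq_or_ne c 0 with rfl | hc0
  · exact .inl (hW.eventually_eq_of_comp_eq hd hPi tendsto_id (by simpa using hc))
  refine .inr ⟨hm, ?_⟩
  have hb0' : (b⁻¹) 0 ≠ 0 := inv_ne_zero hb0
  obtain ⟨ψ, hψ, hψ0, hψ1, hψc⟩ := exists_contDiffAt_laurentLog_mul_eq hA
    (fun hn ↦ hκ hn ▸ hb0') (fun hn h ↦ hb0' (by simpa [h] using (hA0 hn).symm)) c
  have hψt : Tendsto ψ (𝓝[>] 0) (𝓝 (ψ 0)) := hψ.continuousAt.tendsto.mono_left nhdsWithin_le_nhds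
  have hxψ : Tendsto (fun x ↦ x * ψ x) (𝓝[>] 0) (𝓝[>] 0) := by
    refine tendsto_nhdsWithin_iff.2
      ⟨by simpa using (tendsto_nhdsWithin_of_tendsto_nhds tendsto_id).mul hψt, ?_⟩
    filter_upwards [self_mem_nhdsWithin, hψt.eventually_const_lt hψ0] with x hx hψx
    exact mul_pos hx hψx
  have hPiψ : ∀ᶠ x in 𝓝[>] 0, Pi x = x * ψ x :=
    hW.eventually_eq_of_comp_eq hd hPi hxψ (hc.mp (hψc.mono fun x hx hx' ↦ hx'.trans hx.symm))
  refine ⟨ψ, hψ, hPiψ, fun hn ↦ ?_, fun hn ↦ ⟨c * b 0, mul_ne_zero hc0 hb0,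
    hW.tendsto_sub_div_zpow hd hb.continuousAt hPi ?_ hc⟩⟩
  · simpa [hψ1, hc0] using hn
  · rw [← hψ1.2 (.inl (by simpa using hn))]
    refine hψt.congr' ?_
    filter_upwards [hPiψ, self_mem_nhdsWithin] with x hx hx0
    rw [hx, mul_div_cancel_left₀ _ (mem_Ioi.1 hx0).ne']

end TimeFunction

section FormalExpansion

open Asymptotics
open scoped ContDiff

variable {f : ℝ → ℝ} {η : ℕ → ℝ}

lemma isBigO_sub_taylor {ψ : ℝ → ℝ} {N : ℕ} (hψ : ContDiffAt ℝ N ψ 0) :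
    (fun x ↦ ψ x - ∑ i ∈ Finset.range N, iteratedDeriv i ψ 0 / i.factorial * x ^ i)
      =O[𝓝 0] (· ^ N) := by
  obtain ⟨u, hu, hψu⟩ := hψ.contDiffOn le_rfl (by simp)
  obtain ⟨ε, hε, hball⟩ := Metric.mem_nhds_iff.1 (by simpa using hu)
  have h0 : (0 : ℝ) ∈ Metric.ball 0 ε := Metric.mem_ball_self hε
  have htaylor : ∀ x, taylorWithinEval ψ N (Metric.ball 0 ε) 0 x =
      ∑ i ∈ Finset.range N, iteratedDeriv i ψ 0 / i.factorial * x ^ i +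
        iteratedDeriv N ψ 0 / N.factorial * x ^ N := fun x ↦ by
    rw [taylor_within_apply, ← Finset.sum_range_succ]
    refine Finset.sum_congr rfl fun i _ ↦ ?_
    rw [iteratedDerivWithin_of_isOpen Metric.isOpen_ball h0, sub_zero, smul_eq_mul]
    ring
  have hrem := taylor_isLittleO (convex_ball 0 ε) h0 (hψu.mono hball)
  simp only [Metric.isOpen_ball.nhdsWithin_eq h0, sub_zero, htaylor] at hrem
  have hlast := isBigO_const_mul_self (iteratedDeriv N ψ 0 / N.factorial) (· ^ N : ℝ → ℝ) (𝓝 0)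
  refine (hrem.isBigO.add hlast).congr_left fun x ↦ ?_
  ring

lemma hasFormalExpansion_of_contDiffAt {ψ : ℝ → ℝ} (hψ : ContDiffAt ℝ ∞ ψ 0)
    (h : ∀ᶠ x in 𝓝[>] 0, f x = x * ψ x) :
    HasFormalExpansion f fun i ↦ iteratedDeriv (i - 1) ψ 0 / (i - 1).factorial := fun N ↦ by
  have hψN : ContDiffAt ℝ N ψ 0 := hψ.of_le (by exact_mod_cast le_top)
  have hmul := ((isBigO_refl (fun x : ℝ ↦ x) (𝓝 0)).mul (isBigO_sub_taylor hψN)).mono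
    (nhdsWithin_le_nhds (s := Ioi 0))
  refine hmul.congr' ?_ (.of_forall fun x ↦ (pow_succ' x N).symm)
  filter_upwards [h] with x hx
  rw [hx, mul_sub, Finset.mul_sum, ← Finset.Ico_add_one_right_eq_Icc,
    Finset.sum_Ico_eq_sum_range, Nat.add_sub_cancel]
  simp only [Nat.add_sub_cancel_left, pow_add, pow_one, mul_left_comm]

lemma eq_zero_of_const_mul_pow_isLittleO {a : ℝ} {n : ℕ}
    (h : (fun x : ℝ ↦ a * x ^ n) =o[𝓝[>] 0] (· ^ n)) : a = 0 := by
  by_contra ha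
  have hne : ∀ᶠ x : ℝ in 𝓝[>] 0, x ^ n ≠ 0 :=
    eventually_mem_nhdsWithin.mono fun x hx ↦ pow_ne_zero n (ne_of_gt hx)
  exact isLittleO_irrefl hne.frequently ((isLittleO_const_mul_left_iff ha).1 h)

lemma coeff_eq_zero_of_isLittleO {c : ℕ → ℝ} (s : Finset ℕ)
    (h : ∀ i ∈ s, (fun x : ℝ ↦ ∑ j ∈ s, c j * x ^ j) =o[𝓝[>] 0] (· ^ i)) : ∀ i ∈ s, c i = 0 := by
  induction s using Finset.induction_on_max with
  | empty => simp
  | insert a s hs ih =>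
    have ha : a ∉ s := fun has ↦ (hs a has).false
    simp only [Finset.sum_insert ha, Finset.forall_mem_insert] at h ⊢
    have hcs : ∀ i ∈ s, c i = 0 := ih fun i hi ↦ by
      have hpow : (fun x : ℝ ↦ c a * x ^ a) =o[𝓝[>] 0] (· ^ i) :=
        ((isLittleO_pow_pow (hs i hi)).mono nhdsWithin_le_nhds).const_mul_left _
      simpa using (h.2 i hi).sub hpow
    refine ⟨eq_zero_of_const_mul_pow_isLittleO (h.1.congr_left fun x ↦ ?_), hcs⟩
    rw [Finset.sum_eq_zero fun i hi ↦ by rw [hcs i hi, zero_mul], add_zero]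

lemma HasFormalExpansion.coeff_eq (hη : HasFormalExpansion f η) {η' : ℕ → ℝ} {N : ℕ}
    (hη' : (fun x ↦ f x - ∑ i ∈ Finset.Icc 1 N, η' i * x ^ i) =o[𝓝[>] 0] (· ^ N)) :
    ∀ i ∈ Finset.Icc 1 N, η i = η' i := by
  have hdiff : (fun x ↦ ∑ i ∈ Finset.Icc 1 N, (η i - η' i) * x ^ i) =o[𝓝[>] 0] (· ^ N) :=
    (hη'.sub ((hη N).trans_isLittleO
      ((isLittleO_pow_pow N.lt_succ_self).mono nhdsWithin_le_nhds))).congr_left fun x ↦ by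
        simp only [sub_mul, Finset.sum_sub_distrib]
        ring
  have hpow : ∀ i ≤ N, (fun x : ℝ ↦ x ^ N) =O[𝓝[>] 0] (· ^ i) := fun i hi ↦ by
    rcases hi.eq_or_lt with rfl | hi
    · exact isBigO_refl _ _
    · exact (isLittleO_pow_pow hi).isBigO.mono nhdsWithin_le_nhds
  exact fun i hi ↦ sub_eq_zero.1 <| coeff_eq_zero_of_isLittleO (c := fun i ↦ η i - η' i) _
    (fun j hj ↦ hdiff.trans_isBigO (hpow j (Finset.mem_Icc.1 hj).2)) i hi

lemma HasFormalExpansion.eq_of_tendsto (hη : HasFormalExpansion f η) {m : ℕ} (hm : 1 < m) {α : ℝ}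
    (h : Tendsto (fun x ↦ (f x - x) / x ^ m) (𝓝[>] 0) (𝓝 α)) :
    η m = α ∧ (fun x ↦ f x - x - α * x ^ m) =O[𝓝[>] 0] (· ^ (m + 1)) := by
  set η' : ℕ → ℝ := fun i ↦ if i = 1 then 1 else if i = m then α else 0
  have hsum (x : ℝ) : ∑ i ∈ Finset.Icc 1 m, η' i * x ^ i = x + α * x ^ m := by
    have hη' (i : ℕ) : η' i = (if i = 1 then 1 else 0) + if i = m then α else 0 := by
      grind
    simp [hη', add_mul, Finset.sum_add_distrib, ite_mul, hm.le]
  have hlittle : (fun x ↦ f x - ∑ i ∈ Finset.Icc 1 m, η' i * x ^ i) =o[𝓝[>] 0] (· ^ m) := by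
    have hdiv : (fun x ↦ (f x - x) / x ^ m - α) =o[𝓝[>] 0] (fun _ ↦ (1 : ℝ)) := by
      simpa [isLittleO_one_iff] using h.sub_const α
    refine (hdiv.mul_isBigO (isBigO_refl (· ^ m : ℝ → ℝ) _)).congr' ?_
      (.of_forall fun x ↦ one_mul _)
    filter_upwards [self_mem_nhdsWithin] with x (hx : 0 < x)
    rw [hsum]
    field_simp
    ring
  have hcoeff := hη.coeff_eq hlittle
  refine ⟨?_, (hη m).congr_left fun x ↦ ?_⟩
  · simpa [η', hm.ne'] using hcoeff m (Finset.mem_Icc.2 ⟨hm.le, le_rfl⟩)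
  · rw [Finset.sum_congr rfl fun i hi ↦ by rw [hcoeff i hi], hsum, sub_add_eq_sub_sub]

lemma exists_eq_mul_one_add {α : ℝ} (hα : α ≠ 0) {m : ℕ}
    (h : (fun x ↦ f x - α * x ^ m) =O[𝓝[>] 0] (· ^ (m + 1))) :
    ∃ k : ℝ → ℝ, k =O[𝓝[>] 0] (fun x : ℝ ↦ x) ∧
      ∀ᶠ x in 𝓝[>] (0 : ℝ), f x = α * x ^ m * (1 + k x) := by
  refine ⟨fun x ↦ (f x - α * x ^ m) / (α * x ^ m), ?_, ?_⟩
  · refine (h.mul (isBigO_const_mul_self α⁻¹ (fun x : ℝ ↦ (x ^ m)⁻¹) (𝓝[>] 0))).congr' ?_ ?_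
    · exact .of_forall fun x ↦ by simp only [div_eq_mul_inv, mul_inv]
    · filter_upwards [self_mem_nhdsWithin] with x (hx : 0 < x)
      rw [pow_succ', mul_assoc, mul_inv_cancel₀ (pow_pos hx m).ne', mul_one]
  · filter_upwards [self_mem_nhdsWithin] with x (hx : 0 < x)
    field_simp
    ring

lemma exists_hasFormalExpansion {b Pi : ℝ → ℝ} {m : ℤ} (hb : AnalyticAt ℝ b 0) (hb0 : b 0 ≠ 0)
    (hPi : Tendsto Pi (𝓝[>] 0) (𝓝[>] 0))
    (hPi' : ∀ᶠ x in 𝓝[>] 0, HasDerivAt Pi (Pi x ^ m * b (Pi x) / (x ^ m * b x)) x) :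
    ∃ η : ℕ → ℝ, HasFormalExpansion Pi η ∧
      (m ≤ 0 → ∀ᶠ x in 𝓝[>] 0, Pi x = x) ∧
      (1 < m →
        (∃ k : ℝ → ℝ, k =O[𝓝[>] 0] (fun x : ℝ ↦ x) ∧
          ∀ᶠ x in 𝓝[>] 0, Pi x = x + η m.toNat * x ^ m.toNat * (1 + k x)) ∧
        (η m.toNat = 0 → ∀ᶠ x in 𝓝[>] 0, Pi x = x)) ∧
      (m = 1 → η 1 = 1 → ∀ᶠ x in 𝓝[>] 0, Pi x = x) := by
  rcases eventually_eq_id_or_exists_contDiffAt_quotient hb hb0 hPi hPi' with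
    hid | ⟨hm, ψ, hψ, hPiψ, hψ0, hlead⟩
  · have hid' : ∀ᶠ x in 𝓝[>] 0, Pi x = x * 1 := by simpa using hid
    refine ⟨_, hasFormalExpansion_of_contDiffAt contDiffAt_const hid', fun _ ↦ hid, fun hm ↦
      ⟨⟨0, isBigO_zero _ _, ?_⟩, fun _ ↦ hid⟩, fun _ _ ↦ hid⟩
    filter_upwards [hid] with x hx
    simp [hx, iteratedDeriv_const, show m.toNat - 1 ≠ 0 by lia]
  · have hη := hasFormalExpansion_of_contDiffAt hψ hPiψ
    refine ⟨_, hη, fun hm' ↦ absurd hm hm'.not_gt, fun hm' ↦ ?_, fun hm' hη1 ↦ ?_⟩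
    · lift m to ℕ using hm.le
      obtain ⟨α, hα, hlim⟩ := hlead hm'.ne'
      obtain ⟨hηm, hO⟩ := hη.eq_of_tendsto (by exact_mod_cast hm') (by exact_mod_cast hlim)
      obtain ⟨k, hk, hPik⟩ := exists_eq_mul_one_add hα hO
      rw [Int.toNat_natCast, hηm]
      exact ⟨⟨k, hk, hPik.mono fun x hx ↦ sub_eq_iff_eq_add'.1 hx⟩, fun h ↦ absurd h hα⟩
    · exact absurd (by simpa using hη1) (hψ0 hm')

end FormalExpansion

section LaurentInverseIntegratingFactor

variable {p q r : ℕ} {P Q V : ℝ → ℝ → ℝ} {e : ℝ} {m : ℤ} {Pi : ℝ → ℝ}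

lemma exists_isRegularStrip (hp : 0 < p) (hq : 0 < q)
    (hP : AnalyticAt ℝ (fun z : ℝ × ℝ ↦ P z.1 z.2) 0)
    (hQ : AnalyticAt ℝ (fun z : ℝ × ℝ ↦ Q z.1 z.2) 0)
    (hΘ : ¬ HasZeroAngularSpeed p q r P Q) : ∃ e, IsRegularStrip p q r P Q e := by
  obtain ⟨ε, hε, han⟩ := Metric.eventually_nhds_iff_ball.1
    (hP.eventually_analyticAt.and hQ.eventually_analyticAt)
  simp only [mem_ball_zero_iff] at han
  simp only [HasZeroAngularSpeed, not_forall, not_exists, not_and, exists_prop] at hΘ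
  obtain ⟨ε', hε', hΘ⟩ := hΘ
  obtain ⟨e, he0, he⟩ : ∃ e > 0, e ≤ min 1 (min ε ε') := ⟨_, by positivity, le_rfl⟩
  obtain ⟨he1, heε, heε'⟩ : e ≤ 1 ∧ e ≤ ε ∧ e ≤ ε' := by simpa using he
  exact ⟨e, hp, hq, he0, he1, fun z hz ↦ (han z (hz.trans_le heε)).1,
    fun z hz ↦ (han z (hz.trans_le heε)).2, fun φ ρ hρ ↦ hΘ φ ρ hρ.1 (hρ.2.trans_le heε')⟩

lemma IsRegularStrip.exists_isInvIntFactorOn (h : IsRegularStrip p q r P Q e)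
    (hV : IsInvIntFactor p q r P Q V) :
    ∃ e', IsRegularStrip p q r P Q e' ∧ IsInvIntFactorOn (F p q r P Q) (Ioo 0 e') V := by
  obtain ⟨-, eV, heV, hVc, -, hpde⟩ := hV
  have he := h.mono (lt_min h.pos heV) (min_le_left _ _)
  have hregion : ∀ φ, ∀ ρ ∈ Ioo 0 (min e eV), (φ, ρ) ∈ region p q r P Q eV := fun φ ρ hρ ↦
    ⟨hρ.1, hρ.2.trans_le (min_le_right _ _), he.Theta_ne_zero φ ρ hρ⟩
  exact ⟨_, he, hVc.mono fun z hz ↦ hregion z.1 z.2 hz.2, fun φ ρ hρ ↦ hpde _ (hregion φ ρ hρ)⟩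

lemma periodic_mem_Omega : Periodic (· ∈ Omega p q r P Q) (2 * Real.pi) := fun φ ↦ by
  simp [Omega, Theta_add_two_pi]

lemma IsRegularStrip.leading_coeff_ne_zero (h : IsRegularStrip p q r P Q e)
    (hr : IsLeadingDegree p q r P Q) (hPi : IsPoincareMap p q r P Q Pi)
    (hV : IsInvIntFactorOn (F p q r P Q) (Ioo 0 e) V) (hVper : Periodic V (2 * Real.pi))
    {v : ℝ → ℝ}
    (hlim : ∀ φ ∉ Omega p q r P Q, Tendsto (fun ρ ↦ V φ ρ / ρ ^ m) (𝓝[>] 0) (𝓝 (v φ)))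
    {φ : ℝ} (hφ : ∀ ψ ∈ uIcc 0 φ, ψ ∉ Omega p q r P Q) (hv : v φ ≠ 0) : v 0 ≠ 0 := by
  intro hv0
  have hlim0 : Tendsto (fun ρ ↦ V 0 ρ / ρ ^ m) (𝓝[>] 0) (𝓝 0) := by
    simpa only [hv0] using hlim 0 (hφ 0 left_mem_uIcc)
  obtain ⟨n, hn, -⟩ := existsUnique_sub_zsmul_mem_Ico Real.two_pi_pos φ 0
  have hlimφ := hlim φ (hφ φ right_mem_uIcc)
  rw [← hVper.sub_zsmul_eq n] at hlimφ
  have hpi := Real.two_pi_pos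
  rw [zero_add, mem_Ico] at hn
  rcases le_or_gt 0 n with h0 | h0
  · have hshift : 0 ≤ n • (2 * Real.pi) := zsmul_nonneg hpi.le h0
    rw [uIcc_of_le (by linarith)] at hφ
    exact hv (h.leading_coeff_eq_zero hr hPi hV le_rfl hn.2.le
      (fun ψ hψ ↦ hφ ψ ⟨hψ.1, by linarith [hψ.2]⟩)
      (left_mem_Icc.2 hn.1) (right_mem_Icc.2 hn.1) hlim0 hlimφ)
  · have hshift : n • (2 * Real.pi) ≤ -(2 * Real.pi) := by
      simpa using zsmul_le_zsmul_left hpi.le (show n ≤ -1 by lia)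
    rw [uIcc_of_ge (by linarith)] at hφ
    rw [← hVper 0, zero_add] at hlim0
    exact hv (h.leading_coeff_eq_zero hr hPi hV hn.1 le_rfl
      (fun ψ hψ hψΩ ↦ hφ (ψ - 2 * Real.pi) ⟨by linarith [hψ.1], by linarith [hψ.2]⟩
        ((periodic_mem_Omega.sub_eq ψ).mpr hψΩ))
      (right_mem_Icc.2 hn.2.le) (left_mem_Icc.2 hn.2.le) hlim0 hlimφ)

lemma IsLaurentInvIntFactor.exists_eqOn_zpow_mul (hV : IsLaurentInvIntFactor p q r P Q V m)
    (h : IsRegularStrip p q r P Q e) (hr : IsLeadingDegree p q r P Q)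
    (hPi : IsPoincareMap p q r P Q Pi) (hVe : IsInvIntFactorOn (F p q r P Q) (Ioo 0 e) V) :
    ∃ g : ℝ → ℝ, AnalyticAt ℝ g 0 ∧ g 0 ≠ 0 ∧ ∃ δ > 0,
      EqOn (V 0) (fun ρ ↦ ρ ^ m * g ρ) (Ioo 0 δ) := by
  obtain ⟨⟨hVper, -⟩, v, -, -, hsum, φ, hφ, hvφ⟩ := hV
  have hfactor : ∀ φ ∉ Omega p q r P Q, ∃ g : ℝ → ℝ, AnalyticAt ℝ g 0 ∧ g 0 = v m φ ∧ ∃ δ > 0,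
      EqOn (V φ) (fun ρ ↦ ρ ^ m * g ρ) (Ioo 0 δ) := fun φ hφ ↦ by
    obtain ⟨δ, hδ, hs⟩ := hsum φ hφ
    obtain ⟨g, hg, hg0, hVg⟩ := exists_analyticAt_zpow_mul_eq_of_hasSum
      (c := fun k ↦ v (m + k) φ) hδ fun ρ hρ ↦ hs ρ hρ.1 hρ.2
    exact ⟨g, hg, by simpa using hg0, δ, hδ, hVg⟩
  have hlim : ∀ φ ∉ Omega p q r P Q,
      Tendsto (fun ρ ↦ V φ ρ / ρ ^ m) (𝓝[>] 0) (𝓝 (v m φ)) := fun φ hφ ↦ by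
    obtain ⟨g, hg, hg0, δ, hδ, hVg⟩ := hfactor φ hφ
    rw [← hg0]
    refine (hg.continuousAt.tendsto.mono_left nhdsWithin_le_nhds).congr' ?_
    filter_upwards [Ioo_mem_nhdsGT hδ] with ρ hρ
    rw [hVg hρ, mul_div_cancel_left₀ _ (zpow_ne_zero m hρ.1.ne')]
  obtain ⟨g, hg, hg0, hVg⟩ := hfactor 0 (hφ 0 left_mem_uIcc)
  have hv0 := h.leading_coeff_ne_zero hr hPi hVe (fun φ ↦ funext (hVper φ)) hlim hφ hvφ
  exact ⟨g, hg, hg0 ▸ hv0, hVg⟩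

lemma IsPoincareMap.tendsto (hPi : IsPoincareMap p q r P Q Pi) :
    Tendsto Pi (𝓝[>] 0) (𝓝[>] 0) := by
  refine ((nhdsGT_basis 0).tendsto_iff (nhdsGT_basis 0)).2 fun ε hε ↦ ?_
  obtain ⟨δ, hδ, hsol⟩ := hPi.exists_isSolOn hε
  refine ⟨δ, hδ, fun ρ hρ ↦ ?_⟩
  obtain ⟨Φ, hΦ, -, hΦPi⟩ := hsol ρ hρ
  exact hΦPi ▸ hΦ.mem (right_mem_Icc.2 Real.two_pi_pos.le)

lemma IsPoincareMap.eventually_hasDerivAt_abs (hPi : IsPoincareMap p q r P Q Pi)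
    (h : IsRegularStrip p q r P Q e) (hV : IsInvIntFactorOn (F p q r P Q) (Ioo 0 e) V)
    (hVper : V (2 * Real.pi) = V 0) :
    ∀ᶠ x in 𝓝[>] 0, V 0 x ≠ 0 → HasDerivAt Pi |V 0 (Pi x) / V 0 x| x := by
  obtain ⟨δ, hδ, hsol⟩ := hPi.exists_isSolOn h.pos
  choose! Φ hΦ hΦ0 hΦPi using hsol
  filter_upwards [Ioo_mem_nhdsGT hδ] with x hx hVx
  have hnear : ∀ᶠ y in 𝓝 x, y ∈ Ioo 0 δ := Ioo_mem_nhds hx.1 hx.2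
  have hder := hV.hasDerivAt_flow h.contDiffOn_F isOpen_Ioo ordConnected_Ioo Real.two_pi_pos.le
    (hnear.mono fun y hy ↦ ⟨hΦ y hy, hΦ0 y hy⟩) hVx
  rw [hΦPi x hx, hVper] at hder
  exact hder.congr_of_eventuallyEq (hnear.mono fun y hy ↦ (hΦPi y hy).symm)

lemma IsPoincareMap.eventually_hasDerivAt (hPi : IsPoincareMap p q r P Q Pi)
    (h : IsRegularStrip p q r P Q e) (hV : IsInvIntFactorOn (F p q r P Q) (Ioo 0 e) V)
    (hVper : V (2 * Real.pi) = V 0) {g : ℝ → ℝ} (hg : ContinuousAt g 0) (hg0 : g 0 ≠ 0)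
    {δ : ℝ} (hδ : 0 < δ) (hVg : EqOn (V 0) (fun ρ ↦ ρ ^ m * g ρ) (Ioo 0 δ)) :
    ∀ᶠ x in 𝓝[>] 0, HasDerivAt Pi (Pi x ^ m * g (Pi x) / (x ^ m * g x)) x := by
  have hsign : ∀ᶠ x in 𝓝[>] (0 : ℝ), 0 < g x / g 0 :=
    ((hg.tendsto.mono_left nhdsWithin_le_nhds).div_const _).eventually_const_lt (by simp [hg0])
  have hδ' := Ioo_mem_nhdsGT hδ
  filter_upwards [hPi.eventually_hasDerivAt_abs h hV hVper, hsign, hPi.tendsto.eventually hsign,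
    hδ', hPi.tendsto.eventually hδ'] with x hder hgx hgPi hx hPix
  have hratio : 0 < Pi x ^ m * g (Pi x) / (x ^ m * g x) := by
    rw [mul_div_mul_comm, ← div_div_div_cancel_right₀ hg0 (g (Pi x))]
    exact mul_pos (div_pos (zpow_pos hPix.1 m) (zpow_pos hx.1 m)) (div_pos hgPi hgx)
  rw [hVg hx, hVg hPix, abs_of_pos hratio] at hder
  exact hder (div_ne_zero_iff.1 hratio.ne').2

end LaurentInverseIntegratingFactor

end Monodromic

end

open Monodromic in
theorem theorem2_general {p q r : ℕ} {P Q V : ℝ → ℝ → ℝ} {m : ℤ} (hp : 0 < p) (hq : 0 < q)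
    (hP : AnalyticAt ℝ (fun z : ℝ × ℝ ↦ P z.1 z.2) 0)
    (hQ : AnalyticAt ℝ (fun z : ℝ × ℝ ↦ Q z.1 z.2) 0)
    (hmono : IsMonodromic P Q) (hr : IsLeadingDegree p q r P Q)
    (hΘ : ¬ HasZeroAngularSpeed p q r P Q) (hV : IsLaurentInvIntFactor p q r P Q V m) :
    (∃ Pi : ℝ → ℝ, IsPoincareMap p q r P Q Pi) ∧
    ∀ Pi : ℝ → ℝ, IsPoincareMap p q r P Q Pi →
      ∃ η : ℕ → ℝ, HasFormalExpansion Pi η ∧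
        (m ≤ 0 → IsCenter P Q) ∧
        (1 < m →
          (∃ h : ℝ → ℝ, h =O[𝓝[>] 0] (fun ρ : ℝ ↦ ρ) ∧
            ∀ᶠ ρ in 𝓝[>] (0 : ℝ), Pi ρ = ρ + η m.toNat * ρ ^ m.toNat * (1 + h ρ)) ∧
          (η m.toNat = 0 → IsCenter P Q)) ∧
        (m = 1 → η 1 = 1 → IsCenter P Q) := by
  obtain ⟨_, h⟩ := exists_isRegularStrip hp hq hP hQ hΘ
  obtain ⟨e, he, hVe⟩ := h.exists_isInvIntFactorOn hV.1
  refine ⟨he.exists_isPoincareMap hmono, fun Pi hPi ↦ ?_⟩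
  have hcenter : (∀ᶠ ρ in 𝓝[>] 0, Pi ρ = ρ) → IsCenter P Q :=
    he.isCenter_of_poincareMap_eq_id hmono hPi
  have hVper : V (2 * Real.pi) = V 0 := funext fun ρ ↦ by simpa using hV.1.1 0 ρ
  obtain ⟨g, hg, hg0, δ, hδ, hVg⟩ := hV.exists_eqOn_zpow_mul he hr hPi hVe
  have hder := hPi.eventually_hasDerivAt he hVe hVper hg.continuousAt hg0 hδ hVg
  obtain ⟨η, hη, hnonpos, hlarge, hone⟩ := exists_hasFormalExpansion hg hg0 hPi.tendsto hder
  exact ⟨η, hη, hcenter ∘ hnonpos, fun hm ↦ (hlarge hm).imp_right (hcenter ∘ ·),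
    fun hm hη1 ↦ hcenter (hone hm hη1)⟩

theorem theorem2 {d : ℕ} (Λ : Set (Fin d → ℝ)) (P Q : (Fin d → ℝ) → ℝ → ℝ → ℝ)
    (p q : ℕ) (r : (Fin d → ℝ) → ℕ) (m : ℤ) (V : (Fin d → ℝ) → ℝ → ℝ → ℝ)
    (hP : ∀ l ∈ Λ, AnalyticAt ℝ
      (fun z : (Fin d → ℝ) × ℝ × ℝ => P z.1 z.2.1 z.2.2) (l, 0, 0))
    (hQ : ∀ l ∈ Λ, AnalyticAt ℝ
      (fun z : (Fin d → ℝ) × ℝ × ℝ => Q z.1 z.2.1 z.2.2) (l, 0, 0))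
    (hmono : ∀ l ∈ Λ, Monodromic.IsMonodromic (P l) (Q l))
    (hW : ∀ l ∈ Λ, (p, q) ∈ Monodromic.newtonWeights (P l) (Q l))
    (hr : ∀ l ∈ Λ, Monodromic.IsLeadingDegree p q (r l) (P l) (Q l))
    (h0 : ∀ l ∈ Λ, (0 : ℝ) ∉ Monodromic.Omega p q (r l) (P l) (Q l))
    (hV : ∀ l ∈ Λ \ Monodromic.criticalParams p q r P Q Λ,
      Monodromic.IsLaurentInvIntFactor p q (r l) (P l) (Q l) (V l) m) :
    ∀ l ∈ Λ \ Monodromic.criticalParams p q r P Q Λ,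
      (∃ Pi : ℝ → ℝ, Monodromic.IsPoincareMap p q (r l) (P l) (Q l) Pi) ∧
      ∀ Pi : ℝ → ℝ, Monodromic.IsPoincareMap p q (r l) (P l) (Q l) Pi →
        ∃ η : ℕ → ℝ, Monodromic.HasFormalExpansion Pi η ∧
          (m ≤ 0 → Monodromic.IsCenter (P l) (Q l)) ∧
          (1 < m →
            (∃ h : ℝ → ℝ, h =O[𝓝[>] 0] (fun ρ : ℝ => ρ) ∧
              ∀ᶠ ρ in 𝓝[>] (0 : ℝ), Pi ρ = ρ + η m.toNat * ρ ^ m.toNat * (1 + h ρ)) ∧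
            (η m.toNat = 0 → Monodromic.IsCenter (P l) (Q l))) ∧
          (m = 1 → η 1 = 1 → Monodromic.IsCenter (P l) (Q l)) := by
  exact fun l hl ↦ theorem2_general (hW l hl.1).1 (hW l hl.1).2.1 (hP l hl.1).along_snd
    (hQ l hl.1).along_snd (hmono l hl.1) (hr l hl.1) (fun h ↦ hl.2 ⟨hl.1, h⟩) (hV l hl)
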